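/- Let $d\ge 2$, and let $\epsilon^1,\dots,\epsilon^{d}$ be the standard generators of $\mathbb Z^d$, with $\epsilon^{i+d}=-\epsilon^{i}$ for $1\le i\le d$. Call a subset of $\mathbb Z^d$ connected if it is non-empty and induces a connected subgraph of the graph on $\mathbb Z^d$ with edges $\{\gamma,\gamma\pm\epsilon^i\}$. Let $X_{bi}$ be the (non-compact) space of directed bi-infinite Hamiltonian paths, that is, of all $x:\mathbb Z^d\to\{\epsilon^1,\dots,\epsilon^{2d}\}$ such that the graph on $\mathbb Z^d$ with directed edges $(\gamma,\gamma+x_\gamma)$ is a directed bi-infinite path. For $k\ge 1$, a finite set $B\subset\mathbb Z^d$ is a *$k$-grid union* if $B=\gamma+T+[1,k]^d$ for some $\gamma\in\mathbb Z^d$ and $T\subset k\mathbb Z^d$, and both $B$ and $\mathbb Z^d\setminus B$ are connected. **Theorem.** The space $X_{bi}$ has property $F$: there are integers $k\ge1$ and $m\ge0$ and sets $P_C\subset\{x|_C : x\in X_{bi}\}$, one for each $k$-grid union $C$, such that $P_{\alpha+C}$ is the set of translates by $\alpha$ of the elements of $P_C$ for all $C$ and all $\alpha\in\mathbb Z^d$,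 and 1. (extension) for every $r\ge 0$, all $k$-grid unions $C,C_1,\dots,C_r$ and all patterns $c_j\in P_{C_j}$ such that $C_1+[-m,m]^d,\dots,C_r+[-m,m]^d$ are pairwise disjoint and contained in $C$, there is $c\in P_C$ with $c|_{C_j}=c_j$ for $1\le j\le r$ (for $r=0$ this says that $P_C\neq\emptyset$); 2. (limits) if $x:\mathbb Z^d\to\{\epsilon^1,\dots,\epsilon^{2d}\}$ and there is an increasing sequence $B_1\subset B_2\subset\cdots$ of $k$-grid unions which cover $\mathbb Z^d$ with $x|_{B_n}\in P_{B_n}$ for all $n$, then $x\in X_{bi}$. -/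

import Mathlib

open scoped Pointwise

namespace GridShift

/-- The lattice `ℤ^d`. -/
abbrev Lattice (d : ℕ) : Type := Fin d → ℤ

/-- The undirected Cayley graph of `ℤ^d` for the standard generators: `γ` and `δ` are adjacent
exactly when they differ by a standard generator. -/
def cayleyGraph (d : ℕ) : SimpleGraph (Lattice d) where
  Adj γ δ := ∃ i : Fin d, δ = γ + Pi.single i 1 ∨ γ = δ + Pi.single i 1
  symm := ⟨fun _ _ ⟨i, h⟩ => ⟨i, h.symm⟩⟩
  loopless := ⟨fun γ ⟨i, h⟩ => by
    have h1 : γ = γ + Pi.single i 1 := h.elim id id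
    have h2 := congrFun h1 i
    simp at h2⟩

/-- A (finite, non-empty) set `B ⊆ ℤ^d` is a `k`-grid union if `B = γ + T + [1,k]^d` for some
offset `γ ∈ ℤ^d` and some `T ⊆ kℤ^d`, and both `B` and `ℤ^d \ B` are connected, i.e. induce
connected subgraphs of the Cayley graph. -/
def IsGridUnion {d : ℕ} (k : ℕ) (B : Finset (Lattice d)) : Prop :=
  (∃ (γ : Lattice d) (T : Set (Lattice d)),
    (∀ t ∈ T, ∀ i, (k : ℤ) ∣ t i) ∧
    (B : Set (Lattice d)) = {γ} + T + Set.Icc (fun _ => (1 : ℤ)) (fun _ => (k : ℤ))) ∧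
  ((cayleyGraph d).induce (B : Set (Lattice d))).Connected ∧
  ((cayleyGraph d).induce ((B : Set (Lattice d))ᶜ)).Connected

/-- The thickening `B + [-m,m]^d`. -/
def thicken {d : ℕ} (m : ℕ) (B : Finset (Lattice d)) : Set (Lattice d) :=
  (B : Set (Lattice d)) + Set.Icc (fun _ => -(m : ℤ)) (fun _ => (m : ℤ))

/-- The language `L(X, C) = {x|_C : x ∈ X}` of a set of configurations on a finite set `C`. -/
def language {d : ℕ} {A : Type} (X : Set (Lattice d → A)) (C : Finset (Lattice d)) :
    Set (C → A) :=
  {p | ∃ x ∈ X, C.restrict x = p}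

/-- The translate by `α` of a pattern on `C`; it is a pattern on `α + C`. -/
def translate {d : ℕ} {A : Type} (α : Lattice d) {C : Finset (Lattice d)} (p : C → A) :
    (α +ᵥ C : Finset (Lattice d)) → A :=
  fun δ => p ⟨-α + δ.1, by
    obtain ⟨c, hc, h⟩ := Finset.mem_vadd_finset.1 δ.2
    rw [← h, vadd_eq_add, neg_add_cancel_left]
    exact hc⟩

/-- `P` assigns to each `k`-grid union `C` a set `P C ⊆ L(X, C)`, compatibly with translations:
a translation-equivariant family of patterns of `X` over the `k`-grid unions.  Only the values of
`P` at `k`-grid unions matter. -/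
def IsPatternFamily {d : ℕ} {A : Type} (X : Set (Lattice d → A)) (k : ℕ)
    (P : (C : Finset (Lattice d)) → Set (C → A)) : Prop :=
  (∀ C, IsGridUnion k C → P C ⊆ language X C) ∧
  (∀ C, IsGridUnion k C → ∀ α : Lattice d, P (α +ᵥ C) = translate α '' P C)

/-- The extension property with gap `m`: if `C, C₁, …, C_r` are `k`-grid unions, `c_j ∈ P_{C_j}`,
and the sets `C_j + [-m,m]^d` are pairwise disjoint and contained in `C`, then some `c ∈ P_C`
restricts to `c_j` on `C_j` for every `j`.  The case `r = 0` says that `P_C` is non-empty. -/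
def HasExtension {d : ℕ} {A : Type} (k m : ℕ)
    (P : (C : Finset (Lattice d)) → Set (C → A)) : Prop :=
  ∀ (C : Finset (Lattice d)) (r : ℕ) (D : Fin r → Finset (Lattice d))
    (p : (j : Fin r) → D j → A),
    IsGridUnion k C → (∀ j, IsGridUnion k (D j)) → (∀ j, p j ∈ P (D j)) →
    (∀ i j, i ≠ j → Disjoint (thicken m (D i)) (thicken m (D j))) →
    (∀ j, thicken m (D j) ⊆ (C : Set (Lattice d))) →
    ∃ c ∈ P C, ∀ (j : Fin r) (δ : Lattice d) (hD : δ ∈ D j) (hC : δ ∈ C),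
      c ⟨δ, hC⟩ = p j ⟨δ, hD⟩

/-- The limit property: a configuration whose restrictions to an increasing sequence of `k`-grid
unions covering `ℤ^d` belong to the family is an element of `X`. -/
def HasLimits {d : ℕ} {A : Type} (X : Set (Lattice d → A)) (k : ℕ)
    (P : (C : Finset (Lattice d)) → Set (C → A)) : Prop :=
  ∀ (x : Lattice d → A) (C : ℕ → Finset (Lattice d)),
    (∀ n, IsGridUnion k (C n)) → Monotone C → (∀ δ, ∃ n, δ ∈ C n) →
    (∀ n, (C n).restrict x ∈ P (C n)) → x ∈ X

/-- A symbolic system `X ⊆ A^{ℤ^d}` has property `F` if, for some `k ≥ 1` and some gap `m`, there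
is a family of patterns of `X` over the `k`-grid unions which has property `F` with gap `m`. -/
def HasPropertyF {d : ℕ} {A : Type} (X : Set (Lattice d → A)) : Prop :=
  ∃ k m : ℕ, 1 ≤ k ∧ ∃ P : (C : Finset (Lattice d)) → Set (C → A),
    IsPatternFamily X k P ∧ HasExtension k m P ∧ HasLimits X k P

/-- The alphabet `{ε¹, …, ε^{2d}}` of the `2d` unit vectors of `ℤ^d`. -/
abbrev UnitVector (d : ℕ) : Type :=
  {v : Lattice d // ∃ i : Fin d, v = Pi.single i 1 ∨ v = -Pi.single i 1}

/-- The space of directed bi-infinite Hamiltonian paths in `ℤ^d`: all `x` such that the graph on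
`ℤ^d` with directed edges `(γ, γ + x_γ)` is a directed bi-infinite path, i.e. the vertices can be
enumerated bijectively by `ℤ` so that the edges are those from each vertex to the next one. -/
def hamiltonianPaths (d : ℕ) : Set (Lattice d → UnitVector d) :=
  {x | ∃ e : ℤ ≃ Lattice d, ∀ n : ℤ, e (n + 1) = e n + (x (e n)).1}

end GridShift

/-! Write ε⁰, ε¹, … for the generators and call ε⁰ the upward direction. Take k = m = 32, and let
P_C consist of the patterns of good tours: Hamiltonian paths of C from a point s of maximal height
to s + ε¹, followed by a step up out of C. Both ends lie at the top of C. In an increasing union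
every point is therefore eventually interior to the paths, and any two points lie on a common path;
this gives the limit property (`hasLimits_tourPatterns`). Extending a pattern over larger and larger
cubes and passing to the limit shows that it occurs in X_bi.

The extension property asks for a good tour of C that contains given good tours w_j of far apart
sets D_j, each with its exit upwards. Cut C into tiles and enlarge a tour of the first tile by one
tile at a time (`exists_tour_of_attach`). If the tour passes through v, and v + e lies in a new
tile, then one of the two steps at v is transversal to e. It is replaced by a detour: a step e, a
tour of the tile between the two shifted points, a step -e (`exists_tour_attach`). For a box with a
facet of side 4 such tours exist: the facet has a Hamiltonian path with an even number of points
through a prescribed edge at its centre, the comb over this path is a Hamiltonian cycle of the box,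
and the cycle is cut at that edge (`exists_comb`, `attach_box`). The set D_j and the box above its
starting point form a single tile: the first two teeth of the comb end above the two ends of w_j,
and w_j is inserted between their tips (`attach_tip_box`).

In dimension two a facet is a segment and leaves no freedom of direction. There all tours keep the
squares to their left inside the region (`Ccw`), so that e points to the right of the tour at every
exit; this fixes the direction in which the next tile is traversed, and the ends of w_j fit it.

The grids of C and of the D_j need not match. So D_j is thickened in one coordinate after the other
until it is a union of cells of side 4 of the grid of C. The difference of successive layers is cut
into boxes whose outer facets face points outside the larger layer. Every tile can be reached: the
cells outside all layers are connected with each other, by a cohomological argument modulo 2 that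
uses the connectedness of the complements of the D_j (`Linked.diff_iUnion`), and the layers are then
entered from the outside inwards (`Setting.exists_attach`). -/

namespace GridShift

/-! ### Lists as paths: consecutive entries, tours and insertion -/

section Lists

variable {α β : Type*}

/-- `x` and `y` are consecutive entries of the list `l`. -/
def Consec (l : List α) (x y : α) : Prop := ∃ s t, l = s ++ x :: y :: t

theorem consec_nil (x y : α) : ¬ Consec ([] : List α) x y := by
  rintro ⟨s, t, h⟩
  simp at h

theorem consec_cons {c : α} {l : List α} {x y : α} :
    Consec (c :: l) x y ↔ (x = c ∧ l.head? = some y) ∨ Consec l x y := by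
  constructor
  · rintro ⟨s, t, h⟩
    cases s with
    | nil => simp at h; left; simp [h]
    | cons b s => simp at h; right; exact ⟨s, t, h.2⟩
  · rintro (⟨rfl, h⟩ | ⟨s, t, rfl⟩)
    · cases l with
      | nil => simp at h
      | cons b l => simp at h; subst h; exact ⟨[], l, rfl⟩
    · exact ⟨c :: s, t, rfl⟩

theorem consec_singleton (c x y : α) : ¬ Consec [c] x y := by
  simp [consec_cons, consec_nil]

theorem consec_append {l m : List α} {x y : α} :
    Consec (l ++ m) x y ↔
      Consec l x y ∨ Consec m x y ∨ (l.getLast? = some x ∧ m.head? = some y) := by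
  induction l with
  | nil => simp [consec_nil]
  | cons c l ih =>
    cases l with
    | nil => simp [consec_cons, consec_nil, eq_comm]; tauto
    | cons b l =>
      rw [List.cons_append, consec_cons, ih, consec_cons (c := c)]
      simp
      tauto

theorem consec_reverse {l : List α} {x y : α} : Consec l.reverse x y ↔ Consec l y x := by
  induction l with
  | nil => simp [consec_nil]
  | cons c l ih =>
    rw [List.reverse_cons, consec_append, ih, consec_cons (c := c)]
    simp [consec_cons, consec_nil, eq_comm]
    tauto

theorem consec_map {f : α → β} {l : List α} {x y : β} :
    Consec (l.map f) x y ↔ ∃ a b, Consec l a b ∧ f a = x ∧ f b = y := by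
  induction l with
  | nil => simp [consec_nil]
  | cons c l ih =>
    rw [List.map_cons, consec_cons, ih]
    constructor
    · rintro (⟨rfl, h⟩ | ⟨a, b, h, rfl, rfl⟩)
      · cases l with
        | nil => simp at h
        | cons d l => exact ⟨c, d, consec_cons.2 (Or.inl ⟨rfl, rfl⟩), rfl, by simpa using h⟩
      · exact ⟨a, b, consec_cons.2 (Or.inr h), rfl, rfl⟩
    · rintro ⟨a, b, h, rfl, rfl⟩
      rcases consec_cons.1 h with ⟨rfl, h'⟩ | h
      · left; simp [h']
      · right; exact ⟨a, b, h, rfl, rfl⟩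

theorem Consec.mem_left {l : List α} {x y : α} (h : Consec l x y) : x ∈ l := by
  obtain ⟨s, t, rfl⟩ := h; simp

theorem Consec.mem_right {l : List α} {x y : α} (h : Consec l x y) : y ∈ l := by
  obtain ⟨s, t, rfl⟩ := h; simp

theorem consec_insert {l₁ l₂ p : List α} {a b x y : α} (h : Consec (l₁ ++ a :: b :: l₂) x y)
    (hne : ¬ (x = a ∧ y = b)) : Consec (l₁ ++ a :: (p ++ b :: l₂)) x y := by
  rw [consec_append, consec_cons] at *
  rw [consec_append]
  simp at *
  tauto

/-- An element of a list that is not its last one has a successor. -/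
theorem exists_consec_right {l : List α} {x : α} (hx : x ∈ l) (hl : l.getLast? ≠ some x) :
    ∃ y, Consec l x y := by
  obtain ⟨s, t, rfl⟩ := List.append_of_mem hx
  cases t with
  | nil => simp at hl
  | cons y t => exact ⟨y, s, t, rfl⟩

theorem exists_consec_left {l : List α} {x : α} (hx : x ∈ l) (hl : l.head? ≠ some x) :
    ∃ y, Consec l y x := by
  have := exists_consec_right (l := l.reverse) (x := x) (by simpa using hx) (by simpa using hl)
  obtain ⟨y, hy⟩ := this
  exact ⟨y, consec_reverse.1 hy⟩

theorem Consec.right_unique {l : List α} (hl : l.Nodup) {x y z : α} (h : Consec l x y)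
    (h' : Consec l x z) : y = z := by
  induction l with
  | nil => exact absurd h (consec_nil _ _)
  | cons c l ih =>
    rw [List.nodup_cons] at hl
    rcases consec_cons.1 h with ⟨rfl, h1⟩ | h1 <;> rcases consec_cons.1 h' with ⟨h2, h3⟩ | h3
    · simpa [h1] using h3
    · exact absurd h3.mem_left hl.1
    · subst h2; exact absurd h1.mem_left hl.1
    · exact ih hl.2 h1 h3

theorem Consec.left_unique {l : List α} (hl : l.Nodup) {x y z : α} (h : Consec l x z)
    (h' : Consec l y z) : x = y :=
  Consec.right_unique (List.nodup_reverse.2 hl) (consec_reverse.2 h) (consec_reverse.2 h')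

theorem Consec.asymm {l : List α} (hl : l.Nodup) {x y : α} (h : Consec l x y)
    (h' : Consec l y x) : False := by
  induction l with
  | nil => exact absurd h (consec_nil _ _)
  | cons c l ih =>
    rw [List.nodup_cons] at hl
    rcases consec_cons.1 h with ⟨rfl, h1⟩ | h1 <;> rcases consec_cons.1 h' with ⟨h2, h3⟩ | h3
    · subst h2; exact hl.1 (List.mem_of_head? h1)
    · exact hl.1 h3.mem_right
    · subst h2; exact hl.1 h1.mem_right
    · exact ih hl.2 h1 h3

/-- The predecessor of a non-initial entry and the successor of a non-final entry differ. -/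
theorem Consec.left_ne_right {l : List α} (hl : l.Nodup) {u v w : α} (h : Consec l u v)
    (h' : Consec l v w) : u ≠ w := by
  rintro rfl
  exact h.asymm hl h'

theorem head?_not_consec {l : List α} (hl : l.Nodup) {x y : α} (h : l.head? = some y) :
    ¬ Consec l x y := by
  rintro ⟨s, t, rfl⟩
  cases s with
  | nil => simp at h; subst h; simp at hl
  | cons b s => simp at h; subst h; simp at hl

theorem getLast?_not_consec {l : List α} (hl : l.Nodup) {x y : α} (h : l.getLast? = some x) :
    ¬ Consec l x y := fun h' =>
  head?_not_consec (l := l.reverse) (List.nodup_reverse.2 hl) (by simpa using h)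
    (consec_reverse.2 h')

/-- `l` enumerates the set `S` without repetitions, consecutive entries being related by `R`. -/
structure IsTour (R : α → α → Prop) (S : Set α) (l : List α) : Prop where
  nodup : l.Nodup
  rel : ∀ x y, Consec l x y → R x y
  mem : ∀ x, x ∈ l ↔ x ∈ S

theorem IsTour.reverse {R : α → α → Prop} {S : Set α} {l : List α} (h : IsTour R S l) :
    IsTour (fun x y => R y x) S l.reverse where
  nodup := List.nodup_reverse.2 h.nodup
  rel x y hxy := h.rel y x (consec_reverse.1 hxy)
  mem x := by rw [List.mem_reverse, h.mem]

theorem IsTour.mono {R R' : α → α → Prop} {S : Set α} {l : List α} (h : IsTour R S l)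
    (hR : ∀ x y, R x y → R' x y) : IsTour R' S l :=
  ⟨h.nodup, fun x y hxy => hR x y (h.rel x y hxy), h.mem⟩

/-- A tour of `B` may be inserted between two consecutive entries of a tour of `S`. -/
theorem IsTour.insert {R R' R'' : α → α → Prop} {S B : Set α} {l₁ l₂ p : List α} {a b a' b' : α}
    (hl : IsTour R S (l₁ ++ a :: b :: l₂)) (hp : IsTour R' B p) (hd : Disjoint S B)
    (hh : p.head? = some a') (hla : p.getLast? = some b')
    (h1 : ∀ x y, R x y → R'' x y) (h2 : ∀ x y, R' x y → R'' x y)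
    (ha : R'' a a') (hb : R'' b' b) :
    IsTour R'' (S ∪ B) (l₁ ++ a :: (p ++ b :: l₂)) := by
  have hS : ∀ x, x ∈ B → x ∉ S := fun x hx hx' => Set.disjoint_left.1 hd hx' hx
  have hdis : ∀ x ∈ p, x ∉ l₁ ++ a :: b :: l₂ := fun x hx hx' =>
    hS x ((hp.mem x).1 hx) ((hl.mem x).1 hx')
  refine ⟨?_, ?_, ?_⟩
  · have := hl.nodup
    have hp' := hp.nodup
    have hperm : (l₁ ++ a :: (p ++ b :: l₂)).Perm (p ++ (l₁ ++ a :: b :: l₂)) := by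
      have : (l₁ ++ a :: (p ++ b :: l₂)) = (l₁ ++ [a]) ++ (p ++ b :: l₂) := by simp
      rw [this]
      refine (List.Perm.append_left _ List.perm_append_comm).trans ?_
      rw [← List.append_assoc]
      refine List.perm_append_comm.trans ?_
      simp
    rw [hperm.nodup_iff, List.nodup_append]
    exact ⟨hp', this, fun x hx y hy hxy => hdis x hx (hxy ▸ hy)⟩
  · intro x y hxy
    have key : ∀ x y, Consec (l₁ ++ a :: b :: l₂) x y → R'' x y := fun x y h => h1 _ _ (hl.rel _ _ h)
    have e1 : ∀ x y, Consec l₁ x y → R'' x y := fun x y h => key _ _ (consec_append.2 (Or.inl h))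
    have e2 : ∀ x y, Consec (b :: l₂) x y → R'' x y := fun x y h =>
      key _ _ (consec_append.2 (Or.inr (Or.inl (consec_cons.2 (Or.inr h)))))
    rw [consec_append, consec_cons, consec_append] at hxy
    simp only [List.head?_append, hh, hla] at hxy
    rcases hxy with h | (⟨rfl, h⟩ | h | h | ⟨h, h'⟩) | ⟨h, h'⟩
    · exact e1 _ _ h
    · simp at h; exact h ▸ ha
    · exact h2 _ _ (hp.rel _ _ h)
    · exact e2 _ _ h
    · simp at h h'; subst h; subst h'; exact hb
    · simp at h'; subst h'
      exact key _ _ (consec_append.2 (Or.inr (Or.inr ⟨h, rfl⟩)))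
  · intro x
    have := hl.mem x
    have h3 := hp.mem x
    simp only [List.mem_append, List.mem_cons, Set.mem_union] at *
    rw [← this, ← h3]
    tauto

end Lists

end GridShift

namespace GridShift

/-! ### Combs over a path -/

section Comb

variable {d : ℕ}

/-- The column of height `H` over `x` in the direction `e`, without `x` itself. -/
def column (e : Lattice d) (H : ℕ) (x : Lattice d) : List (Lattice d) :=
  (List.range H).map fun c : ℕ => x + ((c : ℤ) + 1) • e

theorem mem_column {e : Lattice d} {H : ℕ} {x z : Lattice d} :
    z ∈ column e H x ↔ ∃ c : ℕ, c < H ∧ z = x + ((c : ℤ) + 1) • e := by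
  simp [column, eq_comm]

theorem consec_range {H x y : ℕ} : Consec (List.range H) x y ↔ y = x + 1 ∧ y < H := by
  induction H with
  | zero => simp [consec_nil]
  | succ H ih =>
    rw [List.range_succ, consec_append, ih]
    simp only [consec_singleton, false_or, List.head?_cons, Option.some.injEq]
    cases H with
    | zero => simp; omega
    | succ H => simp [List.range_succ]; omega

theorem consec_column {e : Lattice d} {H : ℕ} {x u v : Lattice d}
    (h : Consec (column e H x) u v) :
    ∃ c : ℕ, c + 1 < H ∧ u = x + ((c : ℤ) + 1) • e ∧ v = x + ((c : ℤ) + 2) • e := by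
  obtain ⟨a, b, hab, rfl, rfl⟩ := consec_map.1 h
  obtain ⟨rfl, hb⟩ := consec_range.1 hab
  refine ⟨a, hb, rfl, ?_⟩
  push_cast
  ring_nf

theorem head?_column {e : Lattice d} {H : ℕ} (x : Lattice d) :
    (column e (H + 1) x).head? = some (x + e) := by
  simp [column, List.range_succ_eq_map]

theorem getLast?_column {e : Lattice d} {H : ℕ} (x : Lattice d) :
    (column e (H + 1) x).getLast? = some (x + ((H : ℤ) + 1) • e) := by
  simp [column, List.range_succ]

/-- The columns over the entries of `l`, traversed in pairs from the end of `l` to its beginning,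
away from `l` over the second entry of each pair and back over the first one. -/
def teeth (e : Lattice d) (H : ℕ) : List (Lattice d) → List (Lattice d)
  | x :: y :: l => teeth e H l ++ (column e H y ++ (column e H x).reverse)
  | _ => []

theorem mem_teeth {e : Lattice d} {H : ℕ} {z : Lattice d} : ∀ {l : List (Lattice d)},
    Even l.length → (z ∈ teeth e H l ↔ ∃ x ∈ l, ∃ c : ℕ, c < H ∧ z = x + ((c : ℤ) + 1) • e)
  | [], _ => by simp [teeth]
  | [x], h => by simp at h
  | x :: y :: l, h => by
    have hl : Even l.length := by simpa [Nat.even_add_one, parity_simps] using h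
    simp only [teeth, List.mem_append, mem_teeth hl, mem_column, List.mem_reverse, List.mem_cons]
    constructor
    · rintro (⟨w, hw, h⟩ | h | h)
      · exact ⟨w, Or.inr (Or.inr hw), h⟩
      · exact ⟨y, Or.inr (Or.inl rfl), h⟩
      · exact ⟨x, Or.inl rfl, h⟩
    · rintro ⟨w, rfl | rfl | hw, h'⟩
      · exact Or.inr (Or.inr h')
      · exact Or.inr (Or.inl h')
      · exact Or.inl ⟨w, hw, h'⟩

theorem head?_teeth {e : Lattice d} {H : ℕ} : ∀ {l : List (Lattice d)},
    Even l.length → (teeth e (H + 1) l).head? = l.getLast?.map (· + e)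
  | [], _ => by simp [teeth]
  | [x], h => by simp at h
  | [x, y], _ => by simp [teeth, head?_column]
  | x :: y :: z :: l, h => by
    have hl : Even (z :: l).length := by simpa [Nat.even_add_one, parity_simps] using h
    rw [teeth, List.head?_append, head?_teeth hl]
    simp only [List.getLast?_cons_cons]
    cases h' : (z :: l).getLast? with
    | none => simp at h'
    | some w => simp

theorem getLast?_teeth {e : Lattice d} {H : ℕ} : ∀ {l : List (Lattice d)},
    Even l.length → (teeth e (H + 1) l).getLast? = l.head?.map (· + e)
  | [], _ => by simp [teeth]
  | [x], h => by simp at h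
  | x :: y :: l, h => by
    simp [teeth, head?_column]

/-- The facts about a pair of consecutive entries of the spine that make a comb a tour. -/
def CombRel (R : Lattice d → Lattice d → Prop) (e : Lattice d) (H : ℕ) (x y : Lattice d) : Prop :=
  R x y ∧ (∀ c : ℕ, c < H → R (y + ((c : ℤ) + 1) • e) (x + ((c : ℤ) + 1) • e)) ∧
  ∀ c : ℕ, c < H → R (y + (c : ℤ) • e) (y + ((c : ℤ) + 1) • e) ∧
    R (x + ((c : ℤ) + 1) • e) (x + (c : ℤ) • e)

theorem consec_teeth {e : Lattice d} {H : ℕ} {R : Lattice d → Lattice d → Prop} :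
    ∀ {l : List (Lattice d)}, Even l.length →
      (∀ x y, Consec l x y → CombRel R e (H + 1) x y) →
      ∀ u v, Consec (teeth e (H + 1) l) u v → R u v
  | [], _, _ => fun u v h => absurd h (consec_nil _ _)
  | [x], h, _ => by simp at h
  | x :: y :: l, h, hR => by
    intro u v huv
    have hl : Even l.length := by simpa [Nat.even_add_one, parity_simps] using h
    have hxy : CombRel R e (H + 1) x y := hR x y ⟨[], l, rfl⟩
    rw [teeth, consec_append, consec_append] at huv
    rcases huv with huv | (huv | huv | ⟨h1, h2⟩) | ⟨h1, h2⟩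
    · exact consec_teeth hl
        (fun a b hab => hR a b (consec_cons.2 (Or.inr (consec_cons.2 (Or.inr hab))))) u v huv
    · obtain ⟨c, hc, rfl, rfl⟩ := consec_column huv
      have := (hxy.2.2 (c + 1) hc).1
      push_cast at this
      rwa [add_assoc] at this
    · obtain ⟨c, hc, rfl, rfl⟩ := consec_column (consec_reverse.1 huv)
      have := (hxy.2.2 (c + 1) hc).2
      push_cast at this
      rwa [add_assoc] at this
    · rw [getLast?_column] at h1
      simp only [List.head?_reverse, getLast?_column, Option.some.injEq] at h1 h2
      subst h1 h2
      exact hxy.2.1 H (Nat.lt_succ_self H)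
    · rw [getLast?_teeth hl] at h1
      rw [List.head?_append, head?_column] at h2
      simp only [Option.some_or, Option.some.injEq] at h2
      subst h2
      cases l with
      | nil => simp at h1
      | cons z l =>
        simp at h1
        subst h1
        have hyz : CombRel R e (H + 1) y z := hR y z ⟨[x], l, rfl⟩
        simpa using hyz.2.1 0 (Nat.succ_pos H)

theorem nodup_column {e : Lattice d} {H : ℕ} {x : Lattice d}
    (hinj : ∀ c c' : ℕ, x + (c : ℤ) • e = x + (c' : ℤ) • e → c = c') : (column e H x).Nodup := by
  refine List.Nodup.map_on ?_ List.nodup_range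
  intro a _ b _ hab
  have := hinj (a + 1) (b + 1) (by push_cast; exact hab)
  omega

theorem nodup_teeth {e : Lattice d} {H : ℕ} : ∀ {l : List (Lattice d)},
    Even l.length → l.Nodup →
    (∀ x ∈ l, ∀ y ∈ l, ∀ c c' : ℕ, x + (c : ℤ) • e = y + (c' : ℤ) • e → x = y ∧ c = c') →
    (teeth e H l).Nodup
  | [], _, _, _ => by simp [teeth]
  | [x], h, _, _ => by simp at h
  | x :: y :: l, h, hn, hinj => by
    have hl : Even l.length := by simpa [Nat.even_add_one, parity_simps] using h
    have inj' : ∀ x' ∈ x :: y :: l, ∀ y' ∈ x :: y :: l, ∀ c c' : ℕ,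
        x' + ((c : ℤ) + 1) • e = y' + ((c' : ℤ) + 1) • e → x' = y' := by
      intro x' hx' y' hy' c c' h
      exact (hinj x' hx' y' hy' (c + 1) (c' + 1) (by push_cast; exact h)).1
    have hx : x ∈ x :: y :: l := by simp
    have hy : y ∈ x :: y :: l := by simp
    simp only [List.nodup_cons, List.mem_cons, not_or] at hn
    rw [teeth, List.nodup_append, List.nodup_append]
    refine ⟨nodup_teeth hl hn.2.2 fun a ha b hb => hinj a (by simp [ha]) b (by simp [hb]),
      ⟨nodup_column fun c c' h => (hinj y hy y hy c c' h).2,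
        List.nodup_reverse.2 (nodup_column fun c c' h => (hinj x hx x hx c c' h).2), ?_⟩, ?_⟩
    · intro a ha b hb hab
      obtain ⟨c, _, rfl⟩ := mem_column.1 ha
      obtain ⟨c', _, rfl⟩ := mem_column.1 (List.mem_reverse.1 hb)
      exact hn.1.1 (inj' y hy x hx c c' hab).symm
    · intro a ha b hb hab
      obtain ⟨w, hw, c, _, rfl⟩ := (mem_teeth hl).1 ha
      have hw' : w ∈ x :: y :: l := by simp [hw]
      rcases List.mem_append.1 hb with hb | hb
      · obtain ⟨c', _, rfl⟩ := mem_column.1 hb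
        exact hn.2.1 (inj' w hw' y hy c c' hab ▸ hw)
      · obtain ⟨c', _, rfl⟩ := mem_column.1 (List.mem_reverse.1 hb)
        exact hn.1.2 (inj' w hw' x hx c c' hab ▸ hw)

/-- A path of even length is the spine of a comb, which is a Hamiltonian cycle of a prism over the
path; cutting this cycle at a pair `b, a` of consecutive entries of the spine gives a tour from `a`
to `b`.  The tip of the column over the second entry of the spine is followed by the tip of the
column over the first one. -/
theorem exists_comb {R : Lattice d → Lattice d → Prop} {e : Lattice d} {H : ℕ}
    {l : List (Lattice d)} (hl : Even l.length) (hn : l.Nodup)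
    (hinj : ∀ x ∈ l, ∀ y ∈ l, ∀ c c' : ℕ, x + (c : ℤ) • e = y + (c' : ℤ) • e → x = y ∧ c = c')
    (hR : ∀ x y, Consec l x y → CombRel R e (H + 1) x y) {a b : Lattice d} (hba : Consec l b a) :
    ∃ p, IsTour R {z | ∃ x ∈ l, ∃ c : ℕ, c ≤ H + 1 ∧ z = x + (c : ℤ) • e} p ∧
      p.head? = some a ∧ p.getLast? = some b ∧
      ∀ x y l', l = x :: y :: l' →
        Consec p (y + ((H : ℤ) + 1) • e) (x + ((H : ℤ) + 1) • e) := by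
  have hne : l ≠ [] := by rintro rfl; exact consec_nil _ _ hba
  obtain ⟨l₁, l₂, hl12⟩ := id hba
  have hp1 : ∀ z ∈ a :: l₂, z ∈ l := by intro z hz; rw [hl12]; simp at hz ⊢; tauto
  have hp2 : ∀ z ∈ l₁ ++ [b], z ∈ l := by intro z hz; rw [hl12]; simp at hz ⊢; tauto
  have hsub1 : ∀ x y, Consec (a :: l₂) x y → Consec l x y := by
    intro x y h; rw [hl12]
    exact consec_append.2 (Or.inr (Or.inl (consec_cons.2 (Or.inr h))))
  have hsub2 : ∀ x y, Consec (l₁ ++ [b]) x y → Consec l x y := by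
    intro x y h
    have : l = (l₁ ++ [b]) ++ (a :: l₂) := by rw [hl12]; simp
    rw [this]
    exact consec_append.2 (Or.inl h)
  have hlast : (a :: l₂).getLast? = l.getLast? := by
    rw [hl12, List.getLast?_append, List.getLast?_cons_cons]
    simp [List.getLast?_cons]
  have hhead : (l₁ ++ [b]).head? = l.head? := by
    rw [hl12]; cases l₁ <;> simp
  have hmem : ∀ z, z ∈ (a :: l₂) ++ (teeth e (H + 1) l ++ (l₁ ++ [b])) ↔
      ∃ x ∈ l, ∃ c : ℕ, c ≤ H + 1 ∧ z = x + (c : ℤ) • e := by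
    intro z
    rw [List.mem_append, List.mem_append, mem_teeth hl]
    constructor
    · rintro (h | ⟨x, hx, c, hc, rfl⟩ | h)
      · exact ⟨z, hp1 z h, 0, by omega, by simp⟩
      · exact ⟨x, hx, c + 1, by omega, by push_cast; rfl⟩
      · exact ⟨z, hp2 z h, 0, by omega, by simp⟩
    · rintro ⟨x, hx, c, hc, rfl⟩
      cases c with
      | zero => rw [hl12] at hx; simp at hx ⊢; tauto
      | succ c => right; left; exact ⟨x, hx, c, by omega, by push_cast; rfl⟩
  have htd : ∀ z ∈ teeth e (H + 1) l, z ∉ l := by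
    intro z hz hz'
    obtain ⟨x, hx, c, hc, rfl⟩ := (mem_teeth hl).1 hz
    have := (hinj x hx _ hz' (c + 1) 0 (by push_cast; simp)).2
    omega
  -- Run along the spine from `a` to its end, return to its beginning over all the teeth, then run
  -- along the spine up to `b`. The evenness of the length lets the columns pair up into teeth.
  refine ⟨(a :: l₂) ++ (teeth e (H + 1) l ++ (l₁ ++ [b])), ⟨?_, ?_, hmem⟩, by simp,
    by rw [← List.append_assoc, ← List.append_assoc, List.getLast?_concat], ?_⟩
  · have hperm : ((a :: l₂) ++ (teeth e (H + 1) l ++ (l₁ ++ [b]))).Perm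
        (teeth e (H + 1) l ++ l) := by
      have : l = (l₁ ++ [b]) ++ (a :: l₂) := by rw [hl12]; simp
      refine List.perm_append_comm.trans ?_
      rw [List.append_assoc, ← this]
    rw [hperm.nodup_iff, List.nodup_append]
    exact ⟨nodup_teeth hl hn hinj, hn, fun x hx y hy hxy => htd x hx (hxy ▸ hy)⟩
  · intro x y hxy
    have hR1 : ∀ x y, Consec l x y → R x y := fun x y h => (hR x y h).1
    rw [consec_append, consec_append] at hxy
    rcases hxy with h | (h | h | ⟨h, h'⟩) | ⟨h, h'⟩
    · exact hR1 _ _ (hsub1 _ _ h)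
    · exact consec_teeth hl hR _ _ h
    · exact hR1 _ _ (hsub2 _ _ h)
    · rw [getLast?_teeth hl] at h
      rw [hhead] at h'
      rw [h'] at h
      simp at h
      subst h
      obtain ⟨z, hz⟩ : ∃ z, Consec l y z :=
        exists_consec_right (List.mem_of_head? h') (by
          intro h2
          cases l with
          | nil => exact hne rfl
          | cons c l =>
            simp at h'; subst h'
            cases l with
            | nil => simp at hl
            | cons c' l =>
              simp at hn
              rw [List.getLast?_cons_cons] at h2
              have := List.mem_of_getLast? h2
              simp at this; tauto)
      simpa using ((hR _ _ hz).2.2 0 (Nat.succ_pos _)).2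
    · rw [hlast] at h
      rw [List.head?_append, head?_teeth hl, h] at h'
      simp at h'
      subst h'
      obtain ⟨z, hz⟩ : ∃ z, Consec l z x :=
        exists_consec_left (List.mem_of_getLast? h) (by
          intro h2
          cases l with
          | nil => exact hne rfl
          | cons c l =>
            simp at h2; subst h2
            cases l with
            | nil => simp at hl
            | cons c' l =>
              simp at hn
              rw [List.getLast?_cons_cons] at h
              have := List.mem_of_getLast? h
              simp at this; tauto)
      simpa using ((hR _ _ hz).2.2 0 (Nat.succ_pos _)).1
  · rintro x y l' rfl
    rw [consec_append, consec_append]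
    right; left; left
    rw [teeth, consec_append]
    right; left
    rw [consec_append]
    right; right
    simp [getLast?_column]

end Comb

end GridShift

namespace GridShift

section Steps

variable {d : ℕ}

/-- The vectors `±ε^i`. -/
def IsStep (v : Lattice d) : Prop := ∃ (i : Fin d) (σ : ℤ), (σ = 1 ∨ σ = -1) ∧ v = Pi.single i σ

theorem IsStep.neg {v : Lattice d} (h : IsStep v) : IsStep (-v) := by
  obtain ⟨i, σ, hσ, rfl⟩ := h
  refine ⟨i, -σ, by omega, ?_⟩
  rw [Pi.single_neg]

/-- The relation of differing by a generator. -/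
def StepRel (x y : Lattice d) : Prop := IsStep (y - x)

theorem StepRel.symm {x y : Lattice d} (h : StepRel x y) : StepRel y x := by
  have := IsStep.neg h
  rwa [neg_sub] at this

theorem stepRel_add {x y v : Lattice d} : StepRel (x + v) (y + v) ↔ StepRel x y := by
  simp [StepRel]

theorem isStep_single (i : Fin d) {σ : ℤ} (hσ : σ = 1 ∨ σ = -1) :
    IsStep (Pi.single i σ : Lattice d) := ⟨i, σ, hσ, rfl⟩

end Steps

section Append

variable {α : Type*}

theorem IsTour.append {R : α → α → Prop} {S T : Set α} {l m : List α} (hl : IsTour R S l)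
    (hm : IsTour R T m) (hST : Disjoint S T)
    (h : ∀ x y, l.getLast? = some x → m.head? = some y → R x y) : IsTour R (S ∪ T) (l ++ m) where
  nodup := List.nodup_append.2 ⟨hl.nodup, hm.nodup, fun x hx y hy hxy =>
    Set.disjoint_left.1 hST ((hl.mem x).1 hx) (hxy ▸ (hm.mem y).1 hy)⟩
  rel x y hxy := by
    rcases consec_append.1 hxy with h1 | h1 | ⟨h1, h2⟩
    · exact hl.rel _ _ h1
    · exact hm.rel _ _ h1
    · exact h _ _ h1 h2
  mem x := by rw [List.mem_append, hl.mem, hm.mem, Set.mem_union]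

end Append

/-! ### Snake-like tours of the faces of a cube of side 4 -/

section Snake

variable {d : ℕ}

/-- The face at `o`, in the coordinates `A`, of a cube of side `4`. -/
def face (A : Finset (Fin d)) (o : Lattice d) : Set (Lattice d) :=
  {x | ∀ a, (a ∈ A → 0 ≤ x a - o a ∧ x a - o a < 4) ∧ (a ∉ A → x a = o a)}

theorem IsTour.shift {S : Set (Lattice d)} {l : List (Lattice d)} (hl : IsTour StepRel S l)
    (v : Lattice d) : IsTour StepRel {x | x - v ∈ S} (l.map (· + v)) where
  nodup := hl.nodup.map (add_left_injective v)
  rel x y hxy := by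
    obtain ⟨a, b, hab, rfl, rfl⟩ := consec_map.1 hxy
    exact stepRel_add.2 (hl.rel _ _ hab)
  mem x := by
    rw [List.mem_map]
    constructor
    · rintro ⟨a, ha, rfl⟩
      simpa using (hl.mem a).1 ha
    · intro h
      exact ⟨x - v, (hl.mem _).2 h, by simp⟩

theorem isTour_rev {S : Set (Lattice d)} {l : List (Lattice d)} (hl : IsTour StepRel S l) :
    IsTour StepRel S l.reverse := hl.reverse.mono fun _ _ h => StepRel.symm h

theorem stepRel_single_succ {x : Lattice d} {c : Fin d} {k k' : ℤ} (h : k' = k + 1) :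
    StepRel (x + Pi.single c k) (x + Pi.single c k') := by
  refine ⟨c, 1, Or.inl rfl, ?_⟩
  rw [add_sub_add_left_eq_sub, ← Pi.single_sub, h]
  simp

/-- A tour of a face extends to a tour of the face with one more coordinate, traversing the four
layers alternately forwards and backwards. -/
theorem exists_snake {A : Finset (Fin d)} {o : Lattice d} {l : List (Lattice d)}
    (hl : IsTour StepRel (face A o) l) {c : Fin d} (hc : c ∉ A) :
    ∃ m, IsTour StepRel (face (insert c A) o) (l ++ m) ∧ (Even l.length → Even (l ++ m).length) ∧
      ∀ x y, Consec l x y →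
        Consec (l ++ m) (y + Pi.single c 1) (x + Pi.single c 1) ∧
        Consec (l ++ m) (x + Pi.single c 2) (y + Pi.single c 2) := by
  set f : ℤ → List (Lattice d) := fun k => l.map (· + Pi.single c k) with hf
  have hT : ∀ k, IsTour StepRel {x | x - Pi.single c k ∈ face A o} (f k) := fun k => hl.shift _
  have hval : ∀ k x, x - Pi.single c k ∈ face A o → x c = o c + k := by
    intro k x hx
    have := (hx c).2 hc
    simp at this
    omega
  have hdis : ∀ k k', k ≠ k' → Disjoint {x | x - Pi.single c k ∈ face A o}
      {x | x - Pi.single c k' ∈ face A o} := by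
    intro k k' hk
    rw [Set.disjoint_left]
    intro x hx hx'
    have := hval k x hx
    have := hval k' x hx'
    omega
  have hdis0 : ∀ k', 0 ≠ k' → Disjoint (face A o) {x | x - Pi.single c k' ∈ face A o} := by
    intro k hk
    have := hdis 0 k hk
    simpa using this
  have hlast : ∀ k, (f k).getLast? = l.getLast?.map (· + Pi.single c k) := fun k => by simp [hf]
  have hhead : ∀ k, (f k).head? = l.head?.map (· + Pi.single c k) := fun k => by simp [hf]
  have h3 : IsTour StepRel _ (f 2 ++ (f 3).reverse) := (hT 2).append (isTour_rev (hT 3))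
    (hdis 2 3 (by norm_num)) (by
      intro x y hx hy
      rw [List.head?_reverse] at hy
      rw [hlast] at hx hy
      cases hh : l.getLast? with
      | none => simp [hh] at hx
      | some z =>
        simp [hh] at hx hy
        subst hx hy
        exact stepRel_single_succ rfl)
  have h2 : IsTour StepRel _ ((f 1).reverse ++ (f 2 ++ (f 3).reverse)) :=
    (isTour_rev (hT 1)).append h3
    (Disjoint.union_right (hdis 1 2 (by norm_num)) (hdis 1 3 (by norm_num))) (by
      intro x y hx hy
      rw [List.getLast?_reverse, hhead] at hx
      cases hh : l.head? with
      | none => simp [hh] at hx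
      | some z =>
        have : (f 2).head? = some (z + Pi.single c 2) := by rw [hhead, hh]; rfl
        rw [List.head?_append, this] at hy
        simp [hh] at hx hy
        subst hx hy
        exact stepRel_single_succ rfl)
  have h1 : IsTour StepRel _ (l ++ ((f 1).reverse ++ (f 2 ++ (f 3).reverse))) :=
    hl.append h2
    (Disjoint.union_right (hdis0 1 (by norm_num)) (Disjoint.union_right
      (hdis0 2 (by norm_num)) (hdis0 3 (by norm_num)))) (by
      intro x y hx hy
      have : (f 1).reverse.head? = some (x + Pi.single c 1) := by
        rw [List.head?_reverse, hlast, hx]; rfl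
      rw [List.head?_append, this] at hy
      simp at hy
      subst hy
      simpa using (stepRel_single_succ (x := x) (c := c) (k := 0) (k' := 1) rfl))
  refine ⟨_, ⟨h1.nodup, h1.rel, ?_⟩, ?_, ?_⟩
  · intro x
    rw [h1.mem]
    have key : ∀ k : ℤ, x - Pi.single c k ∈ face A o ↔ x c = o c + k ∧
        ∀ a, a ≠ c → (a ∈ A → 0 ≤ x a - o a ∧ x a - o a < 4) ∧ (a ∉ A → x a = o a) := by
      intro k
      constructor
      · intro h
        refine ⟨hval k x h, fun a ha => ?_⟩
        simpa [Pi.single_eq_of_ne ha] using h a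
      · rintro ⟨h, h'⟩ a
        by_cases ha : a = c
        · subst ha; simp [hc, h]
        · simpa [Pi.single_eq_of_ne ha] using h' a ha
    have key0 := key 0
    rw [Pi.single_zero, sub_zero] at key0
    simp only [Set.mem_union, Set.mem_ofPred_eq, key, key0]
    constructor
    · intro h a
      by_cases ha : a = c
      · subst ha
        simp only [Finset.mem_insert_self, forall_true_left, not_true_eq_false, false_implies,
          and_true]
        rcases h with h | h | h | h <;> omega
      · have : a ∈ insert c A ↔ a ∈ A := by simp [ha]
        rw [this]
        rcases h with h | h | h | h <;> exact h.2 a ha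
    · intro h
      have h' : ∀ a, a ≠ c → (a ∈ A → 0 ≤ x a - o a ∧ x a - o a < 4) ∧ (a ∉ A → x a = o a) := by
        intro a ha
        have := h a
        rwa [show a ∈ insert c A ↔ a ∈ A by simp [ha]] at this
      have hcc := (h c).1 (by simp)
      have : x c = o c + 0 ∨ x c = o c + 1 ∨ x c = o c + 2 ∨ x c = o c + 3 := by omega
      tauto
  · intro he
    simp [hf]
    grind
  · intro x y hxy
    have m : ∀ k, Consec (f k) (x + Pi.single c k) (y + Pi.single c k) := fun k =>
      consec_map.2 ⟨x, y, hxy, rfl, rfl⟩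
    constructor
    · exact consec_append.2 (Or.inr (Or.inl (consec_append.2 (Or.inl (consec_reverse.2 (m 1))))))
    · exact consec_append.2 (Or.inr (Or.inl (consec_append.2 (Or.inr (Or.inl
        (consec_append.2 (Or.inl (m 2))))))))

/-- The tour of an edge of the cube of side `4`. -/
def edgeList (o : Lattice d) (j : Fin d) : List (Lattice d) :=
  [o, o + Pi.single j 1, o + Pi.single j 2, o + Pi.single j 3]

theorem consec_edgeList {o : Lattice d} {j : Fin d} {x y : Lattice d} :
    Consec (edgeList o j) x y ↔ (x = o ∧ y = o + Pi.single j 1) ∨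
      (x = o + Pi.single j 1 ∧ y = o + Pi.single j 2) ∨
      (x = o + Pi.single j 2 ∧ y = o + Pi.single j 3) := by
  simp [edgeList, consec_cons, consec_nil, eq_comm]

theorem consec_edgeList_sub {o : Lattice d} {j : Fin d} {x y : Lattice d}
    (h : Consec (edgeList o j) x y) : y - x = Pi.single j 1 := by
  rcases consec_edgeList.1 h with ⟨rfl, rfl⟩ | ⟨rfl, rfl⟩ | ⟨rfl, rfl⟩
  · simp
  · rw [add_sub_add_left_eq_sub, ← Pi.single_sub]; norm_num
  · rw [add_sub_add_left_eq_sub, ← Pi.single_sub]; norm_num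

theorem edgeList_isTour (o : Lattice d) (j : Fin d) :
    IsTour StepRel (face {j} o) (edgeList o j) where
  nodup := by
    have : ∀ k k' : ℤ, (o + Pi.single j k = o + Pi.single j k') ↔ k = k' := by
      intro k k'; simp
    have h0 : ∀ k : ℤ, k ≠ 0 → o ≠ o + Pi.single j k := by
      intro k hk h; simp at h; exact hk h
    simp [edgeList]
  rel x y h := ⟨j, 1, Or.inl rfl, consec_edgeList_sub h⟩
  mem x := by
    simp only [edgeList, List.mem_cons, List.not_mem_nil, or_false]
    constructor
    · intro h a
      by_cases ha : a = j
      · subst ha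
        rcases h with rfl | rfl | rfl | rfl <;> simp
      · rcases h with rfl | rfl | rfl | rfl <;> simp [ha]
    · intro h
      have hj := (h j).1 (by simp)
      have key : x = o + Pi.single j (x j - o j) := by
        funext a
        by_cases ha : a = j
        · subst ha; simp
        · simp [ha, (h a).2 (by simpa using ha)]
      have : x j - o j = 0 ∨ x j - o j = 1 ∨ x j - o j = 2 ∨ x j - o j = 3 := by omega
      rcases this with h' | h' | h' | h' <;> rw [h'] at key
      · left; simpa using key
      · right; left; exact key
      · right; right; left; exact key
      · right; right; right; exact key

end Snake

end GridShift

/-! ### Spines: facet tours through a prescribed central edge -/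

namespace GridShift

variable {n : ℕ}

/-- The position of a central point of a face of a cube of side `4`. -/
def mid (A : Finset (Fin (n + 2))) : Lattice (n + 2) :=
  fun a => if a ∈ A then (if a = 1 then 1 else 2) else 0

theorem mid_insert {A : Finset (Fin (n + 2))} {c : Fin (n + 2)} (hc : c ∉ A) :
    mid (insert c A) = mid A + Pi.single c (if c = 1 then 1 else 2) := by
  funext a
  by_cases ha : a = c
  · subst ha; simp [mid, hc]
  · simp [mid, ha]

theorem mid_singleton (j : Fin (n + 2)) : mid {j} = Pi.single j (if j = 1 then 1 else 2) := by
  funext a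
  by_cases ha : a = j
  · subst ha; simp [mid]
  · simp [mid, ha]

theorem single_add_single {d : ℕ} (j : Fin d) (a b : ℤ) :
    (Pi.single j a + Pi.single j b : Lattice d) = Pi.single j (a + b) :=
  (Pi.single_add (f := fun _ : Fin d => ℤ) j a b).symm

/-- A tour of the edge in direction `j` of a cube of side `4` uses the two pairs at its centre. -/
theorem consec_edgeList_mid (o : Lattice (n + 2)) (j : Fin (n + 2)) {τ : ℤ}
    (hτ : τ = 1 ∨ τ = -1) :
    Consec (edgeList o j) (o + mid {j}) (o + mid {j} + Pi.single j τ) ∨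
      Consec (edgeList o j) (o + mid {j} + Pi.single j τ) (o + mid {j}) := by
  rw [add_assoc, mid_singleton, single_add_single]
  simp only [consec_edgeList]
  by_cases hj : j = 1
  · rcases hτ with rfl | rfl <;> simp [hj]
  · rcases hτ with rfl | rfl <;> simp [hj]

/-- Adding a coordinate `c` moves the central pair to layer 1 of the snake, where it is reversed, if
`c = 1`, and to layer 2, where it keeps its direction, otherwise. This is why the direction of the
pair is left open; a reversal of the whole list adjusts it later. -/
theorem exists_face_tour_of_mem (o : Lattice (n + 2)) (j : Fin (n + 2)) {τ : ℤ}
    (hτ : τ = 1 ∨ τ = -1) (A : Finset (Fin (n + 2))) (hj : j ∉ A) :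
    ∃ l, IsTour StepRel (face (insert j A) o) l ∧ Even l.length ∧
      (Consec l (o + mid (insert j A)) (o + mid (insert j A) + Pi.single j τ) ∨
        Consec l (o + mid (insert j A) + Pi.single j τ) (o + mid (insert j A))) := by
  induction A using Finset.induction_on with
  | empty =>
    exact ⟨edgeList o j, edgeList_isTour o j, by simp [edgeList]; decide,
      consec_edgeList_mid o j hτ⟩
  | insert c A hc ih =>
    obtain ⟨l, hl, he, h⟩ := ih (fun h => hj (by simp [h]))
    have hcj : c ∉ insert j A := by
      simp only [Finset.mem_insert, not_or] at hj ⊢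
      exact ⟨fun h => hj.1 h.symm, hc⟩
    obtain ⟨m, hm, he', hcons⟩ := exists_snake hl hcj
    rw [Finset.insert_comm, mid_insert hcj]
    refine ⟨l ++ m, hm, he' he, ?_⟩
    have hcomm : ∀ k : ℤ, o + (mid (insert j A) + Pi.single c k) + Pi.single j τ =
      o + mid (insert j A) + Pi.single j τ + Pi.single c k := fun k => by abel
    rw [hcomm, ← add_assoc]
    by_cases h1 : c = 1
    · rw [if_pos h1]
      rcases h with h | h
      · exact Or.inr (hcons _ _ h).1
      · exact Or.inl (hcons _ _ h).1
    · rw [if_neg h1]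
      rcases h with h | h
      · exact Or.inl (hcons _ _ h).2
      · exact Or.inr (hcons _ _ h).2

theorem erase_univ_two {i j : Fin (0 + 2)} (h : j ≠ i) : Finset.univ.erase i = {j} := by
  revert i j; decide

/-- A facet of a cube of side `4` has a tour through a given directed edge at its centre, which in
dimension two is straight. -/
theorem exists_spine (o : Lattice (n + 2)) (i j : Fin (n + 2)) (hij : j ≠ i) {τ : ℤ}
    (hτ : τ = 1 ∨ τ = -1) {a b : Lattice (n + 2)}
    (hab : (a = o + mid (Finset.univ.erase i) ∧
        b = o + mid (Finset.univ.erase i) + Pi.single j τ) ∨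
      (b = o + mid (Finset.univ.erase i) ∧
        a = o + mid (Finset.univ.erase i) + Pi.single j τ)) :
    ∃ l, IsTour StepRel (face (Finset.univ.erase i) o) l ∧ Even l.length ∧ Consec l b a ∧
      (n = 0 → ∀ x y, Consec l x y → y - x = a - b) := by
  suffices h : ∃ l, IsTour StepRel (face (Finset.univ.erase i) o) l ∧ Even l.length ∧
      (Consec l b a ∨ Consec l a b) ∧ (n = 0 → ∀ x y u v, Consec l x y → Consec l u v →
        y - x = v - u) by
    obtain ⟨l, hl, he, h | h, h2⟩ := h
    · exact ⟨l, hl, he, h, fun h0 x y hxy => h2 h0 x y b a hxy h⟩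
    · refine ⟨l.reverse, isTour_rev hl, by simpa using he, consec_reverse.2 h,
        fun h0 x y hxy => ?_⟩
      have := h2 h0 _ _ _ _ (consec_reverse.1 hxy) h
      rw [← neg_sub, this, neg_sub]
  have hor : ∀ {l : List (Lattice (n + 2))}, (Consec l (o + mid (Finset.univ.erase i))
      (o + mid (Finset.univ.erase i) + Pi.single j τ) ∨
        Consec l (o + mid (Finset.univ.erase i) + Pi.single j τ)
          (o + mid (Finset.univ.erase i))) → (Consec l b a ∨ Consec l a b) := by
    intro l h
    rcases hab with ⟨rfl, rfl⟩ | ⟨rfl, rfl⟩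
    · exact h.symm
    · exact h
  rcases Nat.eq_zero_or_pos n with h0 | h0
  · subst h0
    have hE := erase_univ_two hij
    refine ⟨edgeList o j, ?_, by simp [edgeList]; decide, hor ?_, ?_⟩
    · rw [hE]; exact edgeList_isTour o j
    · rw [hE]; exact consec_edgeList_mid o j hτ
    · intro _ x y u v h1 h2
      rw [consec_edgeList_sub h1, consec_edgeList_sub h2]
  · obtain ⟨l, hl, he, h⟩ := exists_face_tour_of_mem o j hτ ((Finset.univ.erase i).erase j)
      (Finset.notMem_erase _ _)
    rw [Finset.insert_erase (by simp [hij])] at hl h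
    exact ⟨l, hl, he, hor h, fun h => absurd h (by omega)⟩

/-- Embedding of a coordinate plane. -/
def plane (o : Lattice (n + 2)) (c : Fin (n + 2)) (p : ℤ × ℤ) : Lattice (n + 2) :=
  o + Pi.single 1 p.1 + Pi.single c p.2

/-- A Hamiltonian path of the `4 × 4` grid that starts with the last two points of a side. -/
def IsGridPath (L : List (ℤ × ℤ)) : Prop :=
  L.Nodup ∧ (∀ p ∈ L, 0 ≤ p.1 ∧ p.1 < 4 ∧ 0 ≤ p.2 ∧ p.2 < 4) ∧
  (∀ x : Fin 4, ∀ y : Fin 4, ((x : ℤ), (y : ℤ)) ∈ L) ∧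
  L.IsChain (fun p q => (p.1 = q.1 ∧ (p.2 = q.2 + 1 ∨ p.2 + 1 = q.2)) ∨
    (p.2 = q.2 ∧ (p.1 = q.1 + 1 ∨ p.1 + 1 = q.1)))

instance (L : List (ℤ × ℤ)) : Decidable (IsGridPath L) := by unfold IsGridPath; infer_instance

/-- Six explicit paths cover the eight directed edges at the point (1, 2). The beginning (3, 0), (2,
0) is prescribed because the first two teeth of the comb over the path will carry the tour of a set
`D j`. -/
theorem exists_gridPath {x y : ℤ × ℤ}
    (h : (x = (1, 2) ∧ (y = (2, 2) ∨ y = (0, 2) ∨ y = (1, 3) ∨ y = (1, 1))) ∨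
      (y = (1, 2) ∧ (x = (2, 2) ∨ x = (0, 2) ∨ x = (1, 3) ∨ x = (1, 1)))) :
    ∃ L, IsGridPath ((3, 0) :: (2, 0) :: L) ∧ L.length = 14 ∧
      Consec ((3, 0) :: (2, 0) :: L) x y := by
  have hA : IsGridPath [(3, 0), (2, 0), (1, 0), (0, 0), (0, 1), (1, 1), (2, 1), (3, 1), (3, 2),
    (3, 3), (2, 3), (1, 3), (0, 3), (0, 2), (1, 2), (2, 2)] := by decide
  have hB : IsGridPath [(3, 0), (2, 0), (1, 0), (0, 0), (0, 1), (1, 1), (2, 1), (3, 1), (3, 2),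
    (2, 2), (1, 2), (0, 2), (0, 3), (1, 3), (2, 3), (3, 3)] := by decide
  have hC : IsGridPath [(3, 0), (2, 0), (1, 0), (0, 0), (0, 1), (1, 1), (2, 1), (3, 1), (3, 2),
    (3, 3), (2, 3), (2, 2), (1, 2), (1, 3), (0, 3), (0, 2)] := by decide
  have hD : IsGridPath [(3, 0), (2, 0), (1, 0), (0, 0), (0, 1), (0, 2), (0, 3), (1, 3), (1, 2),
    (2, 2), (2, 3), (3, 3), (3, 2), (3, 1), (2, 1), (1, 1)] := by decide
  have hE : IsGridPath [(3, 0), (2, 0), (1, 0), (0, 0), (0, 1), (0, 2), (0, 3), (1, 3), (2, 3),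
    (3, 3), (3, 2), (2, 2), (1, 2), (1, 1), (2, 1), (3, 1)] := by decide
  have hF : IsGridPath [(3, 0), (2, 0), (1, 0), (0, 0), (0, 1), (1, 1), (1, 2), (2, 2), (2, 1),
    (3, 1), (3, 2), (3, 3), (2, 3), (1, 3), (0, 3), (0, 2)] := by decide
  rcases h with ⟨rfl, rfl | rfl | rfl | rfl⟩ | ⟨rfl, rfl | rfl | rfl | rfl⟩
  · exact ⟨_, hA, by simp, by simp [consec_cons]⟩
  · exact ⟨_, hB, by simp, by simp [consec_cons]⟩
  · exact ⟨_, hC, by simp, by simp [consec_cons]⟩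
  · exact ⟨_, hE, by simp, by simp [consec_cons]⟩
  · exact ⟨_, hB, by simp, by simp [consec_cons]⟩
  · exact ⟨_, hA, by simp, by simp [consec_cons]⟩
  · exact ⟨_, hD, by simp, by simp [consec_cons]⟩
  · exact ⟨_, hF, by simp, by simp [consec_cons]⟩

theorem IsGridPath.isTour {L : List (ℤ × ℤ)} (hL : IsGridPath L) (o : Lattice (n + 2))
    {c : Fin (n + 2)} (hc : c ≠ 1) :
    IsTour StepRel (face {1, c} o) (L.map (plane o c)) where
  nodup := by
    refine hL.1.map ?_
    rintro ⟨x, y⟩ ⟨x', y'⟩ h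
    have h1 := congrFun h 1
    have h2 := congrFun h c
    simp [plane, hc, hc.symm] at h1 h2
    rw [h1, h2]
  rel x y hxy := by
    obtain ⟨⟨p1, p2⟩, ⟨q1, q2⟩, ⟨s, t, hst⟩, rfl, rfl⟩ := consec_map.1 hxy
    have := List.isChain_iff_forall_rel_of_append_cons_cons.1 hL.2.2.2 hst
    simp only at this
    rcases this with ⟨rfl, h⟩ | ⟨rfl, h⟩
    · refine ⟨c, q2 - p2, by omega, ?_⟩
      rw [Pi.single_sub]; simp [plane]
    · refine ⟨1, q1 - p1, by omega, ?_⟩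
      rw [Pi.single_sub]; simp only [plane]; abel
  mem x := by
    rw [List.mem_map]
    constructor
    · rintro ⟨⟨p1, p2⟩, hp, rfl⟩ a
      have := hL.2.1 _ hp
      simp only at this
      by_cases h1 : a = 1
      · subst h1; simp [plane, hc.symm]; omega
      · by_cases h2 : a = c
        · subst h2; simp [plane, h1]; omega
        · simp [plane, h1, h2]
    · intro h
      have h1 := (h 1).1 (by simp)
      have h2 := (h c).1 (by simp)
      refine ⟨(x 1 - o 1, x c - o c), ?_, ?_⟩
      · have := hL.2.2.1 ⟨(x 1 - o 1).toNat, by omega⟩ ⟨(x c - o c).toNat, by omega⟩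
        simpa [Int.toNat_of_nonneg h1.1, Int.toNat_of_nonneg h2.1] using this
      · funext a
        by_cases ha : a = 1
        · subst ha; simp [plane, hc.symm]
        · by_cases ha' : a = c
          · subst ha'; simp [plane, ha]
          · simp [plane, ha, ha', (h a).2 (by simp [ha, ha'])]

/-- The coordinates in `A` differ from 1, so each of them moves the central pair to layer 2 of the
snake, which is traversed forwards: the direction of the pair is preserved. The snake begins with
the old tour, so the first two points stay as well. Reversal would spoil the beginning, hence the
explicit paths in both directions. -/
theorem exists_tip_face_tour (o : Lattice (n + 2)) {c j : Fin (n + 2)} (hc : c ≠ 1)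
    (hj : j = 1 ∨ j = c) {τ : ℤ} (hτ : τ = 1 ∨ τ = -1) (A : Finset (Fin (n + 2)))
    (hA : ∀ a ∈ A, a ≠ 1 ∧ a ≠ c) {x y : Lattice (n + 2)}
    (hxy : (x = 0 ∧ y = Pi.single j τ) ∨ (y = 0 ∧ x = Pi.single j τ)) :
    ∃ l, IsTour StepRel (face (A ∪ {1, c}) o)
        ((o + Pi.single 1 3) :: (o + Pi.single 1 2) :: l) ∧ Even l.length ∧
      Consec ((o + Pi.single 1 3) :: (o + Pi.single 1 2) :: l)
        (o + mid (A ∪ {1, c}) + x) (o + mid (A ∪ {1, c}) + y) := by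
  induction A using Finset.induction_on with
  | empty =>
    rw [Finset.empty_union]
    have hmid : o + mid {1, c} = plane o c (1, 2) := by
      rw [mid_insert (by simpa using hc.symm), mid_singleton]
      simp [plane, hc]; abel
    have key : ∀ v : ℤ × ℤ, o + mid {1, c} + (Pi.single 1 v.1 + Pi.single c v.2) =
        plane o c ((1, 2) + v) := by
      intro v
      rw [hmid]; simp [plane, Pi.single_add]; abel
    obtain ⟨v, hv, hv'⟩ : ∃ v : ℤ × ℤ, (v = (1, 0) ∨ v = (-1, 0) ∨ v = (0, 1) ∨ v = (0, -1)) ∧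
        (Pi.single j τ : Lattice (n + 2)) = Pi.single 1 v.1 + Pi.single c v.2 := by
      rcases hj with rfl | rfl
      · exact ⟨(τ, 0), by simp; omega, by simp⟩
      · exact ⟨(0, τ), by simp; omega, by simp⟩
    obtain ⟨X, Y, hX, hY, hXY⟩ : ∃ X Y, o + mid {1, c} + x = plane o c X ∧
        o + mid {1, c} + y = plane o c Y ∧
        ((X = (1, 2) ∧ Y = (1, 2) + v) ∨ (Y = (1, 2) ∧ X = (1, 2) + v)) := by
      rcases hxy with ⟨rfl, rfl⟩ | ⟨rfl, rfl⟩
      · exact ⟨_, _, by rw [add_zero, hmid], by rw [hv', key], Or.inl ⟨rfl, rfl⟩⟩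
      · exact ⟨_, _, by rw [hv', key], by rw [add_zero, hmid], Or.inr ⟨rfl, rfl⟩⟩
    obtain ⟨L, hL, hlen, hcons⟩ := exists_gridPath (x := X) (y := Y) (by
      rcases hv with rfl | rfl | rfl | rfl <;> norm_num at hXY <;> tauto)
    have hh : ((3, 0) :: (2, 0) :: L).map (plane o c) =
        (o + Pi.single 1 3) :: (o + Pi.single 1 2) :: L.map (plane o c) := by
      simp [plane]
    refine ⟨L.map (plane o c), ?_, by simp [hlen]; decide, ?_⟩
    · rw [← hh]; exact hL.isTour o hc
    · rw [← hh, hX, hY]; exact consec_map.2 ⟨X, Y, hcons, rfl, rfl⟩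
  | insert b A hb ih =>
    obtain ⟨l, hl, he, h⟩ := ih (fun a ha => hA a (by simp [ha]))
    have hb' := hA b (by simp)
    have hbA : b ∉ A ∪ {1, c} := by simp [hb, hb']
    obtain ⟨m, hm, he', hcons⟩ := exists_snake hl hbA
    rw [Finset.insert_union, mid_insert hbA]
    refine ⟨l ++ m, by simpa using hm, ?_, ?_⟩
    · have := he' (by simpa [parity_simps] using he)
      simpa [parity_simps] using this
    · have := (hcons _ _ h).2
      rw [if_neg hb'.1]
      have hcomm : ∀ z, o + (mid (A ∪ {1, c}) + Pi.single b 2) + z =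
        o + mid (A ∪ {1, c}) + z + Pi.single b 2 := fun z => by abel
      rw [hcomm, hcomm]
      simpa using this

/-- The tour of `exists_spine` may be chosen to start at the two points
`o + 3 ε¹, o + 2 ε¹` in this order; in dimension two only one direction of the edge is possible. -/
theorem exists_tip_spine (o : Lattice (n + 2)) (j : Fin (n + 2)) (hj : j ≠ 0) {τ : ℤ}
    (hτ : τ = 1 ∨ τ = -1) {a b : Lattice (n + 2)}
    (hab : (a = o + mid (Finset.univ.erase 0) ∧
        b = o + mid (Finset.univ.erase 0) + Pi.single j τ) ∨
      (b = o + mid (Finset.univ.erase 0) ∧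
        a = o + mid (Finset.univ.erase 0) + Pi.single j τ))
    (h0 : n = 0 → a - b = Pi.single 1 (-1)) :
    ∃ l, IsTour StepRel (face (Finset.univ.erase 0) o)
        ((o + Pi.single 1 3) :: (o + Pi.single 1 2) :: l) ∧ Even l.length ∧
      Consec ((o + Pi.single 1 3) :: (o + Pi.single 1 2) :: l) b a ∧
      (n = 0 → ∀ x y, Consec ((o + Pi.single 1 3) :: (o + Pi.single 1 2) :: l) x y →
        y - x = a - b) := by
  rcases Nat.eq_zero_or_pos n with hn | hn
  · subst hn
    have hj1 : j = 1 := by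
      have : ∀ j : Fin (0 + 2), j ≠ 0 → j = 1 := by decide
      exact this j hj
    subst hj1
    have hE := erase_univ_two hj
    have hab0 := h0 rfl
    -- The facet is a segment, and the descending path is its only tour with the prescribed
    -- beginning; `h0` says that this is the right direction.
    refine ⟨[o + Pi.single 1 1, o], ?_, by simp, ?_, ?_⟩
    · rw [hE]
      exact isTour_rev (edgeList_isTour o 1)
    · have := consec_edgeList_mid o (1 : Fin (0 + 2)) hτ
      rw [← hE] at this
      have h3 : Consec (edgeList o 1) a b ∨ Consec (edgeList o 1) b a := by
        rcases hab with ⟨rfl, rfl⟩ | ⟨rfl, rfl⟩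
        · exact this
        · exact this.symm
      rcases h3 with h3 | h3
      · exact consec_reverse.2 h3
      · have := consec_edgeList_sub h3
        rw [hab0] at this
        have := congrFun this 1
        simp at this
    · intro _ x y hxy
      have h3 : Consec (edgeList o 1) y x := consec_reverse.1 hxy
      rw [hab0, ← neg_sub, consec_edgeList_sub h3, Pi.single_neg]
  · obtain ⟨c, hc1, hc0, hjc⟩ : ∃ c : Fin (n + 2), c ≠ 1 ∧ c ≠ 0 ∧ (j = 1 ∨ j = c) := by
      by_cases h : j = 1
      · refine ⟨⟨2, by omega⟩, ?_, ?_, Or.inl h⟩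
        · intro h'; have := congrArg Fin.val h'; simp at this
        · intro h'; have := congrArg Fin.val h'; simp at this
      · exact ⟨j, h, hj, Or.inr rfl⟩
    have hset : ((Finset.univ.erase 0).erase 1).erase c ∪ {1, c} =
        (Finset.univ.erase 0 : Finset (Fin (n + 2))) := by
      ext a
      simp only [Finset.mem_union, Finset.mem_erase, Finset.mem_univ, and_true, Finset.mem_insert,
        Finset.mem_singleton]
      have h10 : (1 : Fin (n + 2)) ≠ 0 := by simp
      constructor
      · rintro (⟨_, _, h⟩ | rfl | rfl)
        · exact h
        · exact h10
        · exact hc0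
      · tauto
    obtain ⟨x, y, hx, hy, hxy⟩ : ∃ x y, b = o + mid (Finset.univ.erase 0) + x ∧
        a = o + mid (Finset.univ.erase 0) + y ∧
        ((x = 0 ∧ y = Pi.single j τ) ∨ (y = 0 ∧ x = Pi.single j τ)) := by
      rcases hab with ⟨rfl, rfl⟩ | ⟨rfl, rfl⟩
      · exact ⟨_, 0, rfl, by simp, Or.inr ⟨rfl, rfl⟩⟩
      · exact ⟨0, _, by simp, rfl, Or.inl ⟨rfl, rfl⟩⟩
    obtain ⟨l, hl, he, h⟩ := exists_tip_face_tour o hc1 hjc hτ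
      (((Finset.univ.erase 0).erase 1).erase c) (by simp; tauto) hxy
    rw [hset] at hl h
    exact ⟨l, hl, he, by rw [hx, hy]; exact h, fun h => absurd h (by omega)⟩

end GridShift

/-! ### Orientation in the plane, and tiles that can be attached -/

namespace GridShift

variable {n : ℕ}

/-- The quarter turn in the plane of the first two coordinates. -/
def rot (v : Lattice (n + 2)) : Lattice (n + 2) :=
  fun a => if a = 0 then v 1 else if a = 1 then - v 0 else 0

theorem rot_neg (v : Lattice (n + 2)) : rot (-v) = - rot v := by
  funext a
  simp only [rot, Pi.neg_apply]
  split_ifs <;> simp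

theorem rot_rot (hn : n = 0) (v : Lattice (n + 2)) : rot (rot v) = -v := by
  subst hn
  funext a
  fin_cases a <;> simp [rot]

/-- In dimension two, a step that is not parallel to `e` is a quarter turn away from `e`. -/
theorem rot_eq_or_neg (hn : n = 0) {e f : Lattice (n + 2)} (he : IsStep e) (hf : IsStep f)
    (h1 : f ≠ e) (h2 : f ≠ -e) : rot f = e ∨ rot f = -e := by
  subst hn
  obtain ⟨i, σ, hσ, rfl⟩ := he
  obtain ⟨j, τ, hτ, rfl⟩ := hf
  by_cases hij : i = j
  · subst hij
    exfalso
    rcases hσ with rfl | rfl <;> rcases hτ with rfl | rfl <;> simp [← Pi.single_neg] at h1 h2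
  · fin_cases i <;> fin_cases j <;> simp at hij <;>
      rcases hσ with rfl | rfl <;> rcases hτ with rfl | rfl <;>
      first
        | (left; funext a; fin_cases a <;> simp [rot]; done)
        | (right; funext a; fin_cases a <;> simp [rot])

/-- `x` and `y` differ by a generator; in dimension two, moreover, the unit square to the left of
the directed edge `(x, y)` lies in `S`. -/
def Ccw (S : Set (Lattice (n + 2))) (x y : Lattice (n + 2)) : Prop :=
  StepRel x y ∧ (n = 0 → x + rot (y - x) ∈ S ∧ y + rot (y - x) ∈ S)

theorem Ccw.mono {S S' : Set (Lattice (n + 2))} (h : S ⊆ S') {x y : Lattice (n + 2)}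
    (hxy : Ccw S x y) : Ccw S' x y :=
  ⟨hxy.1, fun hn => ⟨h (hxy.2 hn).1, h (hxy.2 hn).2⟩⟩

/-- The box with a facet of side `4` orthogonal to `ε^i` at `o`, and depth `h` in the direction
`σ ε^i`. -/
def box (i : Fin (n + 2)) (σ : ℤ) (o : Lattice (n + 2)) (h : ℤ) : Set (Lattice (n + 2)) :=
  {x | 0 ≤ σ * (x i - o i) ∧ σ * (x i - o i) < h ∧ ∀ a, a ≠ i → 0 ≤ x a - o a ∧ x a - o a < 4}

theorem mem_box_of_face {i : Fin (n + 2)} {σ : ℤ} (hσ : σ = 1 ∨ σ = -1) {o x : Lattice (n + 2)}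
    (hx : x ∈ face (Finset.univ.erase i) o) {c : ℤ} {h : ℤ} (hc : 0 ≤ c) (hch : c < h) :
    x + c • Pi.single i σ ∈ box i σ o h := by
  have hi : x i = o i := (hx i).2 (by simp)
  have : σ * σ = 1 := by rcases hσ with rfl | rfl <;> norm_num
  have h2 : σ * ((x + c • Pi.single i σ : Lattice (n + 2)) i - o i) = c := by
    simp [hi]; linear_combination c * this
  refine ⟨by rw [h2]; exact hc, by rw [h2]; exact hch, fun a ha => ?_⟩
  simpa [ha] using (hx a).1 (by simp [ha])

/-- In dimension two the spine is straight and has `e` on its left, so it has the bottom row of the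
teeth on its left. An outgoing column has the returning column of its pair on its left and
conversely, and the links between columns, which run against the spine, have the row below them on
their left. -/
theorem exists_comb_box {i : Fin (n + 2)} {σ : ℤ} (hσ : σ = 1 ∨ σ = -1) {o : Lattice (n + 2)}
    (H : ℕ) {l : List (Lattice (n + 2))}
    (hl : IsTour StepRel (face (Finset.univ.erase i) o) l) (he : Even l.length)
    {a b : Lattice (n + 2)} (hba : Consec l b a)
    (hstraight : n = 0 → ∀ x y, Consec l x y → y - x = a - b)
    (hrot : n = 0 → rot (a - b) = Pi.single i σ) :
    ∃ p, IsTour (Ccw (box i σ o (H + 2))) (box i σ o (H + 2)) p ∧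
      p.head? = some a ∧ p.getLast? = some b ∧
      ∀ x y l', l = x :: y :: l' →
        Consec p (y + ((H : ℤ) + 1) • Pi.single i σ) (x + ((H : ℤ) + 1) • Pi.single i σ) := by
  set e : Lattice (n + 2) := Pi.single i σ with he'
  have hσσ : σ * σ = 1 := by rcases hσ with rfl | rfl <;> norm_num
  have hface : ∀ x ∈ l, x ∈ face (Finset.univ.erase i) o := fun x hx => (hl.mem x).1 hx
  have hbox : ∀ x ∈ l, ∀ c : ℤ, 0 ≤ c → c < (H : ℤ) + 2 → x + c • e ∈ box i σ o (H + 2) :=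
    fun x hx c h1 h2 => mem_box_of_face hσ (hface x hx) h1 h2
  obtain ⟨p, hp, h1, h2, h3⟩ := exists_comb (R := Ccw (box i σ o (H + 2))) (e := e) (H := H)
    he hl.nodup (by
      intro x hx y hy c c' h
      have hx' : x i = o i := (hface x hx i).2 (by simp)
      have hy' : y i = o i := (hface y hy i).2 (by simp)
      have := congrFun h i
      simp [he', hx', hy'] at this
      have hcc : c = c' := by
        rcases this with h | h
        · exact h
        · subst h; simp at hσ
      subst hcc
      exact ⟨add_right_cancel h, rfl⟩) (by
      intro x y hxy
      have hx := hxy.mem_left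
      have hy := hxy.mem_right
      have hst : IsStep (y - x) := hl.rel _ _ hxy
      have hst' : IsStep (x - y) := by simpa using hst.neg
      have hes : IsStep e := isStep_single i hσ
      have hr : n = 0 → rot (y - x) = e := fun hn => by rw [hstraight hn x y hxy, hrot hn]
      have hr' : n = 0 → rot (x - y) = -e := fun hn => by rw [← neg_sub, rot_neg, hr hn]
      have hre : n = 0 → rot e = x - y := fun hn => by rw [← hr hn, rot_rot hn, neg_sub]
      refine ⟨⟨hst, fun hn => ?_⟩, fun c hc => ⟨?_, fun hn => ?_⟩,
        fun c hc => ⟨⟨?_, fun hn => ?_⟩, ?_, fun hn => ?_⟩⟩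
      · rw [hr hn]
        have e1 := hbox x hx 1 (by omega) (by omega)
        have e2 := hbox y hy 1 (by omega) (by omega)
        rw [one_smul] at e1 e2
        exact ⟨e1, e2⟩
      · exact stepRel_add.2 hst'
      · rw [add_sub_add_right_eq_sub, hr' hn]
        have e1 := hbox x hx c (by omega) (by omega)
        have e2 := hbox y hy c (by omega) (by omega)
        constructor
        · convert e2 using 1; module
        · convert e1 using 1; module
      · have : y + ((c : ℤ) + 1) • e - (y + (c : ℤ) • e) = e := by module
        rw [StepRel, this]; exact hes
      · have : y + ((c : ℤ) + 1) • e - (y + (c : ℤ) • e) = e := by module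
        rw [this, hre hn]
        have e1 := hbox x hx c (by omega) (by omega)
        have e2 := hbox x hx (c + 1) (by omega) (by omega)
        constructor
        · convert e1 using 1; module
        · convert e2 using 1; module
      · have : x + (c : ℤ) • e - (x + ((c : ℤ) + 1) • e) = -e := by module
        rw [StepRel, this]; exact hes.neg
      · have : x + (c : ℤ) • e - (x + ((c : ℤ) + 1) • e) = -e := by module
        rw [this, rot_neg, hre hn]
        have e1 := hbox y hy c (by omega) (by omega)
        have e2 := hbox y hy (c + 1) (by omega) (by omega)
        constructor
        · convert e2 using 1; module
        · convert e1 using 1; module) hba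
  refine ⟨p, ⟨hp.nodup, hp.rel, fun z => ?_⟩, h1, h2, h3⟩
  rw [hp.mem]
  constructor
  · rintro ⟨x, hx, c, hc, rfl⟩
    exact hbox x hx c (by omega) (by omega)
  · rintro ⟨hz1, hz2, hz3⟩
    obtain ⟨c, hc⟩ := Int.eq_ofNat_of_zero_le hz1
    have hcz : z i - o i = c * σ := by
      rw [← hc]; linear_combination - (z i - o i) * hσσ
    refine ⟨z - (c : ℤ) • e, (hl.mem _).2 fun a => ?_, c, by omega, by simp⟩
    by_cases ha : a = i
    · subst ha
      simp [he']
      omega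
    · simpa [ha, he'] using hz3 a ha

/-- A set `B` that is entered through its point `v'` in the direction `e`: a tour of a set disjoint
from `B` that passes from `v' - e` to a neighbour in a direction transversal to `e` may be rerouted
through `B`. -/
def Attach (Req : Lattice (n + 2) → Lattice (n + 2) → Prop) (B : Set (Lattice (n + 2)))
    (e v' : Lattice (n + 2)) : Prop :=
  IsStep e ∧ v' ∈ B ∧ ∀ f a b, IsStep f → f ≠ e → f ≠ -e →
    ((a = v' ∧ b = v' + f) ∨ (b = v' ∧ a = v' + f)) → (n = 0 → rot (a - b) = e) →
    ∃ p, IsTour (Ccw B) B p ∧ p.head? = some a ∧ p.getLast? = some b ∧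
      ∀ x y, Req x y → x ∈ B → Consec p x y

theorem single_ne_of_ne {i j : Fin (n + 2)} {σ τ : ℤ} (hσ : σ = 1 ∨ σ = -1)
    (hτ : τ = 1 ∨ τ = -1) (h1 : (Pi.single j τ : Lattice (n + 2)) ≠ Pi.single i σ)
    (h2 : (Pi.single j τ : Lattice (n + 2)) ≠ -Pi.single i σ) : j ≠ i := by
  rintro rfl
  rcases hσ with rfl | rfl <;> rcases hτ with rfl | rfl <;> simp [← Pi.single_neg] at h1 h2

/-- Boxes may be entered through the centre of the facet. -/
theorem attach_box {Req : Lattice (n + 2) → Lattice (n + 2) → Prop} {i : Fin (n + 2)} {σ : ℤ}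
    (hσ : σ = 1 ∨ σ = -1) (o : Lattice (n + 2)) {h : ℤ} (hh : 2 ≤ h)
    (hreq : ∀ x y, Req x y → x ∉ box i σ o h) :
    Attach Req (box i σ o h) (Pi.single i σ) (o + mid (Finset.univ.erase i)) := by
  obtain ⟨H, hH⟩ := Int.eq_ofNat_of_zero_le (show 0 ≤ h - 2 by omega)
  obtain rfl : h = H + 2 := by omega
  refine ⟨isStep_single i hσ, ?_, ?_⟩
  · have : o + mid (Finset.univ.erase i) ∈ face (Finset.univ.erase i) o := by
      intro a
      simp [mid]
      split_ifs <;> simp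
    simpa using mem_box_of_face hσ this (c := 0) (h := (H : ℤ) + 2) le_rfl (by omega)
  · rintro f a b ⟨j, τ, hτ, rfl⟩ h1 h2 hab hrot
    have hji := single_ne_of_ne hσ hτ h1 h2
    obtain ⟨l, hl, he, hba, hst⟩ := exists_spine o i j hji hτ hab
    obtain ⟨p, hp, hp1, hp2, -⟩ := exists_comb_box hσ H hl he hba hst hrot
    exact ⟨p, hp, hp1, hp2, fun x y hxy hx => absurd hx (hreq x y hxy)⟩

theorem rot_single_one (σ : ℤ) : rot (Pi.single 1 σ : Lattice (n + 2)) = Pi.single 0 σ := by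
  funext a
  by_cases h0 : a = 0
  · subst h0; simp [rot]
  · by_cases h1 : a = 1
    · subst h1; simp [rot]
    · simp [rot, h0, h1]

theorem rot_single_zero (σ : ℤ) : rot (Pi.single 0 σ : Lattice (n + 2)) = Pi.single 1 (-σ) := by
  funext a
  by_cases h0 : a = 0
  · subst h0; simp [rot]
  · by_cases h1 : a = 1
    · subst h1; simp [rot]
    · simp [rot, h0, h1]

/-- A box below its top facet at `o` together with a set `D` that has a tour from `s` to
`t = s + ε¹`, where `s` and `t` are below the bottom of the box in the columns of
`o + 2 ε¹, o + 3 ε¹`, may be entered from above. -/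
theorem attach_tip_box {Req : Lattice (n + 2) → Lattice (n + 2) → Prop} (o : Lattice (n + 2))
    (H : ℕ) {D : Set (Lattice (n + 2))} {w : List (Lattice (n + 2))} {s : Lattice (n + 2)}
    (hw : IsTour (Ccw D) D w) (hs : w.head? = some s) (ht : w.getLast? = some (s + Pi.single 1 1))
    (hdis : Disjoint (box 0 (-1) o (H + 2)) D)
    (hso : s + Pi.single 0 1 = o + Pi.single 1 2 + ((H : ℤ) + 1) • Pi.single 0 (-1))
    (hreq : ∀ x y, Req x y → x ∈ box 0 (-1) o (H + 2) ∪ D →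
      Consec w x y ∨ (x = s + Pi.single 1 1 ∧ y = s + Pi.single 1 1 + Pi.single 0 1)) :
    Attach Req (box 0 (-1) o (H + 2) ∪ D) (Pi.single 0 (-1)) (o + mid (Finset.univ.erase 0)) := by
  have hσ : (-1 : ℤ) = 1 ∨ (-1 : ℤ) = -1 := Or.inr rfl
  set B := box 0 (-1) o (H + 2) with hB
  have hs' : s + Pi.single 0 1 ∈ B := by
    rw [hso]
    refine mem_box_of_face hσ ?_ (by omega) (by omega)
    intro a
    by_cases h1 : a = 1
    · subst h1; simp
    · simp [h1]
  have ht' : s + Pi.single 1 1 + Pi.single 0 1 =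
      o + Pi.single 1 3 + ((H : ℤ) + 1) • Pi.single 0 (-1) := by
    have : s + Pi.single 1 1 + Pi.single 0 1 = s + Pi.single 0 1 + Pi.single 1 1 := by abel
    rw [this, hso]
    have : (Pi.single 1 3 : Lattice (n + 2)) = Pi.single 1 2 + Pi.single 1 1 := by
      rw [single_add_single]; norm_num
    rw [this]; abel
  have ht'B : s + Pi.single 1 1 + Pi.single 0 1 ∈ B := by
    rw [ht']
    refine mem_box_of_face hσ ?_ (by omega) (by omega)
    intro a
    by_cases h1 : a = 1
    · subst h1; simp
    · simp [h1]
  have hsD : s ∈ D := (hw.mem _).1 (List.mem_of_head? hs)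
  have htD : s + Pi.single 1 1 ∈ D := (hw.mem _).1 (List.mem_of_getLast? ht)
  have h0 := (attach_box (Req := fun _ _ => False) (i := 0) hσ o (h := (H : ℤ) + 2) (by omega)
    (by simp)).2.1
  refine ⟨isStep_single 0 hσ, Or.inl h0, ?_⟩
  rintro f a b ⟨j, τ, hτ, rfl⟩ h1 h2 hab hrot
  have hj0 := single_ne_of_ne hσ hτ h1 h2
  -- Entering from above forces the spine to descend along `ε¹` in dimension two. This is the
  -- direction for which the tips of the first two teeth are visited in the order of the two ends of
  -- `w`.
  have hn0 : n = 0 → a - b = Pi.single 1 (-1) := by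
    intro hn
    have := congrArg rot (hrot hn)
    rw [rot_rot hn, rot_single_zero] at this
    rw [← neg_neg (a - b), this, Pi.single_neg, neg_neg]
  obtain ⟨l, hl, he, hba, hst⟩ := exists_tip_spine o j hj0 hτ hab hn0
  obtain ⟨p, hp, hp1, hp2, hp3⟩ := exists_comb_box hσ H hl (by simpa [parity_simps] using he) hba hst hrot
  -- The tip of the second tooth, above `s`, is followed by the tip of the first one, above `s +
  -- ε¹`; the tour `w` is inserted between them.
  have hc := hp3 _ _ _ rfl
  rw [← hso, ← ht'] at hc
  obtain ⟨l₁, l₂, hp12⟩ := id hc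
  rw [hp12] at hp
  have hup : s + Pi.single 0 1 - s = Pi.single 0 1 := by abel
  have hT := hp.insert (R'' := Ccw (B ∪ D)) hw hdis hs ht
    (fun x y h => h.mono Set.subset_union_left) (fun x y h => h.mono Set.subset_union_right)
    ⟨⟨0, -1, Or.inr rfl, by rw [Pi.single_neg]; abel⟩, fun _ => by
      have : s - (s + Pi.single 0 1) = Pi.single 0 (-1) := by rw [Pi.single_neg]; abel
      rw [this, rot_single_zero, neg_neg]
      refine ⟨Or.inl ?_, Or.inr htD⟩
      convert ht'B using 1; abel⟩
    ⟨⟨0, 1, Or.inl rfl, by abel⟩, fun _ => by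
      have : s + Pi.single 1 1 + Pi.single 0 1 - (s + Pi.single 1 1) = Pi.single 0 1 := by abel
      rw [this, rot_single_zero, Pi.single_neg]
      refine ⟨Or.inr ?_, Or.inl ?_⟩
      · convert hsD using 1; abel
      · convert hs' using 1; abel⟩
  refine ⟨_, hT, ?_, ?_, ?_⟩
  · rw [← hp1, hp12]; cases l₁ <;> simp
  · rw [← hp2, hp12]; simp [List.getLast?_append, List.getLast?_cons]
  · intro x y hxy hx
    rcases hreq x y hxy hx with h | ⟨rfl, rfl⟩
    · exact consec_append.2 (Or.inr (Or.inl (consec_cons.2 (Or.inr (consec_append.2 (Or.inl h))))))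
    · exact consec_append.2 (Or.inr (Or.inl (consec_cons.2 (Or.inr (consec_append.2
        (Or.inr (Or.inr ⟨ht, rfl⟩)))))))

/-- The tour of a cube of side `4` between two adjacent points of its top facet. -/
theorem exists_base_tour (o : Lattice (n + 2)) :
    ∃ l, IsTour (Ccw (box 0 (-1) o 4)) (box 0 (-1) o 4) l ∧ l.head? = some (o + Pi.single 1 2) ∧
      l.getLast? = some (o + Pi.single 1 3) := by
  have h01 : (1 : Fin (n + 2)) ≠ 0 := by simp
  obtain ⟨l, hl, he, -, hst⟩ := exists_tip_spine o 1 h01 (Or.inl rfl) (Or.inl ⟨rfl, rfl⟩)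
    (fun _ => by rw [Pi.single_neg]; abel)
  have hsub : (o + Pi.single 1 2 - (o + Pi.single 1 3) : Lattice (n + 2)) = Pi.single 1 (-1) := by
    rw [add_sub_add_left_eq_sub, ← Pi.single_sub]; norm_num
  obtain ⟨p, hp, hp1, hp2, -⟩ := exists_comb_box (σ := -1) (Or.inr rfl) 2 hl
    (by simpa [parity_simps] using he) (a := o + Pi.single 1 2) (b := o + Pi.single 1 3)
    ⟨[], l, rfl⟩ (by
      intro hn x y hxy
      rw [hst hn x y hxy, hsub, Pi.single_neg]; abel)
    (fun _ => by rw [hsub, rot_single_one])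
  exact ⟨p, by simpa using hp, hp1, hp2⟩

end GridShift

/-! ### Growing a tour tile by tile -/

namespace GridShift

variable {n : ℕ}

/-- The predecessor and the successor of `v` are distinct, and neither is `v + e`, which is outside
`S`; hence one of them is not `v - e` either, and gives a pair transversal to `e` that can be
opened. By `hvr` no required pair contains `v`, so none is destroyed. In dimension two the square to
the left of the pair lies in `S`, so `e` points to its right, as `Attach` demands. -/
theorem exists_tour_attach {Req : Lattice (n + 2) → Lattice (n + 2) → Prop}
    {S B : Set (Lattice (n + 2))} {l : List (Lattice (n + 2))} (hl : IsTour (Ccw S) S l)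
    {s t e v : Lattice (n + 2)} (hs : l.head? = some s) (ht : l.getLast? = some t)
    (hreq : ∀ x y, Req x y → x ∈ S → Consec l x y) (hd : Disjoint S B)
    (hv : v ∈ S) (hvs : v ≠ s) (hvt : v ≠ t) (hvr : ∀ x, ¬ Req v x ∧ ¬ Req x v)
    (hB : Attach Req B e (v + e)) :
    ∃ l', IsTour (Ccw (S ∪ B)) (S ∪ B) l' ∧ l'.head? = some s ∧ l'.getLast? = some t ∧
      ∀ x y, Req x y → x ∈ S ∪ B → Consec l' x y := by
  obtain ⟨he, hvB, hatt⟩ := hB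
  have hveS : v + e ∉ S := fun h => Set.disjoint_left.1 hd h hvB
  have hvl := (hl.mem v).2 hv
  obtain ⟨u, hu⟩ := exists_consec_left hvl (by rw [hs]; simpa using fun h => hvs h.symm)
  obtain ⟨w, hw⟩ := exists_consec_right hvl (by rw [ht]; simpa using fun h => hvt h.symm)
  have huw : u ≠ w := hu.left_ne_right hl.nodup hw
  have huS : u ∈ S := (hl.mem u).1 hu.mem_left
  have hwS : w ∈ S := (hl.mem w).1 hw.mem_right
  -- a consecutive pair containing `v` and transversal to `e`
  obtain ⟨x, y, f, hxy, hf, hfe, hfe', hvf⟩ : ∃ x y f, Consec l x y ∧ IsStep f ∧ f ≠ e ∧ f ≠ -e ∧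
      ((x = v ∧ y = v + f) ∨ (y = v ∧ x = v + f)) := by
    by_cases h : w - v = -e
    · refine ⟨u, v, u - v, hu, StepRel.symm (hl.rel _ _ hu).1, ?_, ?_, Or.inr ⟨rfl, by simp⟩⟩
      · intro h'; apply hveS; rw [← h']; simpa using huS
      · intro h'; rw [← h] at h'; exact huw (sub_left_injective h')
    · refine ⟨v, w, w - v, hw, (hl.rel _ _ hw).1, ?_, h, Or.inl ⟨rfl, by simp⟩⟩
      intro h'; apply hveS; rw [← h']; simpa using hwS
  have hrot : n = 0 → rot (x - y) = e := by
    intro hn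
    have hC := (hl.rel _ _ hxy).2 hn
    have hrv : v + rot (y - x) ∈ S := by
      rcases hvf with ⟨rfl, rfl⟩ | ⟨rfl, rfl⟩
      · exact hC.1
      · exact hC.2
    have hst : IsStep (y - x) := (hl.rel _ _ hxy).1
    have h1 : y - x ≠ e ∧ y - x ≠ -e := by
      rcases hvf with ⟨rfl, rfl⟩ | ⟨rfl, rfl⟩
      · simpa using ⟨hfe, hfe'⟩
      · simp only [sub_add_cancel_left, ne_eq, neg_inj]
        exact ⟨fun h => hfe' (by rw [← h, neg_neg]), hfe⟩
    rcases rot_eq_or_neg hn he hst h1.1 h1.2 with h | h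
    · rw [h] at hrv; exact absurd hrv hveS
    · rw [← neg_sub, rot_neg, h, neg_neg]
  obtain ⟨p, hp, hpa, hpb, hpr⟩ := hatt f (x + e) (y + e) hf hfe hfe' (by
    rcases hvf with ⟨rfl, rfl⟩ | ⟨rfl, rfl⟩
    · left; exact ⟨rfl, by abel⟩
    · right; exact ⟨rfl, by abel⟩) (by rw [add_sub_add_right_eq_sub]; exact hrot)
  have hxS : x ∈ S := (hl.mem x).1 hxy.mem_left
  have hyS : y ∈ S := (hl.mem y).1 hxy.mem_right
  have hxB : x + e ∈ B := (hp.mem _).1 (List.mem_of_head? hpa)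
  have hyB : y + e ∈ B := (hp.mem _).1 (List.mem_of_getLast? hpb)
  have hre : n = 0 → rot e = y - x := fun hn => by rw [← hrot hn, rot_rot hn, neg_sub]
  obtain ⟨l₁, l₂, rfl⟩ := id hxy
  refine ⟨_, hl.insert (R'' := Ccw (S ∪ B)) hp hd hpa hpb
    (fun _ _ h => h.mono Set.subset_union_left) (fun _ _ h => h.mono Set.subset_union_right)
    ⟨?_, fun hn => ?_⟩ ⟨?_, fun hn => ?_⟩, ?_, ?_, ?_⟩
  · rw [StepRel, add_sub_cancel_left]; exact he
  · rw [add_sub_cancel_left, hre hn]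
    refine ⟨Or.inl ?_, Or.inr ?_⟩
    · simpa using hyS
    · convert hyB using 1; abel
  · rw [StepRel, sub_add_cancel_left]; exact he.neg
  · rw [sub_add_cancel_left, rot_neg, hre hn]
    refine ⟨Or.inr ?_, Or.inl ?_⟩
    · convert hxB using 1; abel
    · convert hxS using 1; abel
  · rw [← hs]; cases l₁ <;> simp
  · rw [← ht]; simp [List.getLast?_append, List.getLast?_cons]
  · rintro x' y' hr (hx | hx)
    · refine consec_insert (hreq _ _ hr hx) ?_
      rintro ⟨rfl, rfl⟩
      rcases hvf with ⟨rfl, -⟩ | ⟨rfl, -⟩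
      · exact (hvr _).1 hr
      · exact (hvr _).2 hr
    · exact consec_append.2 (Or.inr (Or.inl (consec_cons.2 (Or.inr (consec_append.2
        (Or.inl (hpr _ _ hr hx)))))))

/-- A tour of one tile extends to a tour of the whole finite set `C`, if every union of tiles that
contains the first one can be left through a tile that may be attached to it. -/
theorem exists_tour_of_attach {Req : Lattice (n + 2) → Lattice (n + 2) → Prop}
    {C : Set (Lattice (n + 2))} (hC : C.Finite)
    (tile : Lattice (n + 2) → Set (Lattice (n + 2))) (hmem : ∀ x ∈ C, x ∈ tile x ∧ tile x ⊆ C)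
    (hpart : ∀ x ∈ C, ∀ y ∈ tile x, tile y = tile x) {s t : Lattice (n + 2)}
    (hreach : ∀ S, S ⊆ C → s ∈ S → (∀ x ∈ S, tile x ⊆ S) → S ≠ C →
      ∃ x ∈ C, x ∉ S ∧ ∃ e v, v ∈ S ∧ v ≠ s ∧ v ≠ t ∧ (∀ x, ¬ Req v x ∧ ¬ Req x v) ∧
        Attach Req (tile x) e (v + e))
    {S : Set (Lattice (n + 2))} (hSC : S ⊆ C) (hsat : ∀ x ∈ S, tile x ⊆ S)
    {l : List (Lattice (n + 2))} (hl : IsTour (Ccw S) S l) (hs : l.head? = some s)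
    (ht : l.getLast? = some t) (hreq : ∀ x y, Req x y → x ∈ S → Consec l x y) :
    ∃ l', IsTour (Ccw C) C l' ∧ l'.head? = some s ∧ l'.getLast? = some t ∧
      ∀ x y, Req x y → x ∈ C → Consec l' x y := by
  induction hk : (C \ S).ncard using Nat.strong_induction_on generalizing S l with
  | _ k ih =>
    by_cases hSC' : S = C
    · subst hSC'; exact ⟨l, hl, hs, ht, hreq⟩
    · obtain ⟨x, hxC, hxS, e, v, hv, hvs, hvt, hvr, hatt⟩ := hreach S hSC
        ((hl.mem s).1 (List.mem_of_head? hs)) hsat hSC'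
      have hd : Disjoint S (tile x) := by
        rw [Set.disjoint_left]
        intro z hz hzx
        apply hxS
        have := hsat z hz
        rw [hpart x hxC z hzx] at this
        exact this (hmem x hxC).1
      obtain ⟨l', hl', hs', ht', hr'⟩ := exists_tour_attach hl hs ht hreq hd hv hvs hvt hvr hatt
      refine ih _ ?_ (Set.union_subset hSC (hmem x hxC).2) ?_ hl' hs' ht' hr' rfl
      · rw [← hk]
        refine Set.ncard_lt_ncard ?_ (hC.sdiff)
        refine ⟨Set.sdiff_subset_sdiff_right Set.subset_union_left, fun h => ?_⟩
        exact (h ⟨hxC, hxS⟩).2 (Or.inr (hmem x hxC).1)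
      · rintro z (hz | hz)
        · exact (hsat z hz).trans Set.subset_union_left
        · rw [hpart x hxC z hz]; exact Set.subset_union_right

end GridShift

namespace GridShift

/-! ### Connectedness as propagation of properties -/

section Linked

variable {d : ℕ}

theorem stepRel_iff_adj {x y : Lattice d} : StepRel x y ↔ (cayleyGraph d).Adj x y := by
  constructor
  · rintro ⟨i, σ, rfl | rfl, h⟩
    · exact ⟨i, Or.inl (by rw [← h]; abel)⟩
    · exact ⟨i, Or.inr (by rw [Pi.single_neg] at h; rw [← neg_neg (Pi.single i 1), ← h]; abel)⟩
  · rintro ⟨i, rfl | rfl⟩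
    · exact ⟨i, 1, Or.inl rfl, by abel⟩
    · exact ⟨i, -1, Or.inr rfl, by rw [Pi.single_neg]; abel⟩

/-- Any property that propagates along the edges within `A` and holds at some point of `A` holds
at all points of `A`. -/
def Linked (A : Set (Lattice d)) : Prop :=
  ∀ p : Lattice d → Prop, (∀ x ∈ A, ∀ y ∈ A, StepRel x y → p x → p y) →
    ∀ x ∈ A, ∀ y ∈ A, p x → p y

theorem Linked.of_connected {A : Set (Lattice d)} (h : ((cayleyGraph d).induce A).Connected) :
    Linked A := by
  intro p hp x hx y hy hpx
  obtain ⟨w⟩ := h.preconnected ⟨x, hx⟩ ⟨y, hy⟩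
  have : ∀ (u v : A), ((cayleyGraph d).induce A).Walk u v → p u → p v := by
    intro u v w
    induction w with
    | nil => exact id
    | cons h _ ih => exact fun hu => ih (hp _ (Subtype.prop _) _ (Subtype.prop _)
        (stepRel_iff_adj.2 h) hu)
  exact this _ _ w hpx

theorem Linked.connected {A : Set (Lattice d)} (hne : A.Nonempty) (h : Linked A) :
    ((cayleyGraph d).induce A).Connected := by
  have : Nonempty A := hne.to_subtype
  refine ⟨fun u v => ?_⟩
  have := h (fun z => ∀ hz : z ∈ A, ((cayleyGraph d).induce A).Reachable u ⟨z, hz⟩) (by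
    intro x hx y hy hxy hpx _
    refine (hpx hx).trans (SimpleGraph.Adj.reachable ?_)
    exact stepRel_iff_adj.1 hxy) u u.2 v v.2 (fun _ => SimpleGraph.Reachable.refl _)
  exact this v.2

/-- Properties propagate between two points that span a box within `A`. -/
theorem propagate_of_box {A : Set (Lattice d)} {p : Lattice d → Prop}
    (hp : ∀ x ∈ A, ∀ y ∈ A, StepRel x y → p x → p y) {x y : Lattice d}
    (hA : ∀ z : Lattice d, (∀ a, min (x a) (y a) ≤ z a ∧ z a ≤ max (x a) (y a)) → z ∈ A)
    (hx : p x) : p y := by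
  induction hk : ∑ a, (x a - y a).natAbs using Nat.strong_induction_on generalizing x with
  | _ k ih =>
    by_cases hxy : x = y
    · exact hxy ▸ hx
    · obtain ⟨a, ha⟩ := Function.ne_iff.1 hxy
      obtain ⟨σ, hσ, hσa⟩ : ∃ σ : ℤ, (σ = 1 ∨ σ = -1) ∧
          (x a + σ - y a).natAbs < (x a - y a).natAbs := by
        rcases lt_or_gt_of_ne ha with h | h
        · exact ⟨1, Or.inl rfl, by omega⟩
        · exact ⟨-1, Or.inr rfl, by omega⟩
      have hmem : ∀ z : Lattice d, (∀ b, min ((x + Pi.single a σ : Lattice d) b) (y b) ≤ z b ∧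
          z b ≤ max ((x + Pi.single a σ : Lattice d) b) (y b)) → z ∈ A := by
        intro z hz
        refine hA z fun b => ?_
        have := hz b
        by_cases hb : b = a
        · subst hb; simp at this; omega
        · simpa [hb] using this
      refine ih _ ?_ hmem (hp x (hA x fun b => by omega) _ (hmem _ fun b => by omega)
        ⟨a, σ, hσ, by abel⟩ hx) rfl
      rw [← hk]
      refine Finset.sum_lt_sum (fun b _ => ?_) ⟨a, Finset.mem_univ _, ?_⟩
      · by_cases hb : b = a
        · subst hb; simpa using hσa.le
        · simp [hb]
      · simpa using hσa

end Linked

/-! ### Exactness of closed one-dimensional cochains -/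

section Cochains

variable {d : ℕ} {G : Type*} [AddCommGroup G]

/-- A discrete primitive of a function on `ℤ`. -/
noncomputable def primitive (φ : ℤ → G) (z : ℤ) : G :=
  ∑ k ∈ Finset.Ico 0 z, φ k - ∑ k ∈ Finset.Ico z 0, φ k

theorem primitive_succ (φ : ℤ → G) (z : ℤ) : primitive φ (z + 1) = primitive φ z + φ z := by
  unfold primitive
  rcases le_or_gt 0 z with h | h
  · have h1 : Finset.Ico (z + 1) 0 = ∅ := Finset.Ico_eq_empty (by omega)
    have h2 : Finset.Ico z 0 = ∅ := Finset.Ico_eq_empty (by omega)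
    have h3 : Finset.Ico 0 (z + 1) = insert z (Finset.Ico 0 z) := by ext k; simp; omega
    rw [h1, h2, h3, Finset.sum_insert (by simp)]
    simp [add_comm]
  · have h1 : Finset.Ico 0 (z + 1) = ∅ := Finset.Ico_eq_empty (by omega)
    have h2 : Finset.Ico 0 z = ∅ := Finset.Ico_eq_empty (by omega)
    have h3 : Finset.Ico z 0 = insert z (Finset.Ico (z + 1) 0) := by ext k; simp; omega
    rw [h1, h2, h3, Finset.sum_insert (by simp)]
    simp

/-- Every closed one-dimensional cochain on the lattice is exact. -/
theorem exists_potential (g : Fin d → Lattice d → G)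
    (hg : ∀ i j x, g i x + g j (x + Pi.single i 1) = g j x + g i (x + Pi.single j 1)) :
    ∃ f : Lattice d → G, ∀ i x, f (x + Pi.single i 1) = f x + g i x := by
  suffices h : ∀ A : Finset (Fin d), ∃ f : Lattice d → G,
      ∀ i ∈ A, ∀ x, f (x + Pi.single i 1) = f x + g i x by
    obtain ⟨f, hf⟩ := h Finset.univ
    exact ⟨f, fun i => hf i (Finset.mem_univ i)⟩
  intro A
  induction A using Finset.induction_on with
  | empty => exact ⟨0, by simp⟩
  | insert c A hc ih =>
    obtain ⟨f, hf⟩ := ih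
    -- The defect of `f` in direction `c`. Closedness makes it invariant in the directions of `A`,
    -- so adding its primitive along `c` to `f` corrects this direction without disturbing the
    -- others.
    set g' : Lattice d → G := fun x => g c x - (f (x + Pi.single c 1) - f x) with hg'
    have hinv : ∀ i ∈ A, ∀ x, g' (x + Pi.single i 1) = g' x := by
      intro i hi x
      have h1 := hf i hi x
      have h2 := hf i hi (x + Pi.single c 1)
      have h3 := hg c i x
      have h4 : x + Pi.single i 1 + Pi.single c 1 = x + Pi.single c 1 + Pi.single i 1 := by abel
      simp only [hg', h4, h1, h2]
      rw [← eq_sub_iff_add_eq'] at h3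
      rw [h3]
      abel
    refine ⟨fun x => f x + primitive (fun z => g' (Function.update x c z)) (x c), ?_⟩
    intro i hi x
    by_cases hic : i = c
    · subst hic
      have h1 : ∀ z, Function.update (x + Pi.single i 1) i z = Function.update x i z := by
        intro z; funext a
        by_cases ha : a = i
        · subst ha; simp
        · simp [ha]
      have h2 : (x + Pi.single i 1 : Lattice d) i = x i + 1 := by simp
      simp only [h1]
      rw [h2, primitive_succ, Function.update_eq_self]
      simp only [hg']
      abel
    · have hiA : i ∈ A := by simpa [hic] using hi
      have h1 : ∀ z, Function.update (x + Pi.single i 1) c z =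
          Function.update x c z + Pi.single i 1 := by
        intro z; funext a
        by_cases ha : a = c
        · subst ha; simp [Ne.symm hic]
        · simp [ha]
      have h2 : (x + Pi.single i 1 : Lattice d) c = x c := by simp [Ne.symm hic]
      simp only [h1, h2, hinv i hiA, hf i hiA]
      abel

end Cochains

/-! ### Removing far apart sets with connected complements -/

section Removal

variable {d : ℕ}

theorem and_congr_iff_of_mem {a b p q : Prop} (ha : a) (hb : b) (h : a → b → (p ↔ q)) :
    (a ∧ p) ↔ (b ∧ q) := by
  simp [ha, hb, h ha hb]

/-- Label the vertices of a `4`-cycle so that no vertex has both labels and that adjacent vertices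
without the first label agree on the second.  Then an even number of edges joins different
labels. -/
theorem square_even {e₀ e₁ e₂ e₃ q₀ q₁ q₂ q₃ : Prop} [Decidable e₀] [Decidable e₁] [Decidable e₂]
    [Decidable e₃] [Decidable q₀] [Decidable q₁] [Decidable q₂] [Decidable q₃]
    (h₀ : e₀ → ¬ q₀) (h₁ : e₁ → ¬ q₁) (h₂ : e₂ → ¬ q₂) (h₃ : e₃ → ¬ q₃)
    (h₀₁ : ¬ e₀ → ¬ e₁ → (q₀ ↔ q₁)) (h₀₂ : ¬ e₀ → ¬ e₂ → (q₀ ↔ q₂))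
    (h₁₃ : ¬ e₁ → ¬ e₃ → (q₁ ↔ q₃)) (h₂₃ : ¬ e₂ → ¬ e₃ → (q₂ ↔ q₃)) :
    ((if (e₀ ∧ q₁) ∨ (e₁ ∧ q₀) then 1 else 0) + (if (e₁ ∧ q₃) ∨ (e₃ ∧ q₁) then 1 else 0) : ZMod 2) =
      (if (e₀ ∧ q₂) ∨ (e₂ ∧ q₀) then 1 else 0) + (if (e₂ ∧ q₃) ∨ (e₃ ∧ q₂) then 1 else 0) := by
  have two : (1 : ZMod 2) + 1 = 0 := rfl
  by_cases e₀ <;> by_cases e₁ <;> by_cases e₂ <;> by_cases e₃ <;> simp_all <;>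
    by_cases q₀ <;> simp_all <;> by_cases q₁ <;> simp_all <;> by_cases q₂ <;> simp_all

/-- Removing from a linked set far apart sets with linked complements leaves a linked set. -/
theorem Linked.diff_iUnion {ι : Type*} {C : Set (Lattice d)} {E : ι → Set (Lattice d)}
    (hC : Linked C) (hE : ∀ j, Linked (E j)ᶜ)
    (hthick : ∀ j, ∀ x ∈ E j, ∀ y : Lattice d, (∀ a, |x a - y a| ≤ 1) → y ∈ C)
    (hdis : ∀ i j, i ≠ j → ∀ x ∈ E i, ∀ y ∈ E j, ¬ ∀ a, |x a - y a| ≤ 1) :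
    Linked (C \ ⋃ j, E j) := by
  classical
  intro p hp x₀ hx₀ y₀ hy₀ hpx₀
  set M := C \ ⋃ j, E j with hM
  set Q : Lattice d → Prop := fun z => z ∈ M ∧ p z with hQ
  have hME : ∀ z ∈ M, ∀ j, z ∉ E j := fun z hz j hj => hz.2 (Set.mem_iUnion.2 ⟨j, hj⟩)
  have hcase : ∀ j, ∀ x ∈ E j, ∀ y : Lattice d, (∀ a, |x a - y a| ≤ 1) → y ∈ E j ∨ y ∈ M := by
    intro j x hx y hy
    by_cases h : y ∈ ⋃ i, E i
    · obtain ⟨i, hi⟩ := Set.mem_iUnion.1 h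
      by_cases hij : j = i
      · subst hij; exact Or.inl hi
      · exact absurd hy (hdis j i hij x hx y hi)
    · exact Or.inr ⟨hthick j x hx y hy, h⟩
  have hpp : ∀ x ∈ M, ∀ y ∈ M, StepRel x y → (p x ↔ p y) := fun x hx y hy h =>
    ⟨hp x hx y hy h, hp y hy x hx h.symm⟩
  -- Marking the edges between `E j` and `Q` gives a cochain modulo 2, and `square_even` says that
  -- it is closed. Its potential is constant on the complement of `E j`, which is linked and
  -- contains no marked edge, and can be normalised to vanish there.
  have key : ∀ j, ∃ f : Lattice d → ZMod 2, (∀ z ∉ E j, f z = 0) ∧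
      ∀ x y, StepRel x y → f y = f x +
        if (x ∈ E j ∧ Q y) ∨ (y ∈ E j ∧ Q x) then 1 else 0 := by
    intro j
    set g : Fin d → Lattice d → ZMod 2 := fun i x =>
      if (x ∈ E j ∧ Q (x + Pi.single i 1)) ∨ (x + Pi.single i 1 ∈ E j ∧ Q x) then 1 else 0
      with hg
    obtain ⟨f, hf⟩ := exists_potential g (by
      intro a b x
      by_cases hab : a = b
      · subst hab; rfl
      set x1 : Lattice d := x + Pi.single a 1 with hx1
      set x2 : Lattice d := x + Pi.single b 1 with hx2
      set x3 : Lattice d := x1 + Pi.single b 1 with hx3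
      have hx3' : x2 + Pi.single a 1 = x3 := by rw [hx3, hx2, hx1]; abel
      have s1 : StepRel x x1 := ⟨a, 1, Or.inl rfl, by rw [hx1]; abel⟩
      have s2 : StepRel x x2 := ⟨b, 1, Or.inl rfl, by rw [hx2]; abel⟩
      have s3 : StepRel x1 x3 := ⟨b, 1, Or.inl rfl, by rw [hx3]; abel⟩
      have s4 : StepRel x2 x3 := ⟨a, 1, Or.inl rfl, by rw [← hx3']; abel⟩
      have hnear : ∀ u ∈ ({x, x1, x2, x3} : Set (Lattice d)),
          ∀ v ∈ ({x, x1, x2, x3} : Set (Lattice d)), ∀ c, |u c - v c| ≤ 1 := by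
        have hval : ∀ u ∈ ({x, x1, x2, x3} : Set (Lattice d)), ∀ c, x c ≤ u c ∧ u c ≤ x c + 1 := by
          rintro u (rfl | rfl | rfl | rfl) c
          · simp
          · rw [hx1]; by_cases hc : c = a <;> simp [hc]
          · rw [hx2]; by_cases hc : c = b <;> simp [hc]
          · rw [hx3, hx1]
            simp only [Pi.add_apply, Pi.single_apply]
            split_ifs with h1 h2 <;> first | (exact absurd (h1.symm.trans h2) hab) | omega
        intro u hu v hv c
        have := hval u hu c
        have := hval v hv c
        rw [abs_le]; omega
      simp only [hg]
      rw [hx3', ← hx3, ← hx1, ← hx2]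
      -- A unit square that meets `E j` lies in `E j ∪ M`, as the other sets are too far away; a
      -- square that misses `E j` has no marked edge.
      by_cases hany : ∃ u ∈ ({x, x1, x2, x3} : Set (Lattice d)), u ∈ E j
      · obtain ⟨u, hu, huE⟩ := hany
        have c0 := hcase j u huE x (hnear u hu x (by simp))
        have c1 := hcase j u huE x1 (hnear u hu x1 (by simp))
        have c2 := hcase j u huE x2 (hnear u hu x2 (by simp))
        have c3 := hcase j u huE x3 (hnear u hu x3 (by simp))
        have e0 := hME x
        have e1 := hME x1
        have e2 := hME x2
        have e3 := hME x3
        have p1 := fun h h' => hpp x h x1 h' s1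
        have p2 := fun h h' => hpp x h x2 h' s2
        have p3 := fun h h' => hpp x1 h x3 h' s3
        have p4 := fun h h' => hpp x2 h x3 h' s4
        simp only [hQ]
        exact square_even
          (fun h h' => e0 h'.1 j h) (fun h h' => e1 h'.1 j h) (fun h h' => e2 h'.1 j h)
          (fun h h' => e3 h'.1 j h)
          (fun h h' => and_congr_iff_of_mem (c0.resolve_left h) (c1.resolve_left h') p1)
          (fun h h' => and_congr_iff_of_mem (c0.resolve_left h) (c2.resolve_left h') p2)
          (fun h h' => and_congr_iff_of_mem (c1.resolve_left h) (c3.resolve_left h') p3)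
          (fun h h' => and_congr_iff_of_mem (c2.resolve_left h) (c3.resolve_left h') p4)
      · have hno : ∀ u ∈ ({x, x1, x2, x3} : Set (Lattice d)), u ∉ E j :=
          fun u hu h => hany ⟨u, hu, h⟩
        have n0 := hno x (by simp)
        have n1 := hno x1 (by simp)
        have n2 := hno x2 (by simp)
        have n3 := hno x3 (by simp)
        simp [n0, n1, n2, n3])
    have hstep : ∀ x y, StepRel x y → f y = f x +
        if (x ∈ E j ∧ Q y) ∨ (y ∈ E j ∧ Q x) then 1 else 0 := by
      rintro x y ⟨i, σ, rfl | rfl, h⟩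
      · obtain rfl : y = x + Pi.single i 1 := by rw [← h]; abel
        exact hf i x
      · obtain rfl : x = y + Pi.single i 1 := by
          rw [Pi.single_neg] at h; rw [← neg_neg (Pi.single i 1), ← h]; abel
        rw [hf i y]
        simp only [hg]
        have two : (1 : ZMod 2) + 1 = 0 := rfl
        by_cases h1 : y ∈ E j ∧ Q (y + Pi.single i 1) <;>
          by_cases h2 : y + Pi.single i 1 ∈ E j ∧ Q y <;> simp [h1, h2, add_assoc, two]
    have hconst : ∀ z ∉ E j, f z = f x₀ := by
      intro z hz
      refine hE j (fun z => f z = f x₀) ?_ x₀ (hME x₀ hx₀ j) z hz rfl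
      intro x hx y hy hxy h
      have := hstep x y hxy
      rw [if_neg (by rintro (h | h); exacts [hx h.1, hy h.1]), add_zero] at this
      exact this.trans h
    refine ⟨fun z => f z - f x₀, fun z hz => by simp [hconst z hz], fun x y hxy => ?_⟩
    simp only [hstep x y hxy]; ring
  -- Fill the holes: the property is extended from `M` into `E j` by the condition that the
  -- potential is 1. A step into or out of `E j` changes the potential exactly if its end in `M` has
  -- the property, so the extension propagates throughout `C`.
  choose f hf0 hfs using key
  have := hC (fun z => (∃ j, z ∈ E j ∧ f j z = 1) ∨ Q z) (by
    rintro z hz z' hz' hzz (⟨j, hj, hfj⟩ | hQz)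
    · have hs := hfs j z z' hzz
      by_cases hj' : z' ∈ E j
      · left
        refine ⟨j, hj', ?_⟩
        rw [hs, hfj, if_neg, add_zero]
        rintro (h | h)
        · exact hME _ h.2.1 j hj'
        · exact hME _ h.2.1 j hj
      · right
        rw [hf0 j z' hj', hfj] at hs
        by_contra hQ'
        rw [if_neg (by rintro (h | h); exacts [hQ' h.2, hj' h.1])] at hs
        simp at hs
    · by_cases hu : z' ∈ ⋃ j, E j
      · obtain ⟨j, hj⟩ := Set.mem_iUnion.1 hu
        left
        refine ⟨j, hj, ?_⟩
        rw [hfs j z z' hzz, hf0 j z (hME z hQz.1 j), if_pos (Or.inr ⟨hj, hQz⟩), zero_add]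
      · right
        exact ⟨⟨hz', hu⟩, hp z hQz.1 z' ⟨hz', hu⟩ hzz hQz.2⟩) x₀ hx₀.1 y₀ hy₀.1
      (Or.inr ⟨hx₀, hpx₀⟩)
  rcases this with ⟨j, hj, -⟩ | h
  · exact absurd hj (hME y₀ hy₀ j)
  · exact h.2

end Removal

end GridShift

/-! ### Layers between the grids of two regions -/

namespace GridShift

section Layers

variable {d : ℕ}

/-- `B` is a union of cubes of side `32` of the grid with a corner at `g`. -/
def Aligned (g : Lattice d) (B : Set (Lattice d)) : Prop :=
  ∀ x y : Lattice d, (∀ a, (x a - g a) / 32 = (y a - g a) / 32) → x ∈ B → y ∈ B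

/-- In one coordinate: the cell of side `4` number `c` of the grid at `G` touches or is next to one
that touches the cell of side `32` number `κ` of the grid at `g`. -/
def Near (G g c κ : ℤ) : Prop :=
  (g + 32 * κ - G) / 4 - 1 ≤ c ∧ c ≤ (g + 32 * κ + 31 - G) / 4 + 1

/-- The set `D`, thickened in the first `m` coordinates to cells of the grid at `G`. -/
def layer (G g : Lattice d) (D : Set (Lattice d)) (m : ℕ) : Set (Lattice d) :=
  {x | ∃ y ∈ D, ∀ a : Fin d,
    (a.val < m → Near (G a) (g a) ((x a - G a) / 4) ((y a - g a) / 32)) ∧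
    (m ≤ a.val → (x a - g a) / 32 = (y a - g a) / 32)}

/-- The cells of side `4` of the grid at `G` that belong to the thickening of `D`. -/
def coarse (G g : Lattice d) (D : Set (Lattice d)) : Set (Lattice d) :=
  {β | ∃ y ∈ D, ∀ a, Near (G a) (g a) (β a) ((y a - g a) / 32)}

theorem mem_layer_iff_coarse {G g : Lattice d} {D : Set (Lattice d)} {x : Lattice d} :
    x ∈ layer G g D d ↔ (fun a => (x a - G a) / 4) ∈ coarse G g D := by
  constructor
  · rintro ⟨y, hy, h⟩
    exact ⟨y, hy, fun a => (h a).1 a.2⟩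
  · rintro ⟨y, hy, h⟩
    exact ⟨y, hy, fun a => ⟨fun _ => h a, fun ha => absurd a.2 (by omega)⟩⟩

theorem layer_zero {G g : Lattice d} {D : Set (Lattice d)} (hD : Aligned g D) :
    layer G g D 0 = D := by
  ext x
  constructor
  · rintro ⟨y, hy, h⟩
    exact hD y x (fun a => ((h a).2 (by omega)).symm) hy
  · intro hx
    exact ⟨x, hx, fun a => ⟨fun h => by omega, fun _ => rfl⟩⟩

theorem layer_mono {G g : Lattice d} {D : Set (Lattice d)} {m m' : ℕ} (h : m ≤ m') :
    layer G g D m ⊆ layer G g D m' := by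
  rintro x ⟨y, hy, hx⟩
  refine ⟨y, hy, fun a => ⟨fun ha => ?_, fun ha => (hx a).2 (h.trans ha)⟩⟩
  by_cases h' : a.val < m
  · exact (hx a).1 h'
  · have := (hx a).2 (by omega)
    unfold Near
    omega

/-- Clamp `x` to the cube of side 32 of a witness. The distance 7 comes from at most 3 points of a
cell of side 4 that sticks out of this cube and the 4 points of the next cell. -/
theorem exists_near_of_mem_layer {G g : Lattice d} {D : Set (Lattice d)} (hD : Aligned g D)
    {m : ℕ} {x : Lattice d} (hx : x ∈ layer G g D m) : ∃ y ∈ D, ∀ a, |x a - y a| ≤ 7 := by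
  obtain ⟨y, hy, h⟩ := hx
  refine ⟨fun a => max (g a + 32 * ((y a - g a) / 32))
    (min (x a) (g a + 32 * ((y a - g a) / 32) + 31)), hD y _ (fun a => ?_) hy, fun a => ?_⟩
  · omega
  · simp only [abs_le]
    have := h a
    unfold Near at this
    rcases lt_or_ge a.val m with h' | h'
    · have := this.1 h'
      omega
    · have := this.2 h'
      omega

/-- A cell outside the thickening is joined, within the complement, to the cell at the centre of the
cube of side 32 that contains its corner, since moving towards this centre brings no new cubes near.
A step in the complement of `D` then moves between the centres of equal or adjacent cubes; side 32
is large enough that only these two cubes are near the segment between their centres. -/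
theorem linked_compl_coarse {G g : Lattice d} {D : Set (Lattice d)} (hD : Aligned g D)
    (hL : Linked Dᶜ) : Linked (coarse G g D)ᶜ := by
  intro p hp x hx y hy hpx
  set core : Lattice d → Lattice d := fun w a =>
    (g a + 32 * ((w a - g a) / 32) + 16 - G a) / 4 with hcore
  set corner : Lattice d → Lattice d := fun β a => G a + 4 * β a with hcorner
  have hD' : ∀ β ∈ (coarse G g D)ᶜ, corner β ∈ Dᶜ := by
    intro β hβ h
    refine hβ ⟨corner β, h, fun a => ?_⟩
    unfold Near
    simp only [hcorner]
    omega
  have hhull : ∀ β ∈ (coarse G g D)ᶜ, ∀ z : Lattice d,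
      (∀ a, min (β a) (core (corner β) a) ≤ z a ∧ z a ≤ max (β a) (core (corner β) a)) →
      z ∈ (coarse G g D)ᶜ := by
    rintro β hβ z hz ⟨y, hy, h⟩
    refine hβ ⟨y, hy, fun a => ?_⟩
    have h1 := hz a
    have h2 := h a
    unfold Near at *
    simp only [hcore, hcorner] at h1
    omega
  have h1 : p (core (corner x)) := propagate_of_box hp (hhull x hx) hpx
  have h2 : p (core (corner y)) := by
    refine hL (fun w => p (core w)) ?_ (corner x) (hD' x hx) (corner y) (hD' y hy) h1
    rintro u hu v hv ⟨i, σ, hσ, huv⟩ hpu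
    refine propagate_of_box hp ?_ hpu
    rintro z hz ⟨y, hy, h⟩
    have hval : ∀ a, v a = u a + (Pi.single i σ : Lattice d) a := by
      intro a; rw [← huv]; simp
    by_cases hyi : (y i - g i) / 32 = (u i - g i) / 32
    · refine hu (hD y u (fun a => ?_) hy)
      by_cases ha : a = i
      · exact ha ▸ hyi
      · have h1 := hz a
        have h2 := h a
        have h3 := hval a
        simp only [hcore, Pi.single_eq_of_ne ha] at h1 h3
        unfold Near at h2
        rw [h3] at h1
        omega
    · refine hv (hD y v (fun a => ?_) hy)
      have h1 := hz a
      have h2 := h a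
      have h3 := hval a
      unfold Near at h2
      simp only [hcore] at h1
      by_cases ha : a = i
      · subst ha
        simp only [Pi.single_eq_same] at h3
        rw [h3] at h1 ⊢
        omega
      · simp only [Pi.single_eq_of_ne ha] at h3
        rw [h3] at h1 ⊢
        omega
  refine propagate_of_box hp (fun z hz => hhull y hy z fun a => ?_) h2
  have := hz a
  omega

/-- In one coordinate: `z` lies in the cells of side `4` of the grid at `G` next to the lower end
of its cell of side `32` of the grid at `g`. -/
def Low (G g z : ℤ) : Prop := (z - G) / 4 ≤ (g + 32 * ((z - g) / 32) - 1 - G) / 4 + 1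

/-- The analogue of `Low` at the upper end of the cell. -/
def High (G g z : ℤ) : Prop := (g + 32 * ((z - g) / 32) + 32 - G) / 4 - 1 ≤ (z - G) / 4

/-- The tile around a point of `layer (i + 1)` outside of `layer i`. -/
def shellTile (G g : Lattice d) (i : Fin d) (x : Lattice d) : Set (Lattice d) :=
  {y | ∀ a, (a < i → (y a - G a) / 4 = (x a - G a) / 4) ∧
    (i < a → (y a - g a) / 4 = (x a - g a) / 4) ∧
    (a = i → (y a - g a) / 32 = (x a - g a) / 32 ∧ (Low (G a) (g a) (y a) ↔ Low (G a) (g a) (x a)) ∧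
      (High (G a) (g a) (y a) ↔ High (G a) (g a) (x a)))}

theorem mem_shellTile_self (G g : Lattice d) (i : Fin d) (x : Lattice d) :
    x ∈ shellTile G g i x := fun _ => ⟨fun _ => rfl, fun _ => rfl, fun _ => ⟨rfl, Iff.rfl, Iff.rfl⟩⟩

theorem shellTile_eq {G g : Lattice d} {i : Fin d} {x y : Lattice d}
    (h : y ∈ shellTile G g i x) : shellTile G g i y = shellTile G g i x := by
  ext z
  refine forall_congr' fun a => ?_
  have := h a
  refine and_congr (imp_congr_right fun ha => ?_) (and_congr (imp_congr_right fun ha => ?_)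
    (imp_congr_right fun ha => ?_))
  · rw [this.1 ha]
  · rw [this.2.1 ha]
  · have := this.2.2 ha
    rw [this.1, this.2.1, this.2.2]

/-- Membership in `layer i` depends only on the cells at `G` in the coordinates below `i` and on the
cubes of side 32 at `g` in the others, and these are constant on the tile. -/
theorem mem_layer_of_shellTile {G g : Lattice d} {D : Set (Lattice d)} {i : Fin d}
    {x y : Lattice d} (h : y ∈ shellTile G g i x) (hx : x ∈ layer G g D i) :
    y ∈ layer G g D i := by
  obtain ⟨z, hz, hxz⟩ := hx
  refine ⟨z, hz, fun a => ⟨fun ha => ?_, fun ha => ?_⟩⟩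
  · rw [(h a).1 ha]; exact (hxz a).1 ha
  · have h1 := (hxz a).2 ha
    rcases lt_or_eq_of_le ha with ha' | ha'
    · have := (h a).2.1 ha'
      omega
    · have := ((h a).2.2 (Fin.ext ha'.symm)).1
      omega

/-- In coordinate `i`, a point of the interval number `κ` of length 32 is near `κ` itself, near `κ -
1` exactly if it is low, and near `κ + 1` exactly if it is high. The tile fixes all of this. -/
theorem mem_layer_succ_of_shellTile {G g : Lattice d} {D : Set (Lattice d)} {i : Fin d}
    {x y : Lattice d} (h : y ∈ shellTile G g i x) (hx : x ∈ layer G g D (i + 1)) :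
    y ∈ layer G g D (i + 1) := by
  obtain ⟨z, hz, hxz⟩ := hx
  refine ⟨z, hz, fun a => ⟨fun ha => ?_, fun ha => ?_⟩⟩
  · have h1 := (hxz a).1 ha
    by_cases hai : a = i
    · have := (h a).2.2 hai
      unfold Near Low High at *
      omega
    · have : a < i := by
        have : a.val ≠ i.val := fun h => hai (Fin.ext h)
        exact Fin.lt_def.2 (by omega)
      rw [(h a).1 this]; exact h1
  · have h1 := (hxz a).2 ha
    have := (h a).2.1 (Fin.lt_def.2 (by omega))
    omega

theorem low_or_high {G g : Lattice d} {D : Set (Lattice d)} {i : Fin d} {x : Lattice d}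
    (hx : x ∈ layer G g D (i + 1)) (hx' : x ∉ layer G g D i) :
    Low (G i) (g i) (x i) ∨ High (G i) (g i) (x i) := by
  obtain ⟨z, hz, hxz⟩ := hx
  by_contra hcon
  refine hx' ⟨z, hz, fun a => ⟨fun ha => (hxz a).1 (by omega), fun ha => ?_⟩⟩
  rcases lt_or_eq_of_le ha with ha' | ha'
  · exact (hxz a).2 (by omega)
  · obtain rfl : i = a := Fin.ext ha'
    have h1 := (hxz i).1 (by omega)
    unfold Near Low High at *
    omega

end Layers

section Tiles

variable {n : ℕ}

/-- The tile of a point of `layer (i + 1)` outside of `layer i` is a box, the points beyond whose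
outer facet are not in `layer (i + 1)`. -/
theorem exists_box_shellTile {G g : Lattice (n + 2)} {D : Set (Lattice (n + 2))} {i : Fin (n + 2)}
    {x : Lattice (n + 2)} (hx : x ∈ layer G g D (i + 1)) (hx' : x ∉ layer G g D i) :
    ∃ σ o h, (σ = 1 ∨ σ = -1) ∧ 2 ≤ h ∧ shellTile G g i x = box i σ o h ∧
      (∀ a, i < a → o a = g a + 4 * ((x a - g a) / 4)) ∧ (σ = 1 → High (G i) (g i) (x i)) ∧
      (σ = -1 → o i - h + 1 = g i + 32 * ((x i - g i) / 32)) ∧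
      ∃ v, v + Pi.single i σ = o + mid (Finset.univ.erase i) ∧ v ∉ layer G g D (i + 1) ∧
        ∀ a, |v a - x a| ≤ 8 := by
  set κ := (x i - g i) / 32 with hκ
  -- The lower corner of the tile in the transversal coordinates: those before `i` already follow
  -- the grid at `G`, those after `i` still the grid at `g`.
  set off : Fin (n + 2) → ℤ := fun a =>
    if a < i then G a + 4 * ((x a - G a) / 4) else g a + 4 * ((x a - g a) / 4) with hoff
  have hmid : ∀ a, a ≠ i → mid (Finset.univ.erase i) a = 1 ∨ mid (Finset.univ.erase i) a = 2 := by
    intro a ha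
    simp only [mid, Finset.mem_erase, Finset.mem_univ, and_true, ne_eq, ha, not_false_eq_true,
      if_true]
    split_ifs <;> simp
  have hmidi : mid (Finset.univ.erase i) i = 0 := by simp [mid]
  have hne : ∀ a, a ≠ i → ¬ a < i → i < a := fun a h1 h2 => lt_of_le_of_ne (not_lt.1 h2) h1.symm
  have hbox : ∀ (σ oi h : ℤ), (∀ z, ((z - g i) / 32 = κ ∧ (Low (G i) (g i) z ↔ Low (G i) (g i) (x i)) ∧
      (High (G i) (g i) z ↔ High (G i) (g i) (x i))) ↔
      (0 ≤ σ * (z - oi) ∧ σ * (z - oi) < h)) →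
      shellTile G g i x = box i σ (Function.update off i oi) h := by
    intro σ oi h hz
    ext y
    constructor
    · intro hy
      have h1 := (hz (y i)).1 ((hy i).2.2 rfl)
      refine ⟨by simpa using h1.1, by simpa using h1.2, fun a ha => ?_⟩
      have h2 := hy a
      rw [Function.update_of_ne ha]
      simp only [hoff]
      split_ifs with h'
      · have := h2.1 h'; omega
      · have := h2.2.1 (hne a ha h'); omega
    · rintro ⟨h1, h2, h3⟩ a
      simp only [Function.update_self] at h1 h2
      refine ⟨fun ha => ?_, fun ha => ?_, ?_⟩
      · have := h3 a ha.ne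
        rw [Function.update_of_ne ha.ne] at this
        simp only [hoff, if_pos ha] at this
        omega
      · have := h3 a ha.ne'
        rw [Function.update_of_ne ha.ne'] at this
        simp only [hoff, if_neg (not_lt.2 ha.le)] at this
        omega
      · rintro rfl
        exact (hz (y a)).2 ⟨h1, h2⟩
  -- The point beyond the facet is near no interval in coordinate `i` but its own. Were it in `layer
  -- (i + 1)`, the same witness would put `x` into `layer i`.
  have hout : ∀ vi : ℤ, (vi - g i) / 32 = κ → (∀ κ', Near (G i) (g i) ((vi - G i) / 4) κ' → κ' = κ) →
      |vi - x i| ≤ 8 → ∀ (σ oi : ℤ), vi + σ = oi →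
      ∃ v, v + Pi.single i σ = (Function.update off i oi : Lattice (n + 2)) +
        mid (Finset.univ.erase i) ∧ v ∉ layer G g D (i + 1) ∧ ∀ a, |v a - x a| ≤ 8 := by
    intro vi hvi hnear hd σ oi hσ
    refine ⟨Function.update (off + mid (Finset.univ.erase i)) i vi, ?_, ?_, ?_⟩
    · funext a
      by_cases ha : a = i
      · subst ha; simp [hmidi, hσ]
      · simp [ha]
    · rintro ⟨y, hy, h⟩
      refine hx' ⟨y, hy, fun a => ⟨fun ha => ?_, fun ha => ?_⟩⟩
      · have h1 := (h a).1 (by omega)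
        have hai : a < i := ha
        rw [Function.update_of_ne hai.ne] at h1
        have := hmid a hai.ne
        simp only [Pi.add_apply, hoff, if_pos hai] at h1
        have h2 : (G a + 4 * ((x a - G a) / 4) + mid (Finset.univ.erase i) a - G a) / 4 =
          (x a - G a) / 4 := by omega
        rwa [h2] at h1
      · rcases lt_or_eq_of_le ha with ha' | ha'
        · have h1 := (h a).2 (by omega)
          have hai : i < a := ha'
          rw [Function.update_of_ne hai.ne'] at h1
          have := hmid a hai.ne'
          simp only [Pi.add_apply, hoff, if_neg (not_lt.2 hai.le)] at h1
          omega
        · obtain rfl : i = a := Fin.ext ha'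
          have h1 := (h i).1 (by omega)
          rw [Function.update_self] at h1
          exact (hnear _ h1).symm
    · intro a
      by_cases ha : a = i
      · subst ha; simpa using hd
      · rw [Function.update_of_ne ha]
        have := hmid a ha
        simp only [Pi.add_apply, hoff]
        rw [abs_le]
        split_ifs <;> omega
  have hoffa : ∀ (oi : ℤ) (a : Fin (n + 2)), i < a →
      Function.update off i oi a = g a + 4 * ((x a - g a) / 4) := by
    intro oi a ha
    rw [Function.update_of_ne ha.ne']
    simp only [hoff, if_neg (not_lt.2 ha.le)]
  -- The low part of the interval ends with the cell after the one containing `g + 32κ - 1`, and the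
  -- high part begins one cell before the one containing `g + 32κ + 32`. In both cases the box is
  -- entered from the middle of the interval.
  rcases low_or_high hx hx' with hlow | hhigh
  · set hi := G i + 4 * ((g i + 32 * κ - 1 - G i) / 4 + 2) - 1 with hhi
    refine ⟨-1, Function.update off i hi, hi - (g i + 32 * κ) + 1, Or.inr rfl, by omega,
      hbox _ _ _ ?_, hoffa _,
      by norm_num, fun _ => by rw [Function.update_self]; omega, hout (hi + 1) (by omega) ?_ ?_ (-1) hi (by omega)⟩
    · intro z
      unfold Low High at *
      rw [← hκ] at *
      constructor
      · rintro ⟨h1, h2, h3⟩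
        rw [h1] at h2
        omega
      · rintro ⟨h1, h2⟩
        have h3 : (z - g i) / 32 = κ := by omega
        rw [h3]
        omega
    · intro κ' h; unfold Near at h; omega
    · unfold Low at hlow; rw [← hκ] at hlow; rw [abs_le]; omega
  · set lo := G i + 4 * ((g i + 32 * κ + 32 - G i) / 4 - 1) with hlo
    refine ⟨1, Function.update off i lo, g i + 32 * κ + 32 - lo, Or.inl rfl, by omega,
      hbox _ _ _ ?_, hoffa _,
      fun _ => hhigh, by norm_num, hout (lo - 1) (by omega) ?_ ?_ 1 lo (by omega)⟩
    · intro z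
      unfold Low High at *
      rw [← hκ] at *
      constructor
      · rintro ⟨h1, h2, h3⟩
        rw [h1] at h2 h3
        omega
      · rintro ⟨h1, h2⟩
        have h3 : (z - g i) / 32 = κ := by omega
        rw [h3]
        omega
    · intro κ' h; unfold Near at h; omega
    · unfold High at hhigh; rw [← hκ] at hhigh; rw [abs_le]; omega

end Tiles

end GridShift

/-! ### The extension problem and the tiling of `C` -/

namespace GridShift

variable {n : ℕ}

/-- `s` lies at the top of `B`, at a fixed position in its cell of side `4` of the grid at `g`. -/
structure Slot (g s : Lattice (n + 2)) (B : Set (Lattice (n + 2))) : Prop where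
  aligned : Aligned g B
  mem : s ∈ B
  top : ∀ x ∈ B, x 0 ≤ s 0
  one : (s 1 - g 1) % 4 = 2
  rest : ∀ a, a ≠ 0 → a ≠ 1 → (s a - g a) % 4 = 0

/-- `l` is a tour of `C` that ends at `s + ε¹` if `s` is its starting point, which is in the
position required by `Slot` with respect to some grid. -/
def Good (C : Set (Lattice (n + 2))) (l : List (Lattice (n + 2))) : Prop :=
  IsTour (Ccw C) C l ∧ ∃ g s, Slot g s C ∧ l.head? = some s ∧
    l.getLast? = some (s + Pi.single 1 1)

/-- Otherwise the point above `s` lies in the same cube of side 32, hence in `B`. -/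
theorem Slot.zero {g s : Lattice (n + 2)} {B : Set (Lattice (n + 2))} (h : Slot g s B) :
    (s 0 - g 0) % 32 = 31 := by
  by_contra hne
  have : s + Pi.single 0 1 ∈ B := by
    refine h.aligned s _ (fun a => ?_) h.mem
    by_cases ha : a = 0
    · subst ha; simp; omega
    · simp [ha]
  have := h.top _ this
  simp at this

/-- The data of the extension problem: a region `C` aligned with the grid at `G`, and far apart
regions `D j` within `C` with good tours `w j`. -/
structure Setting (n : ℕ) (ι : Type) where
  C : Set (Lattice (n + 2))
  G : Lattice (n + 2)
  D : ι → Set (Lattice (n + 2))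
  g : ι → Lattice (n + 2)
  s : ι → Lattice (n + 2)
  w : ι → List (Lattice (n + 2))
  s₀ : Lattice (n + 2)
  finite : C.Finite
  linked : Linked C
  slot₀ : Slot G s₀ C
  slot : ∀ j, Slot (g j) (s j) (D j)
  tour : ∀ j, IsTour (Ccw (D j)) (D j) (w j)
  head : ∀ j, (w j).head? = some (s j)
  last : ∀ j, (w j).getLast? = some (s j + Pi.single 1 1)
  linked_compl : ∀ j, Linked (D j)ᶜ
  thick : ∀ j, ∀ x ∈ D j, ∀ y : Lattice (n + 2), (∀ a, |x a - y a| ≤ 32) → y ∈ C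
  apart : ∀ i j, i ≠ j → ∀ x ∈ D i, ∀ y ∈ D j, ¬ ∀ a, |x a - y a| ≤ 64

namespace Setting

variable {ι : Type} (X : Setting n ι)

/-- The layers around `D j`. -/
def L (j : ι) (m : ℕ) : Set (Lattice (n + 2)) := layer X.G (X.g j) (X.D j) m

/-- The point above the start of the tour `w j`. -/
def up (j : ι) : Lattice (n + 2) := X.s j + Pi.single 0 1

/-- The tile above the start of the tour `w j`. -/
def tip (j : ι) : Set (Lattice (n + 2)) := shellTile X.G (X.g j) 0 (X.up j)

/-- The piece formed by `D j` and the tile above the start of its tour. -/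
def piece (j : ι) : Set (Lattice (n + 2)) := X.tip j ∪ X.D j

/-- The cell of side `4` of a point. -/
def block (x : Lattice (n + 2)) : Set (Lattice (n + 2)) :=
  {y | ∀ a, (y a - X.G a) / 4 = (x a - X.G a) / 4}

/-- The pairs of points that must be consecutive in the tour to be constructed. -/
def Req (x y : Lattice (n + 2)) : Prop :=
  ∃ j, Consec (X.w j) x y ∨ (x = X.s j + Pi.single 1 1 ∧ y = X.s j + Pi.single 1 1 + Pi.single 0 1)

open Classical in
/-- The tiling of `C`. -/
noncomputable def tile (x : Lattice (n + 2)) : Set (Lattice (n + 2)) :=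
  if h : ∃ j, x ∈ X.piece j then X.piece h.choose
  else if h : ∃ q : ι × Fin (n + 2), x ∈ X.L q.1 (q.2 + 1) ∧ x ∉ X.L q.1 q.2 then
    shellTile X.G (X.g h.choose.1) h.choose.2 x
  else X.block x

variable {X}

theorem L_zero (j : ι) : X.L j 0 = X.D j := layer_zero (X.slot j).aligned

theorem L_mono (j : ι) {m m' : ℕ} (h : m ≤ m') : X.L j m ⊆ X.L j m' := layer_mono h

theorem D_subset_L (j : ι) (m : ℕ) : X.D j ⊆ X.L j m := by
  rw [← L_zero]; exact L_mono j (Nat.zero_le m)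

/-- A layer stays within distance 7 of `D j`, and 25 = 32 - 7. -/
theorem mem_C_of_L {j : ι} {m : ℕ} {x y : Lattice (n + 2)} (hx : x ∈ X.L j m)
    (h : ∀ a, |x a - y a| ≤ 25) : y ∈ X.C := by
  obtain ⟨z, hz, hxz⟩ := exists_near_of_mem_layer (X.slot j).aligned hx
  refine X.thick j z hz y fun a => ?_
  have := hxz a
  have := h a
  rw [abs_le] at *
  omega

/-- Here 50 = 64 - 2 · 7. -/
theorem L_apart {i j : ι} {m m' : ℕ} {x y : Lattice (n + 2)} (hx : x ∈ X.L i m)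
    (hy : y ∈ X.L j m') (h : ∀ a, |x a - y a| ≤ 50) : i = j := by
  by_contra hij
  obtain ⟨z, hz, hxz⟩ := exists_near_of_mem_layer (X.slot i).aligned hx
  obtain ⟨u, hu, hyu⟩ := exists_near_of_mem_layer (X.slot j).aligned hy
  refine X.apart i j hij z hz u hu fun a => ?_
  have := hxz a
  have := hyu a
  have := h a
  rw [abs_le] at *
  omega

theorem L_unique {i j : ι} {m m' : ℕ} {x : Lattice (n + 2)} (hx : x ∈ X.L i m)
    (hy : x ∈ X.L j m') : i = j := L_apart hx hy (by simp)

theorem up_notMem_D (j : ι) : X.up j ∉ X.D j := by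
  intro h
  have := (X.slot j).top _ h
  simp [up] at this

theorem up_mem_L (j : ι) : X.up j ∈ X.L j 1 := by
  refine ⟨X.s j, (X.slot j).mem, fun a => ⟨fun ha => ?_, fun ha => ?_⟩⟩
  · obtain rfl : a = 0 := Fin.ext (by simpa using ha)
    unfold Near
    simp only [up, Pi.add_apply, Pi.single_eq_same]
    omega
  · have : a ≠ 0 := by rintro rfl; simp at ha
    simp [up, this]

theorem mem_L_of_tip {j : ι} {x : Lattice (n + 2)} (hx : x ∈ X.tip j) : x ∈ X.L j 1 :=
  mem_layer_succ_of_shellTile hx (up_mem_L j)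

theorem notMem_D_of_tip {j : ι} {x : Lattice (n + 2)} (hx : x ∈ X.tip j) : x ∉ X.D j := by
  intro h
  rw [← L_zero] at h
  have h1 : X.up j ∈ shellTile X.G (X.g j) 0 x := by
    rw [shellTile_eq hx]; exact mem_shellTile_self _ _ _ _
  have := mem_layer_of_shellTile h1 h
  exact up_notMem_D (X := X) j (by rw [← L_zero]; exact this)

theorem piece_subset (j : ι) : X.piece j ⊆ X.L j 1 := by
  rintro x (hx | hx)
  · exact mem_L_of_tip hx
  · exact D_subset_L j 1 hx

/-- A required pair never leaves its piece, which is one tile. So the pairs are produced when the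
piece is attached, and points outside the pieces can be used as exits without harm. -/
theorem mem_D_of_req {x y : Lattice (n + 2)} (h : X.Req x y) :
    ∃ j, x ∈ X.D j ∧ y ∈ X.piece j := by
  obtain ⟨j, h | ⟨rfl, rfl⟩⟩ := h
  · exact ⟨j, ((X.tour j).mem x).1 h.mem_left, Or.inr (((X.tour j).mem y).1 h.mem_right)⟩
  · refine ⟨j, ((X.tour j).mem _).1 (List.mem_of_getLast? (X.last j)), Or.inl ?_⟩
    have h1 := (X.slot j).one
    intro a
    refine ⟨fun ha => absurd ha (Fin.not_lt_zero a), fun ha => ?_, ?_⟩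
    · by_cases ha1 : a = 1
      · subst ha1; simp [up]; omega
      · simp [up, ha1]
    · rintro rfl
      simp [up]

theorem tile_of_piece {j : ι} {x : Lattice (n + 2)} (hx : x ∈ X.piece j) :
    X.tile x = X.piece j := by
  have h : ∃ j, x ∈ X.piece j := ⟨j, hx⟩
  rw [tile, dif_pos h, L_unique (piece_subset _ h.choose_spec) (piece_subset _ hx)]

theorem tile_of_layer {j : ι} {i : Fin (n + 2)} {x : Lattice (n + 2)} (hx : x ∈ X.L j (i + 1))
    (hx' : x ∉ X.L j i) (hp : ∀ j, x ∉ X.piece j) : X.tile x = shellTile X.G (X.g j) i x := by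
  have h : ∃ q : ι × Fin (n + 2), x ∈ X.L q.1 (q.2 + 1) ∧ x ∉ X.L q.1 q.2 := ⟨(j, i), hx, hx'⟩
  rw [tile, dif_neg (by simpa using hp), dif_pos h]
  have hs := h.choose_spec
  have hj : h.choose.1 = j := L_unique hs.1 hx
  rw [hj] at hs ⊢
  have hi : h.choose.2 = i := by
    refine Fin.ext (le_antisymm ?_ ?_)
    · by_contra hlt
      exact hs.2 (L_mono j (by omega) hx)
    · by_contra hlt
      exact hx' (L_mono j (by omega) hs.1)
  rw [hi]

theorem tile_of_outside {x : Lattice (n + 2)} (hx : ∀ j, x ∉ X.L j (n + 2)) :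
    X.tile x = X.block x := by
  rw [tile, dif_neg, dif_neg]
  · rintro ⟨⟨j, i⟩, h, -⟩
    exact hx j (L_mono j (by omega) h)
  · rintro ⟨j, h⟩
    exact hx j (L_mono j (by omega) (piece_subset j h))

theorem exists_level {j : ι} {x : Lattice (n + 2)} (hx : x ∈ X.L j (n + 2)) (hD : x ∉ X.D j) :
    ∃ i : Fin (n + 2), x ∈ X.L j (i + 1) ∧ x ∉ X.L j i := by
  classical
  have hex : ∃ m, x ∈ X.L j m := ⟨_, hx⟩
  have h1 := Nat.find_spec hex
  have h2 : Nat.find hex ≠ 0 := by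
    intro h
    rw [h, L_zero] at h1
    exact hD h1
  obtain ⟨m, hm⟩ := Nat.exists_eq_succ_of_ne_zero h2
  have h3 : Nat.find hex ≤ n + 2 := Nat.find_min' hex hx
  refine ⟨⟨m, by omega⟩, ?_, Nat.find_min hex (by simp [hm])⟩
  rw [hm] at h1
  exact h1

theorem tile_cases (x : Lattice (n + 2)) :
    (∃ j, x ∈ X.piece j) ∨
    (∃ j, ∃ i : Fin (n + 2), x ∈ X.L j (i + 1) ∧ x ∉ X.L j i ∧ ∀ j, x ∉ X.piece j) ∨
    (∀ j, x ∉ X.L j (n + 2)) := by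
  by_cases h1 : ∃ j, x ∈ X.piece j
  · exact Or.inl h1
  · by_cases h2 : ∃ j, x ∈ X.L j (n + 2)
    · obtain ⟨j, hj⟩ := h2
      obtain ⟨i, hi, hi'⟩ := exists_level hj (fun h => h1 ⟨j, Or.inr h⟩)
      exact Or.inr (Or.inl ⟨j, i, hi, hi', by simpa using h1⟩)
    · exact Or.inr (Or.inr (by simpa using h2))

theorem notMem_piece_of_shellTile {j : ι} {i : Fin (n + 2)} {x y : Lattice (n + 2)}
    (hx : x ∈ X.L j (i + 1)) (hx' : x ∉ X.L j i) (hp : ∀ j, x ∉ X.piece j)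
    (hy : y ∈ shellTile X.G (X.g j) i x) (j' : ι) : y ∉ X.piece j' := by
  have hxy : x ∈ shellTile X.G (X.g j) i y := by
    rw [shellTile_eq hy]; exact mem_shellTile_self _ _ _ _
  have hyL := mem_layer_succ_of_shellTile hy hx
  have hyL' : y ∉ X.L j i := fun h => hx' (mem_layer_of_shellTile hxy h)
  intro hy'
  obtain rfl : j = j' := L_unique hyL (piece_subset j' hy')
  rcases hy' with h | h
  · have hi : i.val = 0 := by
      by_contra h0
      exact hyL' (L_mono j (by omega) (mem_L_of_tip h))
    obtain rfl : i = 0 := Fin.ext hi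
    refine hp j (Or.inl ?_)
    have := shellTile_eq h
    rw [shellTile_eq hy] at this
    rw [tip, ← this]
    exact mem_shellTile_self _ _ _ _
  · exact hyL' (D_subset_L j i h)

theorem mem_L_iff_of_block {j : ι} {x y : Lattice (n + 2)} (h : y ∈ X.block x) :
    y ∈ X.L j (n + 2) ↔ x ∈ X.L j (n + 2) := by
  rw [L, mem_layer_iff_coarse, mem_layer_iff_coarse, funext h]

theorem block_eq {x y : Lattice (n + 2)} (h : y ∈ X.block x) : X.block y = X.block x := by
  ext z
  simp only [block, Set.mem_ofPred_eq, h _]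

theorem mem_C_of_block {x y : Lattice (n + 2)} (h : y ∈ X.block x) (hx : x ∈ X.C) : y ∈ X.C := by
  refine X.slot₀.aligned x y (fun a => ?_) hx
  have := h a
  omega

theorem mem_block_self (x : Lattice (n + 2)) : x ∈ X.block x := fun _ => rfl

theorem tile_eq {x y : Lattice (n + 2)} (hy : y ∈ X.tile x) : X.tile y = X.tile x := by
  rcases tile_cases (X := X) x with ⟨j, hj⟩ | ⟨j, i, h1, h2, h3⟩ | h
  · rw [tile_of_piece hj] at *
    exact tile_of_piece hy
  · rw [tile_of_layer h1 h2 h3] at *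
    have hxy : x ∈ shellTile X.G (X.g j) i y := by
      rw [shellTile_eq hy]; exact mem_shellTile_self _ _ _ _
    rw [tile_of_layer (mem_layer_succ_of_shellTile hy h1)
      (fun h => h2 (mem_layer_of_shellTile hxy h))
      (notMem_piece_of_shellTile h1 h2 h3 hy), shellTile_eq hy]
  · rw [tile_of_outside h] at *
    rw [tile_of_outside (fun j => by rw [mem_L_iff_of_block hy]; exact h j), block_eq hy]

theorem mem_tile {x : Lattice (n + 2)} : x ∈ X.tile x := by
  rcases tile_cases (X := X) x with ⟨j, hj⟩ | ⟨j, i, h1, h2, h3⟩ | h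
  · rwa [tile_of_piece hj]
  · rw [tile_of_layer h1 h2 h3]; exact mem_shellTile_self _ _ _ _
  · rw [tile_of_outside h]; exact mem_block_self x

theorem tile_subset {x : Lattice (n + 2)} (hx : x ∈ X.C) : X.tile x ⊆ X.C := by
  intro y hy
  rcases tile_cases (X := X) x with ⟨j, hj⟩ | ⟨j, i, h1, h2, h3⟩ | h
  · rw [tile_of_piece hj] at hy
    exact mem_C_of_L (piece_subset j hy) (by simp)
  · rw [tile_of_layer h1 h2 h3] at hy
    exact mem_C_of_L (m := i + 1) (mem_layer_succ_of_shellTile hy h1) (by simp)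
  · rw [tile_of_outside h] at hy
    exact mem_C_of_block hy hx

/-- Points near the layers are not at the top of `C`. -/
theorem lt_top_of_L {j : ι} {m : ℕ} {x v : Lattice (n + 2)} (hx : x ∈ X.L j m)
    (hv : ∀ a, |x a - v a| ≤ 24) : v 0 ≠ X.s₀ 0 := by
  intro h
  have : v + Pi.single 0 1 ∈ X.C := by
    refine mem_C_of_L hx fun a => ?_
    have := hv a
    by_cases ha : a = 0
    · subst ha
      simp only [Pi.add_apply, Pi.single_eq_same]
      rw [abs_le] at *; omega
    · simp only [Pi.add_apply, Pi.single_eq_of_ne ha, add_zero]; omega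
  have := X.slot₀.top _ this
  simp [h] at this

/-- The cells of side `4` within `C` and outside of all layers are linked. -/
theorem linked_coarse :
    Linked ({β : Lattice (n + 2) | (fun a => X.G a + 4 * β a) ∈ X.C} \
      ⋃ j, coarse X.G (X.g j) (X.D j)) := by
  have hcell : ∀ β : Lattice (n + 2), (fun a => ((fun a => X.G a + 4 * β a : Lattice (n + 2)) a -
      X.G a) / 4) = β := by
    intro β; funext a; simp only; omega
  have hmemL : ∀ j, ∀ β ∈ coarse X.G (X.g j) (X.D j),
      (fun a => X.G a + 4 * β a : Lattice (n + 2)) ∈ X.L j (n + 2) := by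
    intro j β hβ
    rw [L, mem_layer_iff_coarse, hcell]; exact hβ
  refine Linked.diff_iUnion ?_ (fun j => linked_compl_coarse (X.slot j).aligned (X.linked_compl j))
    ?_ ?_
  · intro p hp β hβ β' hβ' hpβ
    have := X.linked (fun x => p (fun a => (x a - X.G a) / 4)) ?_ _ hβ _ hβ' (by rwa [hcell])
    · rwa [hcell] at this
    · rintro x hx y hy ⟨i, σ, hσ, hxy⟩ hpx
      have hval : ∀ a, y a = x a + (Pi.single i σ : Lattice (n + 2)) a := by
        intro a; rw [← hxy]; simp
      have hin : ∀ x ∈ X.C, (fun a => (x a - X.G a) / 4) ∈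
          {β : Lattice (n + 2) | (fun a => X.G a + 4 * β a) ∈ X.C} := by
        intro x hx
        refine X.slot₀.aligned x _ (fun a => ?_) hx
        simp only
        omega
      by_cases heq : (y i - X.G i) / 4 = (x i - X.G i) / 4
      · convert hpx using 1
        funext a
        by_cases ha : a = i
        · rw [ha]; exact heq
        · rw [hval a, Pi.single_eq_of_ne ha, add_zero]
      · refine hp _ (hin x hx) _ (hin y hy) ⟨i, σ, hσ, ?_⟩ hpx
        funext a
        by_cases ha : a = i
        · subst ha
          have := hval a
          simp only [Pi.single_eq_same] at this
          simp only [Pi.sub_apply, Pi.single_eq_same]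
          omega
        · simp only [Pi.sub_apply, Pi.single_eq_of_ne ha]
          rw [hval a, Pi.single_eq_of_ne ha, add_zero, sub_self]
  · intro j β hβ β' h
    refine mem_C_of_L (hmemL j β hβ) fun a => ?_
    have := h a
    rw [abs_le] at *
    omega
  · intro i j hij β hβ β' hβ' h
    refine hij (L_apart (hmemL i β hβ) (hmemL j β' hβ') fun a => ?_)
    have := h a
    rw [abs_le] at *
    omega

end Setting

end GridShift

/-! ### Exits from unions of tiles -/

namespace GridShift

variable {n : ℕ}

namespace Setting

variable {ι : Type} {X : Setting n ι}

theorem not_req_of_notMem {v : Lattice (n + 2)} {m : ℕ} (hm : 1 ≤ m) (hv : ∀ j, v ∉ X.L j m)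
    (x : Lattice (n + 2)) : ¬ X.Req v x ∧ ¬ X.Req x v := by
  constructor
  · intro h
    obtain ⟨j, h, -⟩ := mem_D_of_req h
    exact hv j (D_subset_L j m h)
  · intro h
    obtain ⟨j, -, h⟩ := mem_D_of_req h
    exact hv j (L_mono j hm (piece_subset j h))

/-- A union of tiles that covers a cell outside of the layers but not a neighbouring one can be
left through the latter. -/
theorem attach_outside {x y : Lattice (n + 2)} (hx : ∀ j, x ∉ X.L j (n + 2))
    (hy : ∀ j, y ∉ X.L j (n + 2)) {i : Fin (n + 2)} {σ : ℤ} (hσ : σ = 1 ∨ σ = -1)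
    (hxy : ∀ a, (y a - X.G a) / 4 = (x a - X.G a) / 4 + (Pi.single i σ : Lattice (n + 2)) a) :
    ∃ e v, v ∈ X.tile x ∧ v ≠ X.s₀ ∧ v ≠ X.s₀ + Pi.single 1 1 ∧
      (∀ z, ¬ X.Req v z ∧ ¬ X.Req z v) ∧ Attach X.Req (X.tile y) e (v + e) := by
  set o : Lattice (n + 2) := fun a =>
    X.G a + 4 * ((y a - X.G a) / 4) + if a = i ∧ σ = -1 then 3 else 0 with ho
  set v : Lattice (n + 2) := o + mid (Finset.univ.erase i) - Pi.single i σ with hv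
  have hmid : ∀ a, a ≠ i → mid (Finset.univ.erase i) a = if a = 1 then 1 else 2 := by
    intro a ha; simp [mid, ha]
  have hmidi : mid (Finset.univ.erase i) i = 0 := by simp [mid]
  have hvne : ∀ a, a ≠ i → (v a - X.G a) % 4 = if a = 1 then 1 else 2 := by
    intro a ha
    simp only [hv, Pi.sub_apply, Pi.add_apply, Pi.single_eq_of_ne ha, hmid a ha, ho, ha, false_and,
      if_false]
    split_ifs <;> omega
  have hvx : v ∈ X.block x := by
    intro a
    have := hxy a
    by_cases ha : a = i
    · subst ha
      simp only [Pi.single_eq_same] at this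
      simp only [hv, ho, Pi.sub_apply, Pi.add_apply, Pi.single_eq_same, hmidi]
      rcases hσ with rfl | rfl <;> simp <;> omega
    · have h2 := hvne a ha
      simp only [Pi.single_eq_of_ne ha] at this
      simp only [hv, Pi.sub_apply, Pi.add_apply, Pi.single_eq_of_ne ha, hmid a ha, ho, ha,
        false_and, if_false]
      split_ifs <;> omega
  have hbox : X.block y = box i σ o 4 := by
    ext z
    constructor
    · intro hz
      refine ⟨?_, ?_, fun a ha => ?_⟩
      · have := hz i
        rcases hσ with rfl | rfl <;> simp [ho] <;> omega
      · have := hz i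
        rcases hσ with rfl | rfl <;> simp [ho] <;> omega
      · have := hz a
        simp [ho, ha]; omega
    · rintro ⟨h1, h2, h3⟩ a
      by_cases ha : a = i
      · subst ha
        rcases hσ with rfl | rfl <;> simp [ho] at h1 h2 <;> omega
      · have := h3 a ha
        simp [ho, ha] at this; omega
  have hs0 := X.slot₀.zero
  have hs1 := X.slot₀.one
  -- Residues modulo 4 keep `v` away from both ends of the tour. In coordinate 1 the ends have
  -- residues 2 and 3 but `v` has 1, unless `i = 1`; then coordinate 0 distinguishes 3 from 2. This
  -- explains the asymmetric choice of `mid`.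
  refine ⟨Pi.single i σ, v, ?_, ?_, ?_, ?_, ?_⟩
  · rw [tile_of_outside hx]; exact hvx
  · intro h
    by_cases hi : i = 1
    · have := hvne 0 (by rw [hi]; simp)
      rw [h] at this
      simp at this; omega
    · have := hvne 1 (fun h => hi h.symm)
      rw [h] at this
      simp at this; omega
  · intro h
    by_cases hi : i = 1
    · have := hvne 0 (by rw [hi]; simp)
      rw [h] at this
      simp at this; omega
    · have := hvne 1 (fun h => hi h.symm)
      rw [h] at this
      simp at this; omega
  · exact not_req_of_notMem (m := n + 2) (by omega) (fun j => by rw [mem_L_iff_of_block hvx]; exact hx j)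
  · rw [tile_of_outside hy, hbox, hv, sub_add_cancel]
    refine attach_box hσ o (by norm_num) fun z u hzu hz => ?_
    obtain ⟨j, hj, -⟩ := mem_D_of_req hzu
    rw [← hbox] at hz
    exact hy j ((mem_L_iff_of_block hz).1 (D_subset_L j _ hj))

/-- Every tile of a layer can be entered from a point outside of this layer. -/
theorem attach_layer {j : ι} {i : Fin (n + 2)} {x : Lattice (n + 2)} (hx : x ∈ X.L j (i + 1))
    (hx' : x ∉ X.L j i) : ∃ e v, (v ∈ X.C ∧ ∀ j', v ∉ X.L j' (i + 1)) ∧ v ≠ X.s₀ ∧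
      v ≠ X.s₀ + Pi.single 1 1 ∧ (∀ z, ¬ X.Req v z ∧ ¬ X.Req z v) ∧
      Attach X.Req (X.tile x) e (v + e) := by
  -- All points of a piece have the same tile, so a point of the tip may be replaced by the one
  -- above the start of `w j`.
  wlog hp : (∀ j, x ∉ X.piece j) ∨ x = X.up j generalizing x
  · have hp' : ∃ j, x ∈ X.piece j := by by_contra h; exact hp (Or.inl (by simpa using h))
    obtain ⟨j', hj'⟩ := hp'
    obtain rfl : j = j' := L_unique hx (piece_subset j' hj')
    have hxt : x ∈ X.tip j := hj'.resolve_right (fun h => hx' (D_subset_L j _ h))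
    have hi : i.val = 0 := by
      by_contra h0
      exact hx' (L_mono j (by omega) (mem_L_of_tip hxt))
    obtain rfl : i = 0 := Fin.ext hi
    have hup : X.up j ∈ X.piece j := Or.inl (mem_shellTile_self _ _ _ _)
    have := this (up_mem_L j) (by
      have := up_notMem_D (X := X) j
      rw [← L_zero] at this
      exact this) (Or.inr rfl)
    rwa [tile_of_piece hup, ← tile_of_piece hj'] at this
  · obtain ⟨σ, o, h, hσ, hh, hbox, ho, hhigh, hlow, v, hv, hvL, hvx⟩ :=
      exists_box_shellTile hx hx'
    have hvL' : ∀ j', v ∉ X.L j' (i + 1) := by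
      intro j' hj'
      have : j' = j := L_apart hj' hx (fun a => (hvx a).trans (by norm_num))
      subst this
      exact hvL hj'
    have htop : v 0 ≠ X.s₀ 0 := lt_top_of_L hx fun a => by
      have := hvx a
      rw [abs_le] at *; omega
    refine ⟨Pi.single i σ, v, ⟨mem_C_of_L hx fun a => ?_, hvL'⟩, ?_, ?_,
      not_req_of_notMem (m := i + 1) (by omega) hvL', ?_⟩
    · have := hvx a
      rw [abs_le] at *; omega
    · rintro rfl; exact htop rfl
    · rintro rfl; exact htop (by simp)
    · rw [hv]
      rcases hp with hp | rfl
      · rw [tile_of_layer hx hx' hp, hbox]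
        refine attach_box hσ o hh fun z u hzu hz => ?_
        obtain ⟨j', hj', -⟩ := mem_D_of_req hzu
        rw [← hbox] at hz
        exact notMem_piece_of_shellTile hx hx' hp hz j' (Or.inr hj')
      · have hi : i.val = 0 := by
          by_contra h0
          exact hx' (L_mono j (by omega) (up_mem_L j))
        obtain rfl : i = 0 := Fin.ext hi
        have hz := (X.slot j).zero
        have hup0 : X.up j 0 = X.s j 0 + 1 := by simp [up]
        -- The start of `w j` is the last point of its interval of length 32 in coordinate 0, so the
        -- point above it is the first of the next interval and is not high: the box is entered from
        -- above.
        have hσ' : σ = -1 := by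
          refine hσ.resolve_left fun h1 => ?_
          have := hhigh h1
          unfold High at this
          rw [hup0] at this
          omega
        subst hσ'
        obtain ⟨H, hH⟩ := Int.eq_ofNat_of_zero_le (show 0 ≤ h - 2 by omega)
        obtain rfl : h = H + 2 := by omega
        have htile : X.tile (X.up j) = box 0 (-1) o (H + 2) ∪ X.D j := by
          rw [tile_of_piece (Or.inl (mem_shellTile_self _ _ _ _)), piece, tip, hbox]
        rw [htile]
        refine attach_tip_box o H (X.tour j) (X.head j) (X.last j) ?_ ?_ ?_
        · rw [← hbox]
          exact Set.disjoint_left.2 fun z hz => notMem_D_of_tip hz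
        · have h0 := hlow rfl
          rw [hup0] at h0
          funext a
          by_cases ha : a = 0
          · subst ha
            simp
            omega
          · have h1 := ho a (Fin.pos_of_ne_zero ha)
            have h2 : X.up j a = X.s j a := by simp [up, ha]
            rw [h2] at h1
            by_cases ha1 : a = 1
            · subst ha1
              have := (X.slot j).one
              simp [h1]
              omega
            · have := (X.slot j).rest a ha ha1
              simp [ha, ha1, h1]
              omega
        · rintro z u ⟨j', hj'⟩ hzB
          rw [← htile, tile_of_piece (Or.inl (mem_shellTile_self _ _ _ _))] at hzB
          obtain ⟨j'', hz'', -⟩ := mem_D_of_req (X := X) ⟨j', hj'⟩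
          have hz' : z ∈ X.D j' := by
            rcases hj' with h | ⟨rfl, -⟩
            · exact ((X.tour j').mem z).1 h.mem_left
            · exact ((X.tour j').mem _).1 (List.mem_of_getLast? (X.last j'))
          obtain rfl : j = j' := L_unique (piece_subset j hzB) (D_subset_L j' 0 hz')
          exact hj'

/-- If no tile could be attached, `S` would contain every cell outside the layers, since `s₀` lies
in one of them and they are linked. By descending induction on `m` it would contain every point of
`C` outside the `m`-th layers, because each tile of `layer (m + 1)` outside `layer m` can be entered
from outside `layer (m + 1)`. Finally, the tile of `up j` contains `D j`. -/
theorem exists_attach {S : Set (Lattice (n + 2))} (hSC : S ⊆ X.C) (hs : X.s₀ ∈ S)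
    (hsat : ∀ x ∈ S, X.tile x ⊆ S) (hne : S ≠ X.C) :
    ∃ x ∈ X.C, x ∉ S ∧ ∃ e v, v ∈ S ∧ v ≠ X.s₀ ∧ v ≠ X.s₀ + Pi.single 1 1 ∧
      (∀ x, ¬ X.Req v x ∧ ¬ X.Req x v) ∧ Attach X.Req (X.tile x) e (v + e) := by
  by_contra hcon
  have hno : ∀ x ∈ X.C, x ∉ S → ∀ e v, v ∈ S → v ≠ X.s₀ → v ≠ X.s₀ + Pi.single 1 1 →
      (∀ x, ¬ X.Req v x ∧ ¬ X.Req x v) → ¬ Attach X.Req (X.tile x) e (v + e) :=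
    fun x hx hxS e v h1 h2 h3 h4 h5 => hcon ⟨x, hx, hxS, e, v, h1, h2, h3, h4, h5⟩
  have hcorner : ∀ x : Lattice (n + 2),
      (fun a => X.G a + 4 * ((x a - X.G a) / 4) : Lattice (n + 2)) ∈ X.block x := by
    intro x a; simp only; omega
  have hcell : ∀ β : Lattice (n + 2), (fun a => ((fun a => X.G a + 4 * β a : Lattice (n + 2)) a -
      X.G a) / 4) = β := by
    intro β; funext a; simp only; omega
  have hs₀L : ∀ j, X.s₀ ∉ X.L j (n + 2) := fun j h => lt_top_of_L h (by simp) rfl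
  have hiff : ∀ x, (∀ j, x ∉ X.L j (n + 2)) →
      (x ∈ S ↔ (fun a => X.G a + 4 * ((x a - X.G a) / 4) : Lattice (n + 2)) ∈ S) := by
    intro x hx
    have hc := hcorner x
    constructor
    · intro h
      have := hsat x h
      rw [tile_of_outside hx] at this
      exact this hc
    · intro h
      have := hsat _ h
      rw [tile_of_outside (fun j => by rw [mem_L_iff_of_block hc]; exact hx j), block_eq hc] at this
      exact this (mem_block_self x)
  have hout : ∀ x ∈ X.C, (∀ j, x ∉ X.L j (n + 2)) → x ∈ S := by
    intro x hx hxL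
    have hmem : ∀ z ∈ X.C, (∀ j, z ∉ X.L j (n + 2)) → (fun a => (z a - X.G a) / 4) ∈
        ({β : Lattice (n + 2) | (fun a => X.G a + 4 * β a) ∈ X.C} \
          ⋃ j, coarse X.G (X.g j) (X.D j)) := by
      intro z hz hzL
      refine ⟨mem_C_of_block (hcorner z) hz, fun h => ?_⟩
      obtain ⟨j, hj⟩ := Set.mem_iUnion.1 h
      exact hzL j (mem_layer_iff_coarse.2 hj)
    rw [hiff x hxL]
    refine linked_coarse (X := X) (fun β => (fun a => X.G a + 4 * β a : Lattice (n + 2)) ∈ S) ?_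
      _ (hmem _ (hSC hs) hs₀L) _ (hmem x hx hxL) ((hiff _ hs₀L).1 hs)
    rintro β ⟨hβ, hβL⟩ β' ⟨hβ', hβL'⟩ ⟨i, σ, hσ, h⟩ hβS
    by_contra hβS'
    have hL : ∀ β : Lattice (n + 2), (β ∉ ⋃ j, coarse X.G (X.g j) (X.D j)) → ∀ j,
        (fun a => X.G a + 4 * β a : Lattice (n + 2)) ∉ X.L j (n + 2) := by
      intro β hβ j hj
      rw [L, mem_layer_iff_coarse, hcell] at hj
      exact hβ (Set.mem_iUnion.2 ⟨j, hj⟩)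
    obtain ⟨e, v, hv, h1, h2, h3, h4⟩ := attach_outside (hL β hβL) (hL β' hβL') (i := i) hσ (by
      intro a
      have := congrFun h a
      simp only [Pi.sub_apply] at this
      omega)
    exact hno _ hβ' hβS' e v (hsat _ hβS hv) h1 h2 h3 h4
  have hlayer : ∀ k m, m + k = n + 2 → ∀ x ∈ X.C, (∀ j, x ∉ X.L j m) → x ∈ S := by
    intro k
    induction k with
    | zero => intro m hm; obtain rfl : m = n + 2 := by omega
              exact hout
    | succ k ih =>
      intro m hm x hx hxm
      by_cases h : ∃ j, x ∈ X.L j (m + 1)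
      · obtain ⟨j, hj⟩ := h
        by_contra hxS
        obtain ⟨e, v, ⟨hvC, hvL⟩, h1, h2, h3, h4⟩ :=
          attach_layer (i := ⟨m, by omega⟩) hj (hxm j)
        exact hno x hx hxS e v (ih (m + 1) (by omega) v hvC hvL) h1 h2 h3 h4
      · exact ih (m + 1) (by omega) x hx (by simpa using h)
  refine hne (Set.Subset.antisymm hSC fun x hx => ?_)
  by_cases h : ∃ j, x ∈ X.D j
  · obtain ⟨j, hj⟩ := h
    have hup : X.up j ∈ X.piece j := Or.inl (mem_shellTile_self _ _ _ _)
    have hupS : X.up j ∈ S := by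
      refine hlayer (n + 2) 0 (by omega) _ (mem_C_of_L (up_mem_L j) (by simp)) fun j' hj' => ?_
      obtain rfl : j' = j := L_unique hj' (up_mem_L j)
      rw [L_zero] at hj'
      exact up_notMem_D j' hj'
    have := hsat _ hupS
    rw [tile_of_piece hup] at this
    exact this (Or.inr hj)
  · refine hlayer (n + 2) 0 (by omega) x hx fun j hj => ?_
    rw [L_zero] at hj
    exact h ⟨j, hj⟩

theorem exists_tour (X : Setting n ι) : ∃ l, IsTour (Ccw X.C) X.C l ∧ l.head? = some X.s₀ ∧
    l.getLast? = some (X.s₀ + Pi.single 1 1) ∧ ∀ x y, X.Req x y → x ∈ X.C → Consec l x y := by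
  have hs₀L : ∀ j, X.s₀ ∉ X.L j (n + 2) := fun j h => lt_top_of_L h (by simp) rfl
  set o : Lattice (n + 2) := X.s₀ - Pi.single 1 2 with ho
  have hbox : X.block X.s₀ = box 0 (-1) o 4 := by
    have h0 := X.slot₀.zero
    have h1 := X.slot₀.one
    ext z
    constructor
    · intro hz
      have hz0 := hz 0
      refine ⟨by simp [ho]; omega, by simp [ho]; omega, fun a ha => ?_⟩
      have hza := hz a
      by_cases ha1 : a = 1
      · subst ha1; simp [ho]; omega
      · have := X.slot₀.rest a ha ha1
        simp [ho, ha1]; omega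
    · rintro ⟨h2, h3, h4⟩ a
      by_cases ha : a = 0
      · subst ha; simp [ho] at h2 h3; omega
      · have h5 := h4 a ha
        by_cases ha1 : a = 1
        · subst ha1; simp [ho] at h5; omega
        · have := X.slot₀.rest a ha ha1
          simp [ho, ha1] at h5; omega
  obtain ⟨l, hl, hls, hlt⟩ := exists_base_tour o
  have hs : o + Pi.single 1 2 = X.s₀ := by rw [ho]; abel
  have ht : o + Pi.single 1 3 = X.s₀ + Pi.single 1 1 := by
    rw [show (3 : ℤ) = 2 + 1 by norm_num, ← single_add_single, ← add_assoc, hs]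
  rw [hs] at hls
  rw [ht] at hlt
  have htile : X.tile X.s₀ = box 0 (-1) o 4 := by rw [tile_of_outside hs₀L, hbox]
  rw [← htile] at hl
  refine exists_tour_of_attach X.finite X.tile (fun x hx => ⟨mem_tile, tile_subset hx⟩)
    (fun x _ y hy => tile_eq hy) (fun S h1 h2 h3 h4 => exists_attach h1 h2 h3 h4)
    (tile_subset X.slot₀.mem) (fun x hx => (tile_eq hx).le) hl hls hlt ?_
  intro x y hxy hx
  exfalso
  obtain ⟨j, hj, -⟩ := mem_D_of_req hxy
  rw [tile_of_outside hs₀L] at hx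
  exact hs₀L j ((mem_L_iff_of_block hx).1 (D_subset_L j _ hj))

end Setting

/-- A finite region aligned with a grid has a point in the position required by `Slot`. -/
theorem exists_slot {G : Lattice (n + 2)} {C : Set (Lattice (n + 2))} (hG : Aligned G C)
    (hC : C.Finite) (hne : C.Nonempty) : ∃ s, Slot G s C := by
  obtain ⟨z, hz, hmax⟩ := hC.exists_maximalFor (fun x : Lattice (n + 2) => x 0) C hne
  refine ⟨fun a => if a = 0 then z 0 else if a = 1 then G 1 + 4 * ((z 1 - G 1) / 4) + 2
    else G a + 4 * ((z a - G a) / 4), hG, ?_, ?_, ?_, ?_⟩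
  · refine hG z _ (fun a => ?_) hz
    split_ifs with h0 h1
    · rw [h0]
    · subst h1; omega
    · omega
  · intro x hx
    simp only [if_true]
    rcases le_total (x 0) (z 0) with h | h
    · exact h
    · exact hmax hx h
  · simp; omega
  · intro a h0 h1
    simp [h0, h1]

/-- The extension theorem for tours. -/
theorem exists_good {ι : Type} {C : Set (Lattice (n + 2))} {G : Lattice (n + 2)}
    (hC : C.Finite) (hG : Aligned G C) (hne : C.Nonempty) (hL : Linked C)
    (D : ι → Set (Lattice (n + 2))) (w : ι → List (Lattice (n + 2)))
    (hD : ∀ j, Linked (D j)ᶜ) (hw : ∀ j, Good (D j) (w j))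
    (hthick : ∀ j, ∀ x ∈ D j, ∀ y : Lattice (n + 2), (∀ a, |x a - y a| ≤ 32) → y ∈ C)
    (hapart : ∀ i j, i ≠ j → ∀ x ∈ D i, ∀ y ∈ D j, ¬ ∀ a, |x a - y a| ≤ 64) :
    ∃ l, Good C l ∧ ∀ j, (∀ x y, Consec (w j) x y → Consec l x y) ∧
      ∀ t, (w j).getLast? = some t → Consec l t (t + Pi.single 0 1) := by
  choose htour g s hslot hhead hlast using hw
  obtain ⟨s₀, hs₀⟩ := exists_slot hG hC hne
  let X : Setting n ι := ⟨C, G, D, g, s, w, s₀, hC, hL, hs₀, hslot, htour, hhead, hlast, hD, hthick,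
    hapart⟩
  obtain ⟨l, hl, h1, h2, h3⟩ := X.exists_tour
  have hDC : ∀ j, ∀ x ∈ D j, x ∈ C := fun j x hx => hthick j x hx x (by simp)
  refine ⟨l, ⟨hl, G, s₀, hs₀, h1, h2⟩, fun j => ⟨fun x y hxy => ?_, fun t ht => ?_⟩⟩
  · exact h3 x y ⟨j, Or.inl hxy⟩ (hDC j x (((htour j).mem x).1 hxy.mem_left))
  · have : t = s j + Pi.single 1 1 := by
      have := hlast j
      rw [ht] at this
      exact Option.some.inj this
    subst this
    exact h3 _ _ ⟨j, Or.inr ⟨rfl, rfl⟩⟩ (hDC j _ (((htour j).mem _).1 (List.mem_of_getLast? ht)))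

end GridShift

namespace GridShift

variable {n : ℕ}

/-! ### Grid unions and cubes -/

section GridUnion

theorem IsGridUnion.aligned {d : ℕ} {C : Finset (Lattice d)} (h : IsGridUnion 32 C) :
    ∃ G, Aligned G (C : Set (Lattice d)) := by
  obtain ⟨⟨γ, T, hT, hC⟩, -, -⟩ := h
  -- The cubes are `γ + t + [1,32]^d`, with lowest corner `γ + t + 1`.
  refine ⟨γ + 1, fun x y hxy hx => ?_⟩
  rw [hC] at hx ⊢
  obtain ⟨-, ⟨δ, hδ, t, ht, rfl⟩, u, hu, rfl⟩ := hx
  refine ⟨δ + t, ⟨δ, hδ, t, ht, rfl⟩, y - (δ + t), ⟨fun a => ?_, fun a => ?_⟩, by simp⟩ <;>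
  · obtain ⟨q, hq⟩ := hT t ht a
    have h1 := hu.1 a
    have h2 := hu.2 a
    have h3 := hxy a
    have h4 := congrFun hδ a
    simp only [Pi.add_apply, Pi.one_apply, Pi.sub_apply] at h1 h2 h3 ⊢
    omega

/-- The cube of side `64 M` around the origin. -/
noncomputable def cube (d M : ℕ) : Finset (Lattice d) :=
  Finset.Icc (fun _ => -(32 * (M : ℤ))) (fun _ => 32 * (M : ℤ) - 1)

theorem mem_cube {d M : ℕ} {x : Lattice d} :
    x ∈ cube d M ↔ ∀ a, -(32 * (M : ℤ)) ≤ x a ∧ x a ≤ 32 * (M : ℤ) - 1 := by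
  simp only [cube, Finset.mem_Icc, Pi.le_def, forall_and]

theorem linked_cube (d M : ℕ) : Linked (cube d M : Set (Lattice d)) := by
  intro p hp x hx y hy
  refine propagate_of_box hp fun z hz => ?_
  rw [Finset.mem_coe, mem_cube] at *
  intro a
  have := hx a
  have := hy a
  have := hz a
  omega

/-- The complement is a union of half-spaces. Two of them in different coordinates intersect, and
two opposite ones both meet a third in another coordinate, which exists because the dimension is at
least two. -/
theorem linked_compl_cube (M : ℕ) : Linked ((cube (n + 2) M : Set (Lattice (n + 2)))ᶜ) := by
  intro p hp x hx y hy hpx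
  set c : Fin (n + 2) → Bool → Lattice (n + 2) → Prop := fun i b x =>
    if b then 32 * (M : ℤ) ≤ x i else x i < -(32 * (M : ℤ)) with hc
  have hcube : ∀ x, x ∈ ((cube (n + 2) M : Set (Lattice (n + 2)))ᶜ) ↔ ∃ i b, c i b x := by
    intro x
    rw [Set.mem_compl_iff, Finset.mem_coe, mem_cube, not_forall]
    refine exists_congr fun i => ?_
    rw [Bool.exists_bool]
    simp only [hc, if_true, Bool.false_eq_true, if_false]
    omega
  have h1 : ∀ i b x y, c i b x → c i b y → p x → p y := by
    intro i b x y hx hy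
    refine propagate_of_box hp fun z hz => (hcube z).2 ⟨i, b, ?_⟩
    have := hz i
    cases b <;> simp [hc] at * <;> omega
  have h2 : ∀ i k b b' x y, i ≠ k → c i b x → c k b' y → p x → p y := by
    intro i k b b' x y hik hx hy hpx
    set z : Lattice (n + 2) := fun a => if a = i then x i else y k with hz
    have hzi : z i = x i := by simp [hz]
    have hzk : z k = y k := by simp [hz, hik.symm]
    refine h1 k b' z y ?_ hy (h1 i b x z hx ?_ hpx)
    · simpa only [hc, hzk] using hy
    · simpa only [hc, hzi] using hx
  obtain ⟨i, b, hx⟩ := (hcube x).1 hx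
  obtain ⟨j, b', hy⟩ := (hcube y).1 hy
  by_cases hij : i = j
  · subst hij
    obtain ⟨k, hk⟩ := exists_ne i
    obtain ⟨z, hz⟩ : ∃ z, c k true z := ⟨fun _ => 32 * (M : ℤ), by simp [hc]⟩
    exact h2 k i true b' z y hk hz hy (h2 i k b true x z hk.symm hx hz hpx)
  · exact h2 i j _ _ _ _ hij hx hy hpx

theorem isGridUnion_cube {M : ℕ} (hM : 1 ≤ M) : IsGridUnion 32 (cube (n + 2) M) := by
  refine ⟨⟨fun _ => -1, {t | ∀ i, (32 : ℤ) ∣ t i ∧ -(32 * (M : ℤ)) ≤ t i ∧ t i < 32 * (M : ℤ)},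
    fun t ht i => (ht i).1, ?_⟩, ?_, ?_⟩
  · ext x
    rw [Finset.mem_coe, mem_cube]
    constructor
    · intro hx
      refine ⟨(fun _ => -1) + fun a => 32 * (x a / 32),
        ⟨_, rfl, fun a => 32 * (x a / 32), fun a => ⟨⟨_, rfl⟩, ?_⟩, rfl⟩,
        fun a => x a % 32 + 1, ⟨fun a => ?_, fun a => ?_⟩, funext fun a => ?_⟩
      · have := hx a
        show _ ≤ 32 * (x a / 32) ∧ 32 * (x a / 32) < _
        omega
      · simp only
        omega
      · simp only
        omega
      · simp only [Pi.add_apply]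
        omega
    · rintro ⟨-, ⟨_, rfl, t, ht, rfl⟩, u, hu, rfl⟩ a
      have h1 := ht a
      have h2 := hu.1 a
      have h3 := hu.2 a
      simp only [Pi.add_apply] at *
      omega
  · refine (linked_cube _ _).connected ⟨0, ?_⟩
    rw [Finset.mem_coe, mem_cube]
    intro a
    simp
    omega
  · refine (linked_compl_cube _).connected ⟨fun _ => 32 * (M : ℤ), ?_⟩
    rw [Set.mem_compl_iff, Finset.mem_coe, mem_cube]
    intro h
    have := h 0
    omega

theorem thicken_cube_subset {d M : ℕ} :
    thicken 32 (cube d M) ⊆ (cube d (M + 1) : Set (Lattice d)) := by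
  rintro _ ⟨x, hx, u, hu, rfl⟩
  rw [Finset.mem_coe, mem_cube] at *
  intro a
  have h1 := hx a
  have h2 := hu.1 a
  have h3 := hu.2 a
  simp only [Pi.add_apply] at *
  push_cast at *
  omega

theorem exists_thicken_subset_cube {d : ℕ} (C : Finset (Lattice d)) :
    ∃ M, 1 ≤ M ∧ thicken 32 C ⊆ (cube d M : Set (Lattice d)) := by
  refine ⟨∑ x ∈ C, ∑ a, (x a).natAbs + 2, by omega, ?_⟩
  rintro _ ⟨x, hx, u, hu, rfl⟩
  rw [Finset.mem_coe, mem_cube]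
  intro a
  have h1 : (x a).natAbs ≤ ∑ x ∈ C, ∑ a, (x a).natAbs :=
    (Finset.single_le_sum (f := fun a => (x a).natAbs) (fun _ _ => Nat.zero_le _)
      (Finset.mem_univ a)).trans
      (Finset.single_le_sum (f := fun x : Lattice d => ∑ a, (x a).natAbs)
        (fun _ _ => Nat.zero_le _) hx)
  have h2 := hu.1 a
  have h3 := hu.2 a
  generalize ∑ x ∈ C, ∑ a, (x a).natAbs = K at h1 ⊢
  simp only [Pi.add_apply] at *
  push_cast at h2 h3 ⊢
  omega

theorem exists_mem_cube {d : ℕ} (x : Lattice d) : ∃ M, ∀ M' ≥ M, x ∈ cube d M' := by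
  refine ⟨∑ a, (x a).natAbs + 1, fun M' hM => mem_cube.2 fun a => ?_⟩
  have : (x a).natAbs ≤ ∑ a, (x a).natAbs := Finset.single_le_sum
    (f := fun a => (x a).natAbs) (fun _ _ => Nat.zero_le _) (Finset.mem_univ a)
  omega

theorem mem_of_thicken_subset {d m : ℕ} {D : Finset (Lattice d)} {C : Set (Lattice d)}
    (h : thicken m D ⊆ C) {x y : Lattice d} (hx : x ∈ D) (hxy : ∀ a, |x a - y a| ≤ m) :
    y ∈ C := by
  refine h ⟨x, hx, y - x, ⟨fun a => ?_, fun a => ?_⟩, by simp⟩ <;>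
  · have := abs_le.1 (hxy a)
    simp only [Pi.sub_apply]
    omega

end GridUnion

/-! ### The patterns of good tours and their extension -/

/-- `y` follows `x` on the path that leaves the list `l` upwards. -/
def Next (l : List (Lattice (n + 2))) (x y : Lattice (n + 2)) : Prop :=
  Consec l x y ∨ (l.getLast? = some x ∧ y = x + Pi.single 0 1)

theorem exists_next {l : List (Lattice (n + 2))} {x : Lattice (n + 2)} (hx : x ∈ l) :
    ∃ y, Next l x y := by
  by_cases h : l.getLast? = some x
  · exact ⟨_, Or.inr ⟨h, rfl⟩⟩
  · obtain ⟨y, hy⟩ := exists_consec_right hx h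
    exact ⟨y, Or.inl hy⟩

theorem Next.unique {l : List (Lattice (n + 2))} (hl : l.Nodup) {x y z : Lattice (n + 2)}
    (hy : Next l x y) (hz : Next l x z) : y = z := by
  rcases hy with hy | ⟨h, rfl⟩ <;> rcases hz with hz | ⟨h', rfl⟩
  · exact hy.right_unique hl hz
  · exact absurd hy (getLast?_not_consec hl h')
  · exact absurd hz (getLast?_not_consec hl h)
  · rfl

/-- The patterns given by the good tours of `C`. -/
def tourPatterns (C : Finset (Lattice (n + 2))) : Set (C → UnitVector (n + 2)) :=
  {p | ∃ l, Good (C : Set (Lattice (n + 2))) l ∧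
    ∀ x y, Next l x y → ∀ h : x ∈ C, x + (p ⟨x, h⟩).1 = y}

theorem exists_unitVector {d : ℕ} {v : Lattice d} (h : IsStep v) : ∃ u : UnitVector d, u.1 = v := by
  obtain ⟨i, σ, rfl | rfl, rfl⟩ := h
  · exact ⟨⟨_, i, Or.inl rfl⟩, rfl⟩
  · exact ⟨⟨_, i, Or.inr (Pi.single_neg i 1)⟩, rfl⟩

theorem exists_pattern {C : Finset (Lattice (n + 2))} {l : List (Lattice (n + 2))}
    (hl : Good (C : Set (Lattice (n + 2))) l) : ∃ p : C → UnitVector (n + 2),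
      ∀ x y, Next l x y → ∀ h : x ∈ C, x + (p ⟨x, h⟩).1 = y := by
  have : ∀ x : C, ∃ u : UnitVector (n + 2), ∀ y, Next l x.1 y → x.1 + u.1 = y := by
    intro x
    obtain ⟨y, hy⟩ := exists_next ((hl.1.mem x).2 x.2)
    have hstep : IsStep (y - x.1) := by
      rcases hy with hy | ⟨-, rfl⟩
      · exact (hl.1.rel _ _ hy).1
      · rw [add_sub_cancel_left]
        exact isStep_single 0 (Or.inl rfl)
    obtain ⟨u, hu⟩ := exists_unitVector hstep
    refine ⟨u, fun z hz => ?_⟩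
    rw [hu, add_sub_cancel]
    exact hy.unique hl.1.nodup hz
  choose p hp using this
  exact ⟨p, fun x y hxy h => hp ⟨x, h⟩ y hxy⟩

theorem hasExtension_tourPatterns :
    HasExtension 32 32 (tourPatterns : (C : Finset (Lattice (n + 2))) → _) := by
  intro C r D p hC hD hp hdisj hsub
  obtain ⟨G, hG⟩ := hC.aligned
  choose w hw hpw using hp
  obtain ⟨l, hl, hlw⟩ := exists_good (C := (C : Set (Lattice (n + 2)))) C.finite_toSet hG
    (Set.nonempty_coe_sort.1 hC.2.1.nonempty) (Linked.of_connected hC.2.1)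
    (fun j => (D j : Set (Lattice (n + 2)))) w (fun j => Linked.of_connected (hD j).2.2) hw
    (fun j x hx y hxy => mem_of_thicken_subset (hsub j) hx (by exact_mod_cast hxy))
    -- Two points at distance at most 64 have a common point of their 32-thickenings, namely the
    -- midpoint rounded down.
    (fun i j hij x hx y hy hxy => by
      refine Set.disjoint_left.1 (hdisj i j hij)
        (?_ : (fun a => (x a + y a) / 2 : Lattice (n + 2)) ∈ _) ?_
      · refine mem_of_thicken_subset subset_rfl hx fun a => ?_
        have := abs_le.1 (hxy a)
        rw [abs_le]
        push_cast
        omega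
      · refine mem_of_thicken_subset subset_rfl hy fun a => ?_
        have := abs_le.1 (hxy a)
        rw [abs_le]
        push_cast
        omega)
  obtain ⟨c, hc⟩ := exists_pattern hl
  refine ⟨c, ⟨l, hl, hc⟩, fun j δ hδ hδC => ?_⟩
  obtain ⟨y, hy⟩ := exists_next (((hw j).1.mem δ).2 hδ)
  have h1 := hpw j δ y hy hδ
  have h2 : Consec l δ y := by
    rcases hy with hy | ⟨hy, rfl⟩
    · exact (hlw j).1 _ _ hy
    · exact (hlw j).2 _ hy
  have h3 := hc δ y (Or.inl h2) hδC
  exact Subtype.ext (add_left_cancel (h3.trans h1.symm))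

/-! ### Limits and the language -/

section Limits

theorem forall_of_consec {α : Type*} {R : α → α → Prop} (hR : Equivalence R) {l : List α}
    (hl : ∀ x y, Consec l x y → R x y) : ∀ x ∈ l, ∀ y ∈ l, R x y := by
  suffices ∀ c l, (∀ x y, Consec (c :: l) x y → R x y) → ∀ x ∈ c :: l, R c x by
    cases l with
    | nil => simp
    | cons c l =>
      exact fun x hx y hy => hR.trans (hR.symm (this c l hl x hx)) (this c l hl y hy)
  intro c l
  induction l generalizing c with
  | nil => intro _ x hx; rw [List.mem_singleton.1 hx]; exact hR.refl c
  | cons b l ih =>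
    intro h x hx
    rcases List.mem_cons.1 hx with rfl | hx
    · exact hR.refl _
    · exact hR.trans (h c b ⟨[], l, rfl⟩) (ih b (fun x y hxy => h x y (by
        rw [consec_cons]; exact Or.inr hxy)) x hx)

/-- A permutation of an infinite type with a single orbit is conjugate to the shift of `ℤ`. -/
theorem exists_equiv_int {α : Type*} [Infinite α] (σ : Equiv.Perm α) (a : α)
    (h : ∀ b, ∃ k : ℤ, (σ ^ k) a = b) : ∃ e : ℤ ≃ α, ∀ k, e (k + 1) = σ (e k) := by
  have hinj : Function.Injective fun k : ℤ => (σ ^ k) a := by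
    intro k k' hk
    by_contra hne
    -- A repetition would make the orbit of `a`, which is everything, finite.
    have hfix : (σ ^ (k - k')) a = a := by
      rw [sub_eq_neg_add, zpow_add, Equiv.Perm.mul_apply, zpow_neg, Equiv.Perm.inv_eq_iff_eq]
      exact hk
    have hfin : (Set.univ : Set α).Finite := by
      refine ((Set.finite_Icc 0 |k - k'|).image fun k : ℤ => (σ ^ k) a).subset fun b _ => ?_
      obtain ⟨m, rfl⟩ := h b
      refine ⟨m % (k - k'), ⟨Int.emod_nonneg _ (sub_ne_zero.2 hne),
        (Int.emod_lt_abs _ (sub_ne_zero.2 hne)).le⟩, ?_⟩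
      conv_rhs => rw [← Int.emod_add_mul_ediv m (k - k'), zpow_add, Equiv.Perm.mul_apply, zpow_mul,
        Equiv.Perm.zpow_apply_eq_self_of_apply_eq_self hfix]
    exact Set.infinite_univ hfin
  refine ⟨Equiv.ofBijective _ ⟨hinj, h⟩, fun k => ?_⟩
  show (σ ^ (k + 1)) a = σ ((σ ^ k) a)
  rw [add_comm, zpow_add, zpow_one,
    Equiv.Perm.mul_apply]

/-- Both ends of a good tour have maximal height in `C`. This is what removes the ends in the limit.
-/
theorem Good.interior {C : Set (Lattice (n + 2))} {l : List (Lattice (n + 2))} (hl : Good C l)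
    {v : Lattice (n + 2)} (hv : v + Pi.single 0 1 ∈ C) :
    l.head? ≠ some v ∧ l.getLast? ≠ some v := by
  obtain ⟨-, g, s, hs, h1, h2⟩ := hl
  have := hs.top _ hv
  rw [h1, h2]
  constructor <;>
  · rintro h
    rw [← Option.some_injective _ h] at this
    simp at this

/-- Every point eventually has a predecessor and a successor on the tours, so `v ↦ v + x_v` is a
permutation; any two points eventually lie on the same tour, so it has a single orbit. -/
theorem hasLimits_tourPatterns : HasLimits (hamiltonianPaths (n + 2)) 32
    (tourPatterns : (C : Finset (Lattice (n + 2))) → _) := by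
  intro x C _ hmono hcover hx
  choose l hl hxl using hx
  have hnext : ∀ m u v, Consec (l m) u v → u + (x u).1 = v := fun m u v h =>
    hxl m u v (Or.inl h) (((hl m).1.mem u).1 h.mem_left)
  have hev : ∀ v, ∃ N, ∀ m ≥ N, v ∈ l m ∧ (∃ u, Consec (l m) u v) ∧ ∃ w, Consec (l m) v w := by
    intro v
    obtain ⟨N, hN⟩ := hcover v
    obtain ⟨N', hN'⟩ := hcover (v + Pi.single 0 1)
    refine ⟨max N N', fun m hm => ?_⟩
    have hv : v ∈ l m := ((hl m).1.mem v).2 (hmono ((le_max_left _ _).trans hm) hN)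
    obtain ⟨h1, h2⟩ := (hl m).interior (hmono ((le_max_right _ _).trans hm) hN')
    exact ⟨hv, exists_consec_left hv h1, exists_consec_right hv h2⟩
  have hinj : Function.Injective fun v => v + (x v).1 := by
    intro u v huv
    obtain ⟨N, hN⟩ := hev u
    obtain ⟨N', hN'⟩ := hev v
    obtain ⟨-, -, u', hu⟩ := hN _ (le_max_left N N')
    obtain ⟨-, -, v', hv⟩ := hN' _ (le_max_right N N')
    have : u' = v' := by rw [← hnext _ _ _ hu, ← hnext _ _ _ hv]; exact huv
    subst this
    exact hu.left_unique (hl _).1.nodup hv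
  have hsurj : Function.Surjective fun v => v + (x v).1 := by
    intro v
    obtain ⟨N, hN⟩ := hev v
    obtain ⟨-, ⟨u, hu⟩, -⟩ := hN N le_rfl
    exact ⟨u, hnext _ _ _ hu⟩
  set σ : Equiv.Perm (Lattice (n + 2)) := Equiv.ofBijective _ ⟨hinj, hsurj⟩ with hσ
  have horbit : ∀ b, ∃ k : ℤ, (σ ^ k) 0 = b := by
    intro b
    obtain ⟨N, hN⟩ := hev 0
    obtain ⟨N', hN'⟩ := hev b
    refine forall_of_consec (Equiv.Perm.SameCycle.equivalence σ) (fun u v huv => ⟨1, ?_⟩) 0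
      (hN _ (le_max_left N N')).1 b (hN' _ (le_max_right N N')).1
    exact hnext _ _ _ huv
  obtain ⟨e, he⟩ := exists_equiv_int σ 0 horbit
  exact ⟨e, he⟩

end Limits

/-- The extension property for a single subregion, iterated along growing cubes each of which
contains the 32-thickening of its predecessor, yields configurations that stabilise; their limit is
a Hamiltonian path by the limit property. -/
theorem tourPatterns_subset_language {C : Finset (Lattice (n + 2))} (hC : IsGridUnion 32 C) :
    tourPatterns C ⊆ language (hamiltonianPaths (n + 2)) C := by
  intro p hp
  obtain ⟨M, hM, hCM⟩ := exists_thicken_subset_cube C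
  set Q : ℕ → Finset (Lattice (n + 2)) := fun m => Nat.casesOn m C fun m => cube (n + 2) (M + m)
    with hQ
  have hQ0 : Q 0 = C := rfl
  have hQs : ∀ m, Q (m + 1) = cube (n + 2) (M + m) := fun m => rfl
  have hgrid : ∀ m, IsGridUnion 32 (Q m) := by
    intro m
    cases m with
    | zero => exact hC
    | succ m => exact isGridUnion_cube (by omega)
  have hthick : ∀ m, thicken 32 (Q m) ⊆ (Q (m + 1) : Set (Lattice (n + 2))) := by
    intro m
    cases m with
    | zero => exact hCM
    | succ m => exact thicken_cube_subset
  have hmono : Monotone Q := monotone_nat_of_le_succ fun m x hx =>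
    mem_of_thicken_subset (hthick m) hx (by simp)
  have hcover : ∀ δ, ∃ m, δ ∈ Q m := fun δ => by
    obtain ⟨N, hN⟩ := exists_mem_cube δ
    exact ⟨N + 1, hN _ (by omega)⟩
  have hstep : ∀ m (y : Lattice (n + 2) → UnitVector (n + 2)),
      (Q m).restrict y ∈ tourPatterns (Q m) → ∃ y' : Lattice (n + 2) → UnitVector (n + 2),
        (Q (m + 1)).restrict y' ∈ tourPatterns (Q (m + 1)) ∧
        ∀ δ ∈ Q m, y' δ = y δ := by
    intro m y hy
    obtain ⟨c, hc, hcy⟩ := hasExtension_tourPatterns (Q (m + 1)) 1 (fun _ => Q m)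
      (fun _ => (Q m).restrict y) (hgrid (m + 1)) (fun _ => hgrid m) (fun _ => hy)
      (fun i j hij => absurd (Subsingleton.elim i j) hij) (fun _ => hthick m)
    classical
    refine ⟨fun δ => if h : δ ∈ Q (m + 1) then c ⟨δ, h⟩ else y δ, ?_, fun δ hδ => ?_⟩
    · convert hc
      ext1 δ
      simp
    · have h := hmono (Nat.le_succ m) hδ
      exact (dif_pos h).trans (hcy 0 δ hδ h)
  choose f hf hfy using hstep
  obtain ⟨y₀, hy₀⟩ : ∃ y : Lattice (n + 2) → UnitVector (n + 2), C.restrict y = p := by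
    classical
    refine ⟨fun δ => if h : δ ∈ C then p ⟨δ, h⟩ else ⟨_, 0, Or.inl rfl⟩, ?_⟩
    ext1 δ
    simp
  let Y : (m : ℕ) → {y : Lattice (n + 2) → UnitVector (n + 2) //
      (Q m).restrict y ∈ tourPatterns (Q m)} := fun m =>
    Nat.rec ⟨y₀, (hy₀ ▸ hp : C.restrict y₀ ∈ tourPatterns C)⟩
      (fun m y => ⟨f m y.1 y.2, hf m y.1 y.2⟩) m
  have hY : ∀ m k, ∀ δ ∈ Q m, (Y (m + k)).1 δ = (Y m).1 δ := by
    intro m k δ hδ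
    induction k with
    | zero => rfl
    | succ k ih => exact (hfy (m + k) _ _ δ (hmono (Nat.le_add_right m k) hδ)).trans ih
  choose N hN using hcover
  have hlim : ∀ m, ∀ δ ∈ Q m, (Y (N δ)).1 δ = (Y m).1 δ := by
    intro m δ hδ
    rw [← hY _ m δ (hN δ), ← hY _ (N δ) δ hδ, add_comm (N δ)]
  have hrestrict : ∀ m, (Q m).restrict (fun δ => (Y (N δ)).1 δ) = (Q m).restrict (Y m).1 :=
    fun m => funext fun δ => hlim m δ δ.2
  refine ⟨fun δ => (Y (N δ)).1 δ, hasLimits_tourPatterns _ Q hgrid hmono (fun δ => ⟨N δ, hN δ⟩)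
    fun m => ?_, (hrestrict 0).trans hy₀⟩
  rw [hrestrict]
  exact (Y m).2

/-! ### Translates of good tours -/

section Translation

theorem Good.map {C C' : Set (Lattice (n + 2))} {l : List (Lattice (n + 2))} (hl : Good C l)
    {α : Lattice (n + 2)} (h : ∀ x, α + x ∈ C' ↔ x ∈ C) : Good C' (l.map (α + ·)) := by
  obtain ⟨hl, g, s, hs, h1, h2⟩ := hl
  have h' : ∀ x, x ∈ C' ↔ x - α ∈ C := fun x => by rw [← h, add_sub_cancel]
  refine ⟨⟨hl.nodup.map (add_right_injective α), ?_, ?_⟩, α + g, α + s, ⟨?_, ?_, ?_, ?_, ?_⟩, ?_, ?_⟩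
  · intro x y hxy
    obtain ⟨u, v, huv, rfl, rfl⟩ := consec_map.1 hxy
    have := hl.rel _ _ huv
    rw [Ccw, StepRel, add_sub_add_left_eq_sub, add_assoc, add_assoc, h, h]
    exact this
  · intro x
    rw [h', ← hl.mem, List.mem_map]
    exact ⟨fun ⟨u, hu, hx⟩ => by rw [← hx, add_sub_cancel_left]; exact hu,
      fun hx => ⟨_, hx, add_sub_cancel _ _⟩⟩
  · intro x y hxy
    rw [h', h']
    refine hs.aligned _ _ fun a => ?_
    have := hxy a
    simp only [Pi.sub_apply, Pi.add_apply] at *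
    rwa [sub_sub, sub_sub]
  · rw [h]; exact hs.mem
  · intro x hx
    have := hs.top _ ((h' x).1 hx)
    simp only [Pi.sub_apply, Pi.add_apply] at *
    omega
  · simpa using hs.one
  · intro a h0 h1
    simpa using hs.rest a h0 h1
  · rw [List.head?_map, h1]; rfl
  · rw [List.getLast?_map, h2, Option.map_some, add_assoc]

theorem Next.of_map {l : List (Lattice (n + 2))} {α x y : Lattice (n + 2)}
    (h : Next (l.map (α + ·)) x y) : Next l (-α + x) (-α + y) := by
  rcases h with h | ⟨h, rfl⟩
  · obtain ⟨u, v, huv, rfl, rfl⟩ := consec_map.1 h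
    rw [neg_add_cancel_left, neg_add_cancel_left]
    exact Or.inl huv
  · rw [List.getLast?_map, Option.map_eq_some_iff] at h
    obtain ⟨u, hu, rfl⟩ := h
    rw [neg_add_cancel_left, add_assoc, neg_add_cancel_left]
    exact Or.inr ⟨hu, rfl⟩

theorem tourPatterns_vadd (α : Lattice (n + 2)) (C : Finset (Lattice (n + 2))) :
    tourPatterns (α +ᵥ C) = translate α '' tourPatterns C := by
  have hmem : ∀ x, α + x ∈ α +ᵥ C ↔ x ∈ C := fun x => Finset.vadd_mem_vadd_finset_iff α
  ext q
  constructor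
  · rintro ⟨l, hl, hq⟩
    refine ⟨fun x => q ⟨α + x.1, (hmem x.1).2 x.2⟩, ⟨l.map (-α + ·), hl.map fun x => ?_, ?_⟩, ?_⟩
    · rw [Finset.mem_coe, Finset.mem_coe, ← hmem, add_neg_cancel_left]
    · intro x y hxy hx
      have h1 := hxy.of_map
      rw [neg_neg] at h1
      have h2 := hq _ _ h1 ((hmem x).2 hx)
      rw [add_assoc] at h2
      exact add_left_cancel h2
    · funext δ
      simp only [translate, add_neg_cancel_left]
  · rintro ⟨p, ⟨l, hl, hp⟩, rfl⟩
    refine ⟨l.map (α + ·), hl.map hmem, fun x y hxy hx => ?_⟩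
    have h1 := hp _ _ hxy.of_map ((hmem _).1 (by rw [add_neg_cancel_left]; exact hx))
    rw [add_assoc] at h1
    exact add_left_cancel h1

end Translation

end GridShift

theorem theorem11p2 (d : ℕ) (hd : 2 ≤ d) :
    GridShift.HasPropertyF (GridShift.hamiltonianPaths d) := by
  obtain ⟨n, rfl⟩ := Nat.exists_eq_add_of_le' hd
  exact ⟨32, 32, by norm_num, GridShift.tourPatterns,
    ⟨fun _ hC => GridShift.tourPatterns_subset_language hC,
      fun C _ α => GridShift.tourPatterns_vadd α C⟩,
    GridShift.hasExtension_tourPatterns, GridShift.hasLimits_tourPatterns⟩
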